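/- A (nondeterministic Turing) machine is a tuple $M=\langle Q,\Gamma,\delta\rangle$ with a finite set $Q$ of states containing the initial state $q_0$, a finite tape alphabet $\Gamma\supseteq\{0,1\}$ that does not contain the blank $\mathtt B$, and a transition function $\delta : Q\times(\Gamma\cup\{\mathtt B\})\to\mathcal P(Q\times\Gamma\times\{\leftarrow,\rightarrow\})$. A configuration is a tuple $\langle n,t,p,q\rangle$ with $n\ge 1$, a tape $t:\{1,\dots,n\}\to\Gamma\cup\{\mathtt B\}$ such that $t(n)=\mathtt B$ and $t(i)=\mathtt B$ implies $t(i+1)=\mathtt B$ for $1\le i<n$, a head position $p\in\{1,\dots,n\}$ and a state $q\in Q$. Its successor configurations are the configurations $\langle n+1,t',p',r\rangle$ for which there is some $\langle r,a,d\rangle\in\delta(t(p),q)$ with $d={\rightarrow}$ or $p\ge 2$, such that $t'(p)=a$, $t'(n+1)=\mathtt B$, $t'(i)=t(i)$ for all other $i$, and $p'=p+1$ if $d={\rightarrow}$, $p'=p-1$ if $d={\leftarrow}$. A run of $M$ on a configuration $\rho$ is a finite or infinite sequence of configurations that starts with $\rho$, in which each further element is a successor of the preceding one, and which, if finite, ends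 in a configuration without successors. A run on a word $w=w_1\cdots w_\ell\in\{0,1\}^*$ is a run on the starting configuration $\langle \ell+1,\,w_1\cdots w_\ell\mathtt B,\,1,\,q_0\rangle$. Let $q_r\in Q$. The machine $M$ is *non-recurring through $q_r$ on $w$* if every run of $M$ on $w$ features $q_r$ only finitely many times; *universally non-recurring through $q_r$* if it is non-recurring through $q_r$ on every word $w\in\{0,1\}^*$; and *robust non-recurring through $q_r$* if every run of $M$ on any configuration features $q_r$ only finitely many times. **Proposition.** Each of the following three decision problems, whose input is a pair $(M,q_r)$ of a machine and one of its states, is $\Pi^1_1$-complete: 1. Is $M$ non-recurring through $q_r$ on the empty word $\varepsilon$? 2. Is $M$ universally non-recurring through $q_r$? 3. Is $M$ robust non-recurring through $q_r$? Here a problem is identified with the set of natural numbers coding its positive instances (under a standard effective coding of pairs $(M,q_r)$). A set $A\subseteq\mathbb N$ is $\Pi^1_1$ if it can be defined in the standard model of arithmetic by a formula $\forall X_1\cdots\forall X_k\,\varphi(x,X_1,\dots,X_k)$, with set variables $X_i$ ranging over subsets of $\mathbb N$ and $\varphi$ a formula of arithmetic without set quantifiers; and $A$ is $\Pi^1_1$-complete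 if it is $\Pi^1_1$ and every $\Pi^1_1$ set is many-one reducible to $A$ by a computable function. -/

import Mathlib

/-! ### The class `Π¹₁` and completeness -/

/-- Function symbols of arithmetic: `0`, `1`, `+`, `·`. -/
inductive ArithFunc : ℕ → Type
  | zero : ArithFunc 0
  | one : ArithFunc 0
  | add : ArithFunc 2
  | mul : ArithFunc 2

/-- Relation symbols: a unary symbol for each second-order (set) variable `X₀, X₁, …`; the atomic
formula `set i t` is read `t ∈ Xᵢ`. -/
inductive ArithRel : ℕ → Type
  | set (i : ℕ) : ArithRel 1

/-- The language of second-order arithmetic.  Its first-order formulas are the formulas of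
second-order arithmetic without set quantifiers. -/
def arithLang : FirstOrder.Language := ⟨ArithFunc, ArithRel⟩

/-- The standard model `(ℕ, 0, 1, +, ·)`, with the set variable `Xᵢ` interpreted by `X i`. -/
@[reducible]
def natModel (X : ℕ → Set ℕ) : arithLang.Structure ℕ where
  funMap := fun {_} f =>
    match f with
    | ArithFunc.zero => fun _ => 0
    | ArithFunc.one => fun _ => 1
    | ArithFunc.add => fun v => v 0 + v 1
    | ArithFunc.mul => fun v => v 0 * v 1
  RelMap := fun {_} R =>
    match R with
    | ArithRel.set i => fun v => v 0 ∈ X i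

/-- `A ⊆ ℕ` is `Π¹₁`: there is a formula `φ(x, X₀, X₁, …)` without set quantifiers such that
`n ∈ A` iff `∀ X₀ X₁ …, φ(n, X₀, X₁, …)` holds in the standard model.  Only finitely many set
variables occur in `φ`, so this is a finite block of universal set quantifiers. -/
def IsPi11 (A : Set ℕ) : Prop :=
  ∃ φ : arithLang.Formula Unit, ∀ n : ℕ,
    n ∈ A ↔ ∀ X : ℕ → Set ℕ,
      @FirstOrder.Language.Formula.Realize arithLang ℕ (natModel X) Unit φ (fun _ => n)

/-- `A` is `Π¹₁`-complete: it is `Π¹₁`, and every `Π¹₁` set is many-one reducible to it by a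
computable function. -/
def IsPi11Complete (A : Set ℕ) : Prop :=
  IsPi11 A ∧ ∀ B : Set ℕ, IsPi11 B → ManyOneReducible (fun n => n ∈ B) (fun n => n ∈ A)

/-! ### Nondeterministic Turing machines -/

/-- Moves of the head. -/
inductive Dir
  | left
  | right

/-- A nondeterministic Turing machine `⟨Q, Γ, δ⟩`.  As states and symbols only matter up to
renaming, `Q = {0, …, k}` with initial state `0`, and `Γ = {0, …, m + 1}`, which contains `0` and
`1`.  The blank, which does not belong to `Γ` and cannot be written, is `none : Option Γ`. -/
structure NDTM where
  k : ℕ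
  m : ℕ
  δ : Option (Fin (m + 2)) → Fin (k + 1) → Set (Fin (k + 1) × Fin (m + 2) × Dir)

namespace NDTM

/-- The set `Q` of states. -/
abbrev State (M : NDTM) : Type := Fin (M.k + 1)

/-- The tape alphabet `Γ`. -/
abbrev Symbol (M : NDTM) : Type := Fin (M.m + 2)

/-- A configuration `⟨n, t, p, q⟩`.  Tape positions are `1, …, n`; the function `t` on
`{1, …, n}` is extended by the blank to all of `ℕ`, to have a unique representation. -/
structure Config (M : NDTM) where
  n : ℕ
  t : ℕ → Option M.Symbol
  p : ℕ
  q : M.State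
  outside : ∀ i, i = 0 ∨ n < i → t i = none
  last_blank : t n = none
  blank_succ : ∀ i, 1 ≤ i → i < n → t i = none → t (i + 1) = none
  one_le_p : 1 ≤ p
  p_le_n : p ≤ n

/-- `M.Next ρ` is the set of all configurations `⟨n + 1, t', p', r⟩` that arise from
`ρ = ⟨n, t, p, q⟩` by some `⟨r, a, d⟩ ∈ δ(t(p), q)`, where a left move needs `p ≥ 2`, and `t'` is
`t` with `a` written at `p` and a blank at the new position `n + 1`. -/
def Next (M : NDTM) (ρ : M.Config) : Set M.Config :=
  {ρ' | ∃ r a d, (r, a, d) ∈ M.δ (ρ.t ρ.p) ρ.q ∧ (d = Dir.right ∨ 2 ≤ ρ.p) ∧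
    ρ'.n = ρ.n + 1 ∧
    ρ'.t = Function.update ρ.t ρ.p (some a) ∧
    ρ'.p = (match d with
      | Dir.left => ρ.p - 1
      | Dir.right => ρ.p + 1) ∧
    ρ'.q = r}

/-- The possibly infinite sequence `S` (`none` from its end on) is a run of `M` on `ρ₁`. -/
def IsRun (M : NDTM) (ρ₁ : M.Config) (S : ℕ → Option M.Config) : Prop :=
  S 0 = some ρ₁ ∧
  (∀ i, S i = none → S (i + 1) = none) ∧
  ∀ i ρ, S i = some ρ →
    (∃ ρ' ∈ M.Next ρ, S (i + 1) = some ρ') ∨ (M.Next ρ = ∅ ∧ S (i + 1) = none)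

/-- Every run of `M` on `ρ` features the state `qr` only finitely many times. -/
def NonRecurringFrom (M : NDTM) (qr : M.State) (ρ : M.Config) : Prop :=
  ∀ S, M.IsRun ρ S → {i | ∃ ρ', S i = some ρ' ∧ ρ'.q = qr}.Finite

/-- The letter `0` or `1` as a tape symbol. -/
def bit (M : NDTM) (b : Bool) : M.Symbol := if b then 1 else 0

/-- The contents `w₁ … wₗ B` of the tape for the input word `w`. -/
def inputTape (M : NDTM) (w : List Bool) : ℕ → Option M.Symbol
  | 0 => none
  | i + 1 => (w[i]?).map M.bit

/-- The starting configuration `⟨|w| + 1, w₁ … wₗ B, 1, q₀⟩` on the word `w`. -/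
def start (M : NDTM) (w : List Bool) : M.Config where
  n := w.length + 1
  t := M.inputTape w
  p := 1
  q := 0
  outside := by
    rintro (_ | i) hi
    · rfl
    · have h : w.length ≤ i := by omega
      simp [inputTape, h]
  last_blank := by simp [inputTape]
  blank_succ := by
    rintro (_ | i) h1 _ h
    · omega
    · simp only [inputTape, Option.map_eq_none_iff, List.getElem?_eq_none_iff] at h ⊢
      omega
  one_le_p := le_rfl
  p_le_n := by omega

/-- `M` is non-recurring through `qr` on the word `w`. -/
def NonRecurringOn (M : NDTM) (qr : M.State) (w : List Bool) : Prop :=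
  M.NonRecurringFrom qr (M.start w)

/-- `M` is universally non-recurring through `qr`. -/
def UniversallyNonRecurring (M : NDTM) (qr : M.State) : Prop :=
  ∀ w : List Bool, M.NonRecurringOn qr w

/-- `M` is robust non-recurring through `qr`. -/
def RobustNonRecurring (M : NDTM) (qr : M.State) : Prop :=
  ∀ ρ : M.Config, M.NonRecurringFrom qr ρ

/-! ### The decision problems as sets of codes -/

/-- The transition `⟨r, a, d⟩ ∈ δ(s, q)` written as a tuple of numbers. -/
def transitionCode (M : NDTM) :
    M.State × Option M.Symbol × M.State × M.Symbol × Dir → ℕ × Option ℕ × ℕ × ℕ × Bool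
  | (q, s, r, a, d) =>
    (q.val, s.map Fin.val, r.val, a.val,
      match d with
      | Dir.left => false
      | Dir.right => true)

/-- `c` is a code of the pair `(M, qr)`: it is the number of `(k, m, qr, l)` for some list `l` of
all transitions of `M` (in any order, repetitions allowed). -/
def IsCode (c : ℕ) (M : NDTM) (qr : M.State) : Prop :=
  ∃ l : List (M.State × Option M.Symbol × M.State × M.Symbol × Dir),
    (∀ q s r a d, (q, s, r, a, d) ∈ l ↔ (r, a, d) ∈ M.δ s q) ∧
    c = Encodable.encode (M.k, M.m, qr.val, l.map M.transitionCode)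

/-- The set of all codes of pairs `(M, qr)` with the property `P`. -/
def codesOf (P : (M : NDTM) → M.State → Prop) : Set ℕ :=
  {c | ∃ (M : NDTM) (qr : M.State), IsCode c M qr ∧ P M qr}

end NDTM

/-! Upper bound. A run that features `qr` infinitely often is infinite, so it is a sequence of
configurations, and such a sequence is coded by one function `F : ℕ → ℕ` (lengths, head positions,
states, tape cells). That `F` codes a computation of the described machine which starts as required
and recurs is arithmetical in `F`; hence non-recurrence has the form "for all `F`, not ...", which
is `Π¹₁` (`isPi11_codesOf`). Definability rests on Gödel's β-function (`UDef.graph`).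

Lower bound. Robust non-recurrence implies universal non-recurrence, which implies non-recurrence on
the empty word. So one reduction serves all three problems, provided that it sends `n ∈ B` to a
robust non-recurring machine and `n ∉ B` to a machine that recurs on the empty word
(`IsPi11.exists_reduction`).

By Skolemization, `n ∉ B` holds iff some function has only good initial segments
(`IsPi11.exists_initialSegment`). Equivalently, a primitive recursive relation `T n` has an infinite
chain; the chain can be taken to start at `0`, while a chain from any starting point already yields
`n ∉ B` (`IsPi11.exists_chain`). The machine keeps a number `s`, guesses `y` by counting up for an
arbitrary time, checks `T n s y`, halts on failure, and otherwise passes once through `qr` and goes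
on with `y` in place of `s`. A run may guess forever, but then it does not recur; a recurring run
completes every guess and thus traces a chain. Conversely, a chain tells the machine what to guess.

Robustness. The search program runs on a counter machine with unary counters stored on parallel
tracks of the tape. Every tape content represents some counter values, since beyond the end of the
tape all bits count as zero. Each round rewrites `n` and clears all registers but the current
number, so after the first visit to `qr` an arbitrary configuration influences only the start of the
chain. -/

section
open FirstOrder FirstOrder.Language

/-! ### Definability in second-order arithmetic -/

/-- A relation between set variables and numbers that is uniformly defined by a formula of
arithmetic without set quantifiers. -/
def UDef {α : Type} (R : (ℕ → Set ℕ) → (α → ℕ) → Prop) : Prop :=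
  ∃ φ : arithLang.Formula α, ∀ X v,
    @FirstOrder.Language.Formula.Realize arithLang ℕ (natModel X) α φ v ↔ R X v

/-- A function of finitely many numbers that is the value of a term of arithmetic. -/
def UTerm {α : Type} (f : (α → ℕ) → ℕ) : Prop :=
  ∃ t : arithLang.Term α, ∀ X v, @FirstOrder.Language.Term.realize arithLang ℕ (natModel X) α v t = f v

namespace UTerm
variable {α : Type} {f g : (α → ℕ) → ℕ}

theorem var (i : α) : UTerm fun v : α → ℕ => v i := ⟨.var i, fun _ _ => rfl⟩

theorem zero : UTerm fun _ : α → ℕ => 0 :=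
  ⟨.func (ArithFunc.zero : arithLang.Functions 0) ![], fun _ _ => rfl⟩

theorem one : UTerm fun _ : α → ℕ => 1 :=
  ⟨.func (ArithFunc.one : arithLang.Functions 0) ![], fun _ _ => rfl⟩

theorem add : UTerm f → UTerm g → UTerm fun v => f v + g v := by
  rintro ⟨t, ht⟩ ⟨s, hs⟩
  refine ⟨.func (ArithFunc.add : arithLang.Functions 2) ![t, s], fun X v => ?_⟩
  exact congrArg₂ (· + ·) (ht X v) (hs X v)

theorem mul : UTerm f → UTerm g → UTerm fun v => f v * g v := by
  rintro ⟨t, ht⟩ ⟨s, hs⟩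
  refine ⟨.func (ArithFunc.mul : arithLang.Functions 2) ![t, s], fun X v => ?_⟩
  exact congrArg₂ (· * ·) (ht X v) (hs X v)

end UTerm

namespace UDef
variable {α β : Type} {R S : (ℕ → Set ℕ) → (α → ℕ) → Prop} {f g : (α → ℕ) → ℕ}

theorem of_iff (h : UDef R) (H : ∀ X v, S X v ↔ R X v) : UDef S :=
  let ⟨φ, hφ⟩ := h
  ⟨φ, fun X v => (hφ X v).trans (H X v).symm⟩

theorem not : UDef R → UDef fun X v => ¬ R X v := by
  rintro ⟨φ, hφ⟩
  refine ⟨φ.not, fun X v => ?_⟩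
  let _ := natModel X
  rw [Formula.realize_not, hφ]

theorem and : UDef R → UDef S → UDef fun X v => R X v ∧ S X v := by
  rintro ⟨φ, hφ⟩ ⟨ψ, hψ⟩
  refine ⟨φ ⊓ ψ, fun X v => ?_⟩
  let _ := natModel X
  rw [Formula.realize_inf, hφ, hψ]

theorem imp (hR : UDef R) (hS : UDef S) : UDef fun X v => R X v → S X v :=
  (hR.and hS.not).not.of_iff fun X v => by tauto

theorem or (hR : UDef R) (hS : UDef S) : UDef fun X v => R X v ∨ S X v :=
  (hR.not.and hS.not).not.of_iff fun X v => by tauto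

theorem reindex (σ : α → β) : UDef R → UDef fun X (v : β → ℕ) => R X fun i => v (σ i) := by
  rintro ⟨φ, hφ⟩
  refine ⟨φ.relabel σ, fun X v => ?_⟩
  let _ := natModel X
  rw [Formula.realize_relabel, hφ]; rfl

theorem ex {R : (ℕ → Set ℕ) → (α → ℕ) → ℕ → Prop}
    (h : UDef fun X (v : α ⊕ Unit → ℕ) => R X (fun i => v (.inl i)) (v (.inr ()))) :
    UDef fun X v => ∃ a, R X v a := by
  obtain ⟨φ, hφ⟩ := h
  refine ⟨φ.iExs Unit, fun X v => ?_⟩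
  let _ := natModel X
  rw [Formula.realize_iExs]
  constructor
  · rintro ⟨i, hi⟩
    exact ⟨i (), (hφ _ _).1 hi⟩
  · rintro ⟨a, ha⟩
    exact ⟨fun _ => a, (hφ _ _).2 ha⟩

theorem all {R : (ℕ → Set ℕ) → (α → ℕ) → ℕ → Prop}
    (h : UDef fun X (v : α ⊕ Unit → ℕ) => R X (fun i => v (.inl i)) (v (.inr ()))) :
    UDef fun X v => ∀ a, R X v a :=
  (ex (R := fun X v a => ¬ R X v a) h.not).not.of_iff fun X v => by simp

theorem eq : UTerm f → UTerm g → UDef fun _ v => f v = g v := by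
  rintro ⟨t, ht⟩ ⟨s, hs⟩
  refine ⟨t.equal s, fun X v => ?_⟩
  let _ := natModel X
  rw [Formula.realize_equal, ht, hs]

theorem mem (k : ℕ) : UTerm f → UDef fun X v => f v ∈ X k := by
  rintro ⟨t, ht⟩
  refine ⟨Relations.formula₁ (ArithRel.set k : arithLang.Relations 1) t, fun X v => ?_⟩
  let _ := natModel X
  refine Formula.realize_rel₁.trans ?_
  rw [ht]
  rfl

theorem lt (hf : UTerm f) (hg : UTerm g) : UDef fun _ v => f v < g v := by
  refine of_iff (R := fun X v => ∃ a, f v + a + 1 = g v) (ex ?_) fun X v => ?_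
  · have hf' : UTerm fun v : α ⊕ Unit → ℕ => f fun i => v (.inl i) := by
      obtain ⟨t, ht⟩ := hf
      refine ⟨t.relabel .inl, fun X v => ?_⟩
      let _ := natModel X
      rw [Term.realize_relabel, ht]; rfl
    have hg' : UTerm fun v : α ⊕ Unit → ℕ => g fun i => v (.inl i) := by
      obtain ⟨t, ht⟩ := hg
      refine ⟨t.relabel .inl, fun X v => ?_⟩
      let _ := natModel X
      rw [Term.realize_relabel, ht]; rfl
    exact eq ((hf'.add (.var _)).add .one) hg'
  · constructor
    · intro h; exact ⟨g v - f v - 1, by omega⟩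
    · rintro ⟨a, h⟩; omega

theorem pair (i j k : α) : UDef fun _ v => v k = Nat.pair (v i) (v j) := by
  refine of_iff (R := fun X v => (v i < v j ∧ v k = v j * v j + v i) ∨
    (¬ v i < v j ∧ v k = v i * v i + v i + v j)) ?_ fun X v => ?_
  · exact ((lt (.var i) (.var j)).and (eq (.var k) (((UTerm.var j).mul (.var j)).add (.var i)))).or
      ((lt (.var i) (.var j)).not.and
        (eq (.var k) ((((UTerm.var i).mul (.var i)).add (.var i)).add (.var j))))
  · unfold Nat.pair
    split_ifs with h <;> simp [h]

/-- The β-function is a remainder, and a remainder is characterized by the existence of a quotient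
together with a strict bound. -/
theorem beta (i j k : α) : UDef fun _ v => v k = Nat.beta (v i) (v j) := by
  refine of_iff (R := fun X v => ∃ a b q, v i = Nat.pair a b ∧ v k < (v j + 1) * b + 1 ∧
    a = q * ((v j + 1) * b + 1) + v k) (ex (ex (ex ?_))) fun X v => ?_
  · have hm : UTerm fun v : ((α ⊕ Unit) ⊕ Unit) ⊕ Unit → ℕ =>
        (v (.inl (.inl (.inl j))) + 1) * v (.inl (.inr ())) + 1 :=
      (((UTerm.var _).add .one).mul (.var _)).add .one
    exact (pair _ _ _).and ((lt (.var _) hm).and (eq (.var _) (((UTerm.var _).mul hm).add (.var _))))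
  · unfold Nat.beta
    constructor
    · intro h
      refine ⟨(v i).unpair.1, (v i).unpair.2, (v i).unpair.1 / ((v j + 1) * (v i).unpair.2 + 1),
        by simp, ?_, ?_⟩
      · rw [h]; exact Nat.mod_lt _ (by omega)
      · rw [h]; exact (Nat.div_add_mod' _ _).symm
    · rintro ⟨a, b, q, h1, h2, h3⟩
      rw [h1]
      simp only [Nat.unpair_pair]
      rw [h3, Nat.mul_add_mod', Nat.mod_eq_of_lt h2]

end UDef

/-- Gödel's β-lemma: one number quantifier can stand for a quantifier over finite sequences, such as
the list of values of a recursion. -/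
theorem exists_beta (f : ℕ → ℕ) (n : ℕ) : ∃ s, ∀ i ≤ n, Nat.beta s i = f i := by
  refine ⟨Nat.unbeta ((List.range (n + 1)).map f), fun i hi => ?_⟩
  have := Nat.beta_unbeta_coe ((List.range (n + 1)).map f) ⟨i, by simp; omega⟩
  simpa using this

/-- The graph of a primitive recursive function is definable in arithmetic. -/
theorem UDef.graph {g : ℕ → ℕ} (hg : Nat.Primrec g) :
    ∀ {α : Type} (i j : α), UDef fun _ v => v j = g (v i) := by
  induction hg with
  | zero => exact fun i j => eq (.var j) .zero
  | succ => exact fun i j => eq (.var j) ((UTerm.var i).add .one)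
  | left =>
    intro α i j
    refine of_iff (R := fun X v => ∃ b, v i = Nat.pair (v j) b) (ex (pair _ _ _)) fun X v => ?_
    constructor
    · intro h; exact ⟨(v i).unpair.2, by simp [h]⟩
    · rintro ⟨b, h⟩; simp [h]
  | right =>
    intro α i j
    refine of_iff (R := fun X v => ∃ b, v i = Nat.pair b (v j)) (ex (pair _ _ _)) fun X v => ?_
    constructor
    · intro h; exact ⟨(v i).unpair.1, by simp [h]⟩
    · rintro ⟨b, h⟩; simp [h]
  | @pair f g _ _ hf hg =>
    intro α i j
    refine of_iff (R := fun X v => ∃ a b, a = f (v i) ∧ b = g (v i) ∧ v j = Nat.pair a b)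
      (ex (ex ((hf _ _).and ((hg _ _).and (pair _ _ _))))) fun X v => ?_
    simp
  | @comp f g _ _ hf hg =>
    intro α i j
    refine of_iff (R := fun X v => ∃ a, a = g (v i) ∧ v j = f a)
      (ex ((hg _ _).and (hf _ _))) fun X v => ?_
    simp
  | @prec f g _ _ hf hg =>
    intro α i j
    -- The number `s` codes the values of the recursion at `0, …, n`. The further variables only
    -- name intermediate values, because the definability statements for `Nat.pair`, `Nat.beta`, `f`
    -- and `g` speak of variables.
    refine of_iff (R := fun X v => ∃ z n s, v i = Nat.pair z n ∧
        (∃ o a, o = 0 ∧ a = f z ∧ a = Nat.beta s o) ∧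
        (∀ y, y < n → ∃ y' a b c d, y' = y + 1 ∧ a = Nat.beta s y ∧ b = Nat.beta s y' ∧
          c = Nat.pair y a ∧ d = Nat.pair z c ∧ b = g d) ∧
        v j = Nat.beta s n)
      (ex (ex (ex ((pair _ _ _).and (and ?_ (and ?_ (beta _ _ _))))))) fun X v => ?_
    · exact ex (ex ((eq (.var _) .zero).and ((hf _ _).and (beta _ _ _))))
    · exact all (imp (lt (.var _) (.var _)) (ex (ex (ex (ex (ex
        ((eq (.var _) ((UTerm.var _).add .one)).and ((beta _ _ _).and ((beta _ _ _).and
          ((pair _ _ _).and ((pair _ _ _).and (hg _ _))))))))))))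
    set h : ℕ → ℕ → ℕ := fun z n =>
      n.rec (f z) fun y IH => g (Nat.pair z (Nat.pair y IH)) with hh
    constructor
    · intro hv
      obtain ⟨s, hs⟩ := exists_beta (h (v i).unpair.1) (v i).unpair.2
      refine ⟨(v i).unpair.1, (v i).unpair.2, s, by simp, ⟨0, _, rfl, rfl, ?_⟩, fun y hy =>
        ⟨_, _, _, _, _, rfl, rfl, rfl, rfl, rfl, ?_⟩, ?_⟩
      · rw [hs 0 (by omega)]; rfl
      · rw [hs _ (by omega), hs _ (by omega)]
      · rw [hs _ le_rfl, hv, Nat.unpaired]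
    · rintro ⟨z, n, s, hi, ⟨o, a, rfl, ha, h0⟩, hstep, hj⟩
      have key : ∀ y ≤ n, Nat.beta s y = h z y := by
        intro y
        induction y with
        | zero => intro _; rw [← h0, ha]; rfl
        | succ y ih =>
          intro hy
          obtain ⟨y', a, b, c, d, rfl, rfl, rfl, rfl, rfl, hb⟩ := hstep y (by omega)
          rw [hb, ih (by omega)]
      rw [hj, key n le_rfl, hi]
      simp [Nat.unpaired, hh]

end

section
open Encodable

/-! ### Arithmetical relations -/

/-- A relation between a function `F : ℕ → ℕ` and an element of a coded type that is arithmetical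
in (the graph of) `F`. -/
def Arith {α : Type} [Primcodable α] (R : (ℕ → ℕ) → α → Prop) : Prop :=
  ∃ S : (ℕ → Set ℕ) → ℕ → Prop, UDef (fun X (v : Unit → ℕ) => S X (v ())) ∧
    ∀ X F, (∀ x y, Nat.pair x y ∈ X 0 ↔ F x = y) → ∀ a, S X (encode a) ↔ R F a

/-- A function depending on `F : ℕ → ℕ` whose graph is arithmetical in `F`. -/
def ArithFun {α β : Type} [Primcodable α] [Primcodable β] (h : (ℕ → ℕ) → α → β) : Prop :=
  Arith fun F (p : α × β) => h F p.1 = p.2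

theorem UDef.reindex_unit {α : Type} {T : (ℕ → Set ℕ) → ℕ → Prop}
    (hT : UDef fun X (v : Unit → ℕ) => T X (v ())) (i : α) : UDef fun X (v : α → ℕ) => T X (v i) :=
  hT.reindex fun _ => i

namespace Arith
variable {α β γ : Type} [Primcodable α] [Primcodable β] [Primcodable γ]
  {R S : (ℕ → ℕ) → α → Prop}

theorem of_iff (h : Arith R) (H : ∀ F a, S F a ↔ R F a) : Arith S :=
  let ⟨T, hT, h⟩ := h
  ⟨T, hT, fun X F hX a => (h X F hX a).trans (H F a).symm⟩

theorem not : Arith R → Arith fun F a => ¬ R F a := by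
  rintro ⟨T, hT, h⟩
  exact ⟨fun X n => ¬ T X n, hT.not, fun X F hX a => not_congr (h X F hX a)⟩

theorem and : Arith R → Arith S → Arith fun F a => R F a ∧ S F a := by
  rintro ⟨T, hT, h⟩ ⟨U, hU, h'⟩
  exact ⟨fun X n => T X n ∧ U X n, hT.and hU, fun X F hX a => and_congr (h X F hX a) (h' X F hX a)⟩

theorem or (hR : Arith R) (hS : Arith S) : Arith fun F a => R F a ∨ S F a :=
  (hR.not.and hS.not).not.of_iff fun F a => by tauto

theorem imp (hR : Arith R) (hS : Arith S) : Arith fun F a => R F a → S F a :=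
  (hR.and hS.not).not.of_iff fun F a => by tauto

theorem of_pred {p : α → Prop} (hp : PrimrecPred p) : Arith fun _ a => p a := by
  classical
  have hg : Nat.Primrec fun n => encode ((decode (α := α) n).map fun a => decide (p a)) := hp.decide
  -- The value `1 + 1` is the code of `some true`; `some false` has the code `1` and `none` the code
  -- `0`.
  refine ⟨fun X n => ∃ y, y = encode ((decode (α := α) n).map fun a => decide (p a)) ∧ y = 1 + 1,
    .ex (.and (.graph hg _ _) (.eq (.var _) (.add .one .one))), fun X F _ a => ?_⟩
  by_cases h : p a <;> simp [h]

theorem comp {R : (ℕ → ℕ) → β → Prop} {g : α → β} (hR : Arith R) (hg : Primrec g) :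
    Arith fun F a => R F (g a) := by
  obtain ⟨T, hT, h⟩ := hR
  refine ⟨fun X n => ∃ y z, y = encode ((decode (α := α) n).map g) ∧ y = z + 1 ∧ T X z,
    .ex (.ex (.and (.graph hg _ _) (.and (.eq (.var _) (.add (.var _) .one))
      (hT.reindex_unit _)))), fun X F hX a => ?_⟩
  simp [h X F hX]

/-- Not every number codes an element of `β`. The number `encode (decode y)` is `0` if `y` decodes
to nothing, and otherwise exceeds by one the code `z` of the decoded element; requiring `u = z + 1`
therefore lets `z` range over exactly the codes of elements. -/
theorem ex {R : (ℕ → ℕ) → α → β → Prop} (hR : Arith fun F (p : α × β) => R F p.1 p.2) :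
    Arith fun F a => ∃ b, R F a b := by
  obtain ⟨T, hT, h⟩ := hR
  refine ⟨fun X n => ∃ y u z w, u = encode (decode (α := β) y) ∧ u = z + 1 ∧
      w = Nat.pair n z ∧ T X w,
    .ex (.ex (.ex (.ex (.and (.graph (Primcodable.prim β) _ _) (.and (.eq (.var _) (.add (.var _) .one))
      (.and (.pair _ _ _) (hT.reindex_unit _))))))), fun X F hX a => ?_⟩
  constructor
  · rintro ⟨y, u, z, w, hu, hz, rfl, hw⟩
    cases hd : decode (α := β) y with
    | none => simp [hd] at hu; omega
    | some b =>
      simp only [hd, encode_some] at hu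
      obtain rfl : z = encode b := by omega
      exact ⟨b, (h X F hX (a, b)).1 hw⟩
  · rintro ⟨b, hb⟩
    exact ⟨encode b, _, encode b, _, rfl, by simp, rfl, (h X F hX (a, b)).2 hb⟩

theorem all {R : (ℕ → ℕ) → α → β → Prop} (hR : Arith fun F (p : α × β) => R F p.1 p.2) :
    Arith fun F a => ∀ b, R F a b :=
  (ex (R := fun F a b => ¬ R F a b) hR.not).not.of_iff fun F a => by simp

theorem subst {R : (ℕ → ℕ) → β → Prop} {h : (ℕ → ℕ) → α → β} (hR : Arith R) (hh : ArithFun h) :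
    Arith fun F a => R F (h F a) :=
  (ex (R := fun F a b => h F a = b ∧ R F b) (hh.and (hR.comp .snd))).of_iff fun F a => by simp

theorem pred {p : β → Prop} {h : (ℕ → ℕ) → α → β} (hp : PrimrecPred p) (hh : ArithFun h) :
    Arith fun F a => p (h F a) :=
  (of_pred hp).subst hh

end Arith

namespace ArithFun
variable {α β γ : Type} [Primcodable α] [Primcodable β] [Primcodable γ]
  {h : (ℕ → ℕ) → α → β} {k : (ℕ → ℕ) → α → γ}

theorem of_primrec {g : α → β} (hg : Primrec g) : ArithFun fun _ a => g a :=
  .of_pred (Primrec.eq.comp (hg.comp .fst) .snd)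

theorem comp {g : β → γ} (hg : Primrec g) (hh : ArithFun h) : ArithFun fun F a => g (h F a) :=
  (Arith.ex (R := fun F (p : α × γ) b => h F p.1 = b ∧ g b = p.2) ((Arith.comp hh
    ((Primrec.fst.comp .fst).pair .snd)).and (.of_pred (Primrec.eq.comp (hg.comp .snd)
      (Primrec.snd.comp .fst))))).of_iff fun F a => by simp

theorem pair (hh : ArithFun h) (hk : ArithFun k) : ArithFun fun F a => (h F a, k F a) :=
  ((Arith.comp hh (Primrec.fst.pair (Primrec.fst.comp .snd))).and
    (Arith.comp hk (Primrec.fst.pair (Primrec.snd.comp .snd)))).of_iff fun _ _ => Prod.ext_iff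

/-- This is where `F` itself enters: the atomic formula `pair x y ∈ X 0` says `F x = y`, as `X 0` is
the graph of `F`. -/
theorem oracle {h : (ℕ → ℕ) → α → ℕ} (hh : ArithFun h) : ArithFun fun F a => F (h F a) := by
  have h0 : Arith fun F (p : ℕ × ℕ) => F p.1 = p.2 :=
    ⟨fun X n => n ∈ X 0, .mem 0 (.var _), fun X F hX p => hX p.1 p.2⟩
  exact (Arith.ex (R := fun F (p : α × ℕ) b => h F p.1 = b ∧ F b = p.2) ((Arith.comp hh
    ((Primrec.fst.comp .fst).pair .snd)).and (h0.comp
      (Primrec.snd.pair (Primrec.snd.comp .fst))))).of_iff fun F a => by simp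

end ArithFun

theorem Arith.eq {α β : Type} [Primcodable α] [Primcodable β] {h k : (ℕ → ℕ) → α → β}
    (hh : ArithFun h) (hk : ArithFun k) : Arith fun F a => h F a = k F a :=
  Arith.pred (p := fun q : β × β => q.1 = q.2) Primrec.eq (hh.pair hk)

theorem Arith.le {α : Type} [Primcodable α] {h k : (ℕ → ℕ) → α → ℕ}
    (hh : ArithFun h) (hk : ArithFun k) : Arith fun F a => h F a ≤ k F a :=
  Arith.pred (p := fun q : ℕ × ℕ => q.1 ≤ q.2) Primrec.nat_le (hh.pair hk)

/-- Universal quantification over functions leads from arithmetical relations to `Π¹₁` sets. -/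
theorem Arith.isPi11 {R : (ℕ → ℕ) → ℕ → Prop} (hR : Arith R) : IsPi11 {n | ∀ F, R F n} := by
  obtain ⟨T, hT, h⟩ := hR
  -- The quantifiers range over arbitrary sets, so the formula is relativized to those `X 0` that
  -- are graphs of total functions.
  have hF : UDef fun X (v : Unit → ℕ) => (∀ x, ∃ y, (∃ z, z = Nat.pair x y ∧ z ∈ X 0) ∧
      ∀ y', (∃ z, z = Nat.pair x y' ∧ z ∈ X 0) → y' = y) → T X (v ()) :=
    .imp (.all (.ex (.and (.ex (.and (.pair _ _ _) (.mem 0 (.var _))))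
      (.all (.imp (.ex (.and (.pair _ _ _) (.mem 0 (.var _)))) (.eq (.var _) (.var _))))))) hT
  obtain ⟨φ, hφ⟩ := hF
  refine ⟨φ, fun n => ?_⟩
  simp only [hφ, Set.mem_ofPred_eq]
  constructor
  · intro H X hX
    choose F hF hF' using hX
    refine (h X F (fun x y => ?_) n).2 (H F)
    constructor
    · intro hy; exact (hF' x y ⟨_, rfl, hy⟩).symm
    · rintro rfl
      obtain ⟨z, rfl, hz⟩ := hF x
      exact hz
  · intro H F
    have hX : ∀ x y, Nat.pair x y ∈ {z : ℕ | F z.unpair.1 = z.unpair.2} ↔ F x = y := by simp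
    refine (h (fun _ => {z : ℕ | F z.unpair.1 = z.unpair.2}) F hX n).1 (H _ fun x => ⟨F x, ?_, ?_⟩)
    · exact ⟨_, rfl, by simp⟩
    · rintro y' ⟨z, rfl, hz⟩
      exact ((hX x y').1 hz).symm

end

section
open Encodable

/-! ### Computations and descriptions of machines -/

namespace NDTM

/-- An infinite computation that visits the state `qr` infinitely often. -/
def Recurs (M : NDTM) (qr : M.State) (c : ℕ → M.Config) : Prop :=
  (∀ i, c (i + 1) ∈ M.Next (c i)) ∧ ∀ i, ∃ j, i ≤ j ∧ (c j).q = qr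

/-- A run with infinitely many visits never ends, so finite runs and the condition on their last
configuration are irrelevant. -/
theorem nonRecurringFrom_iff {M : NDTM} {qr : M.State} {ρ : M.Config} :
    M.NonRecurringFrom qr ρ ↔ ¬ ∃ c, c 0 = ρ ∧ M.Recurs qr c := by
  constructor
  · rintro h ⟨c, rfl, hc, hq⟩
    refine Set.infinite_of_forall_exists_gt (fun i => ?_) (h (fun i => some (c i))
      ⟨rfl, fun i hi => by simp at hi, fun i ρ hi => .inl ⟨c (i + 1), ?_, rfl⟩⟩)
    · obtain ⟨j, hj, hjq⟩ := hq (i + 1)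
      exact ⟨j, ⟨_, rfl, hjq⟩, by omega⟩
    · cases hi; exact hc i
  · intro h S ⟨h0, hnone, hstep⟩
    by_contra hinf
    have hgt := Set.Infinite.exists_gt hinf
    have hanti : ∀ i d, S i = none → S (i + d) = none := by
      intro i d hi
      induction d with
      | zero => exact hi
      | succ d ih => exact hnone _ ih
    have hsome : ∀ i, ∃ ρ, S i = some ρ := by
      intro i
      obtain ⟨j, ⟨ρ, hρ, -⟩, hij⟩ := hgt i
      rw [← Option.ne_none_iff_exists']
      intro hi
      have := hanti i (j - i) hi
      rw [Nat.add_sub_cancel' hij.le, hρ] at this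
      cases this
    choose c hc using hsome
    refine h ⟨c, Option.some_injective _ (by rw [← hc, h0]), fun i => ?_, fun i => ?_⟩
    · rcases hstep i _ (hc i) with ⟨ρ', h1, h2⟩ | ⟨-, h2⟩
      · rw [hc] at h2; cases h2; exact h1
      · rw [hc] at h2; cases h2
    · obtain ⟨j, ⟨ρ, hρ, hq⟩, hij⟩ := hgt i
      rw [hc] at hρ; cases hρ
      exact ⟨j, hij.le, hq⟩

/-- The type of the tuples `(k, m, qr, l)` that describe a machine with one of its states. -/
abbrev Description : Type := ℕ × ℕ × ℕ × List (ℕ × Option ℕ × ℕ × ℕ × Bool)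

/-- The machine with a given description. -/
def ofDescription (x : Description) : NDTM where
  k := x.1
  m := x.2.1
  δ := fun s q => {y | (q.val, s.map Fin.val, y.1.val, y.2.1.val,
    match y.2.2 with
      | Dir.left => false
      | Dir.right => true) ∈ x.2.2.2}

/-- The entries of a transition are states and symbols. -/
def TransitionBounded (k m : ℕ) (y : ℕ × Option ℕ × ℕ × ℕ × Bool) : Prop :=
  -- The blank has the code `0` and the symbol `s < m + 2` the code `s + 1`.
  y.1 < k + 1 ∧ encode y.2.1 < m + 3 ∧ y.2.2.1 < k + 1 ∧ y.2.2.2.1 < m + 2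

/-- All numbers in the description denote states and symbols. -/
def Description.Valid (x : Description) : Prop :=
  x.2.2.1 < x.1 + 1 ∧ ∀ y ∈ x.2.2.2, TransitionBounded x.1 x.2.1 y

theorem transitionCode_injective (M : NDTM) : Function.Injective M.transitionCode := by
  rintro ⟨q, s, r, a, d⟩ ⟨q', s', r', a', d'⟩ h
  simp only [transitionCode, Prod.mk.injEq, Fin.val_inj] at h
  obtain ⟨rfl, h2, rfl, rfl, h5⟩ := h
  have := Option.map_injective Fin.val_injective h2
  subst this
  cases d <;> cases d' <;> simp_all

theorem exists_transitionCode_eq (M : NDTM) {y} (h : TransitionBounded M.k M.m y) :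
    ∃ z, M.transitionCode z = y := by
  obtain ⟨q, s, r, a, d⟩ := y
  obtain ⟨h1, h2, h3, h4⟩ := h
  have hs : ∃ s' : Option M.Symbol, s'.map Fin.val = s := by
    cases s with
    | none => exact ⟨none, rfl⟩
    | some s => exact ⟨some ⟨s, by simp at h2; omega⟩, rfl⟩
  obtain ⟨s', rfl⟩ := hs
  exact ⟨(⟨q, h1⟩, s', ⟨r, h3⟩, ⟨a, h4⟩, if d then Dir.right else Dir.left),
    by cases d <;> simp [transitionCode]⟩

theorem transitionBounded_transitionCode (M : NDTM) (z) :
    TransitionBounded M.k M.m (M.transitionCode z) := by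
  obtain ⟨q, s, r, a, d⟩ := z
  refine ⟨q.2, ?_, r.2, a.2⟩
  cases s with
  | none => simp [transitionCode]
  | some s => have := s.2; simp [transitionCode]

/-- The machine can be recovered from the list of its transitions, since numbering the transitions
is injective. Membership thus becomes a condition on numerical descriptions, whose validity is
decidable. -/
theorem mem_codesOf {P : (M : NDTM) → M.State → Prop} {c : ℕ} :
    c ∈ codesOf P ↔ ∃ x : Description, encode x = c ∧ ∃ h : x.Valid,
      P (ofDescription x) ⟨x.2.2.1, h.1⟩ := by
  constructor
  · rintro ⟨M, qr, ⟨l, hl, rfl⟩, hP⟩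
    refine ⟨_, rfl, ⟨qr.2, ?_⟩, ?_⟩
    · simp only [List.mem_map]
      rintro _ ⟨z, -, rfl⟩
      exact M.transitionBounded_transitionCode z
    · have hM : ofDescription (M.k, M.m, qr.val, l.map M.transitionCode) = M := by
        obtain ⟨k, m, δ⟩ := M
        simp only [ofDescription, mk.injEq, heq_eq_eq, true_and]
        funext s q
        ext ⟨r, a, d⟩
        rw [← hl q s r a d]
        exact List.mem_map_of_injective (a := (q, s, r, a, d)) (transitionCode_injective ⟨k, m, δ⟩)
      -- The type of states depends on the machine, so equal machines have their states compared
      -- through the underlying numbers.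
      have key : ∀ (M' : NDTM) (h : M' = M) (q' : M'.State), q'.val = qr.val → P M' q' := by
        rintro M' rfl q' hq
        rwa [Fin.ext hq]
      exact key _ hM _ rfl
  · rintro ⟨x, rfl, hx, hP⟩
    refine ⟨_, _, ?_, hP⟩
    obtain ⟨k, m, r, L⟩ := x
    have hL : ∃ l : List _, l.map (ofDescription (k, m, r, L)).transitionCode = L := by
      choose f hf using fun y : {y // TransitionBounded k m y} =>
        exists_transitionCode_eq (ofDescription (k, m, r, L)) y.2
      exact ⟨L.attach.map fun y => f ⟨y.1, hx.2 y.1 y.2⟩, by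
        simpa [Function.comp_def, hf] using List.attach_map_subtype_val L⟩
    obtain ⟨l, hl⟩ := hL
    refine ⟨l, fun q s r a d => ?_, by rw [hl]; rfl⟩
    rw [← List.mem_map_of_injective (transitionCode_injective _), hl]
    rfl

/-! ### Computations described by a function on the natural numbers -/

/-- The part of `F` that describes the numbers `n`. -/
def lengthAt (F : ℕ → ℕ) (i : ℕ) : ℕ := F (Nat.pair 0 i)

/-- The part of `F` that describes the head positions. -/
def headAt (F : ℕ → ℕ) (i : ℕ) : ℕ := F (Nat.pair 1 i)

/-- The part of `F` that describes the states. -/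
def stateAt (F : ℕ → ℕ) (i : ℕ) : ℕ := F (Nat.pair 2 i)

/-- The part of `F` that describes the tapes. -/
def tapeAt (F : ℕ → ℕ) (i j : ℕ) : ℕ := F (Nat.pair 3 (Nat.pair i j))

/-- The numerical code of a tape symbol or blank. -/
def cell {m : ℕ} (s : Option (Fin m)) : ℕ := encode (s.map Fin.val)

theorem cell_injective {m : ℕ} : Function.Injective (cell (m := m)) :=
  encode_injective.comp (Option.map_injective Fin.val_injective)

@[simp] theorem cell_eq_zero {m : ℕ} {s : Option (Fin m)} : cell s = 0 ↔ s = none := by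
  cases s <;> simp [cell]

theorem cell_le {m : ℕ} (s : Option (Fin m)) : cell s ≤ m := by
  cases s with
  | none => simp [cell]
  | some s => simp [cell]

/-- `F` describes the configuration `ρ` at time `i`. -/
structure Describes {M : NDTM} (F : ℕ → ℕ) (i : ℕ) (ρ : M.Config) : Prop where
  length : lengthAt F i = ρ.n
  head : headAt F i = ρ.p
  state : stateAt F i = ρ.q.val
  tape : ∀ j, tapeAt F i j = cell (ρ.t j)

/-- `F` describes some configuration at time `i`. -/
def ConfigAt (F : ℕ → ℕ) (k m i : ℕ) : Prop :=
  stateAt F i ≤ k ∧ (∀ j, tapeAt F i j ≤ m + 2) ∧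
  (∀ j, j = 0 ∨ lengthAt F i + 1 ≤ j → tapeAt F i j = 0) ∧ tapeAt F i (lengthAt F i) = 0 ∧
  (∀ j, 1 ≤ j → j + 1 ≤ lengthAt F i → tapeAt F i j = 0 → tapeAt F i (j + 1) = 0) ∧
  1 ≤ headAt F i ∧ headAt F i ≤ lengthAt F i

theorem configAt_iff {M : NDTM} {F : ℕ → ℕ} {i : ℕ} :
    ConfigAt F M.k M.m i ↔ ∃ ρ : M.Config, Describes F i ρ := by
  constructor
  · rintro ⟨h1, h2, h3, h4, h5, h6, h7⟩
    have ht : ∀ j, ∃ s : Option M.Symbol, tapeAt F i j = cell s := by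
      intro j
      have := h2 j
      obtain h0 | h0 := Nat.eq_zero_or_pos (tapeAt F i j)
      · exact ⟨none, by simp [cell, h0]⟩
      · exact ⟨some ⟨tapeAt F i j - 1, by omega⟩, by simp [cell]; omega⟩
    choose t ht using ht
    simp only [ht, cell_eq_zero] at h3 h4 h5
    exact ⟨⟨lengthAt F i, t, headAt F i, ⟨stateAt F i, by omega⟩, h3, h4, h5, h6, h7⟩,
      rfl, rfl, rfl, ht⟩
  · rintro ⟨ρ, h1, h2, h3, h4⟩
    refine ⟨?_, fun j => ?_, fun j hj => ?_, ?_, fun j hj hj' => ?_, ?_, ?_⟩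
    · rw [h3]; exact Nat.le_of_lt_succ ρ.q.2
    · rw [h4]; exact cell_le _
    · rw [h4, cell_eq_zero]; rw [h1] at hj; exact ρ.outside j hj
    · rw [h4, h1, cell_eq_zero]; exact ρ.last_blank
    · rw [h4, h4, cell_eq_zero, cell_eq_zero]; rw [h1] at hj'; exact ρ.blank_succ j hj hj'
    · rw [h2]; exact ρ.one_le_p
    · rw [h2, h1]; exact ρ.p_le_n

/-- `F` describes a computation step at time `i`. -/
def StepAt (F : ℕ → ℕ) (l : List (ℕ × Option ℕ × ℕ × ℕ × Bool)) (i : ℕ) : Prop :=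
  ∃ y : ℕ × Option ℕ × ℕ × ℕ × Bool, y ∈ l ∧ stateAt F i = y.1 ∧
    tapeAt F i (headAt F i) = encode y.2.1 ∧ (y.2.2.2.2 = true ∨ 2 ≤ headAt F i) ∧
    lengthAt F (i + 1) = lengthAt F i + 1 ∧
    (∀ j, (j = headAt F i → tapeAt F (i + 1) j = y.2.2.2.1 + 1) ∧
      (¬ j = headAt F i → tapeAt F (i + 1) j = tapeAt F i j)) ∧
    headAt F (i + 1) = (bif y.2.2.2.2 then headAt F i + 1 else headAt F i - 1) ∧
    stateAt F (i + 1) = y.2.2.1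

theorem stepAt_iff {x : Description} (hx : x.Valid) {F : ℕ → ℕ} {i : ℕ}
    {ρ ρ' : (ofDescription x).Config} (h : Describes F i ρ) (h' : Describes F (i + 1) ρ') :
    StepAt F x.2.2.2 i ↔ ρ' ∈ (ofDescription x).Next ρ := by
  constructor
  · rintro ⟨y, hy, h1, h2, h3, h4, h5, h6, h7⟩
    obtain ⟨⟨q, s, r, a, d⟩, rfl⟩ := (ofDescription x).exists_transitionCode_eq (hx.2 y hy)
    simp only [transitionCode, h.state, h.head, h.tape, h.length, h'.state, h'.head, h'.tape,
      h'.length, Fin.val_inj] at h1 h2 h3 h4 h5 h6 h7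
    subst h1
    obtain rfl : ρ.t ρ.p = s := cell_injective h2
    refine ⟨r, a, d, hy, ?_, h4, ?_, ?_, h7⟩
    · cases d
      exacts [.inr (by simpa using h3), .inl rfl]
    · funext j
      by_cases hj : j = ρ.p
      · subst hj
        rw [Function.update_self]
        exact cell_injective ((h5 _).1 rfl)
      · rw [Function.update_of_ne hj]
        exact cell_injective ((h5 _).2 hj)
    · cases d <;> simpa using h6
  · rintro ⟨r, a, d, h1, h2, h3, h4, h5, h6⟩
    refine ⟨(ofDescription x).transitionCode (ρ.q, ρ.t ρ.p, r, a, d), h1, ?_⟩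
    simp only [transitionCode, h.state, h.head, h.tape, h.length, h'.state, h'.head, h'.tape,
      h'.length, Fin.val_inj]
    refine ⟨trivial, rfl, ?_, h3, fun j => ⟨?_, fun hj => ?_⟩, ?_, h6⟩
    · cases d
      exacts [.inr (by simpa using h2), .inl rfl]
    · rintro rfl
      rw [h4, Function.update_self]; rfl
    · rw [h4, Function.update_of_ne hj]
    · rw [h5]; cases d <;> rfl

/-- `F` describes a computation that visits `qr` infinitely often. -/
def RecursBy (F : ℕ → ℕ) (x : Description) : Prop :=
  (∀ i, ConfigAt F x.1 x.2.1 i) ∧ (∀ i, StepAt F x.2.2.2 i) ∧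
    ∀ i, ∃ j, i ≤ j ∧ stateAt F j = x.2.2.1

/-- This turns the quantifier over sequences of configurations into a quantifier over one function.
The pair `I`, `J` leaves open which initial configurations are admitted; that is the only difference
between the three problems. -/
theorem exists_recurs_iff {x : Description} (hx : x.Valid)
    {I : (ofDescription x).Config → Prop} {J : (ℕ → ℕ) → Prop}
    (hIJ : ∀ F ρ, Describes F 0 ρ → (J F ↔ I ρ)) :
    (∃ c, I (c 0) ∧ (ofDescription x).Recurs ⟨x.2.2.1, hx.1⟩ c) ↔ ∃ F, J F ∧ RecursBy F x := by
  constructor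
  · rintro ⟨c, hI, hc, hq⟩
    let F : ℕ → ℕ := fun y => match y.unpair with
      | (0, i) => (c i).n
      | (1, i) => (c i).p
      | (2, i) => (c i).q.val
      | (_, z) => cell ((c z.unpair.1).t z.unpair.2)
    have hF : ∀ i, Describes F i (c i) := fun i =>
      ⟨by simp [lengthAt, F], by simp [headAt, F], by simp [stateAt, F], by simp [tapeAt, F]⟩
    refine ⟨F, (hIJ F _ (hF 0)).2 hI, fun i => configAt_iff.2 ⟨_, hF i⟩,
      fun i => (stepAt_iff hx (hF i) (hF (i + 1))).2 (hc i), fun i => ?_⟩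
    obtain ⟨j, hj, hjq⟩ := hq i
    exact ⟨j, hj, by rw [(hF j).state, hjq]⟩
  · rintro ⟨F, hJ, hF, hs, hq⟩
    have hF : ∀ i, ∃ ρ : (ofDescription x).Config, Describes F i ρ :=
      fun i => configAt_iff.1 (hF i)
    choose c hc using hF
    refine ⟨c, (hIJ F _ (hc 0)).1 hJ, fun i => (stepAt_iff hx (hc i) (hc (i + 1))).1 (hs i),
      fun i => ?_⟩
    obtain ⟨j, hj, hjq⟩ := hq i
    exact ⟨j, hj, Fin.ext (by rw [← (hc j).state, hjq])⟩

end NDTM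

end

section
open Encodable

/-! ### The decision problems are `Π¹₁` -/

namespace NDTM

section
variable {α : Type} [Primcodable α] {x : (ℕ → ℕ) → α → Description} {i j : (ℕ → ℕ) → α → ℕ}

theorem arithFun_pair {i j : (ℕ → ℕ) → α → ℕ} (hi : ArithFun i) (hj : ArithFun j) :
    ArithFun fun F a => Nat.pair (i F a) (j F a) :=
  .comp (g := fun p : ℕ × ℕ => Nat.pair p.1 p.2) Primrec₂.natPair (hi.pair hj)

theorem arithFun_const {β : Type} [Primcodable β] (b : β) :
    ArithFun fun (_ : ℕ → ℕ) (_ : α) => b := .of_primrec (.const b)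

theorem arithFun_succ (hi : ArithFun i) : ArithFun fun F a => i F a + 1 := .comp .succ hi

theorem arithFun_lengthAt (hi : ArithFun i) : ArithFun fun F a => lengthAt F (i F a) :=
  .oracle (arithFun_pair (arithFun_const 0) hi)

theorem arithFun_headAt (hi : ArithFun i) : ArithFun fun F a => headAt F (i F a) :=
  .oracle (arithFun_pair (arithFun_const 1) hi)

theorem arithFun_stateAt (hi : ArithFun i) : ArithFun fun F a => stateAt F (i F a) :=
  .oracle (arithFun_pair (arithFun_const 2) hi)

theorem arithFun_tapeAt (hi : ArithFun i) (hj : ArithFun j) :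
    ArithFun fun F a => tapeAt F (i F a) (j F a) :=
  .oracle (arithFun_pair (arithFun_const 3) (arithFun_pair hi hj))

end

theorem arith_configAt : Arith fun F (a : Description × ℕ) => ConfigAt F a.1.1 a.1.2.1 a.2 := by
  have hk : ArithFun fun _ (a : Description × ℕ) => a.1.1 := .of_primrec (.comp .fst .fst)
  have hm : ArithFun fun _ (a : (Description × ℕ) × ℕ) => a.1.1.2.1 + 2 := .of_primrec
    (.comp .succ (.comp .succ (.comp .fst (.comp .snd (.comp .fst .fst)))))
  have hi : ArithFun fun _ (a : Description × ℕ) => a.2 := .of_primrec .snd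
  have hi' : ArithFun fun _ (a : (Description × ℕ) × ℕ) => a.1.2 :=
    .of_primrec (.comp .snd .fst)
  have hj : ArithFun fun _ (a : (Description × ℕ) × ℕ) => a.2 := .of_primrec .snd
  refine (Arith.le (arithFun_stateAt hi) hk).and (.and (.all (.le (arithFun_tapeAt hi' hj) hm))
    (.and (.all (.imp (.or (.eq hj (arithFun_const 0)) (.le (arithFun_succ (arithFun_lengthAt hi'))
      hj)) (.eq (arithFun_tapeAt hi' hj) (arithFun_const 0)))) (.and
    (.eq (arithFun_tapeAt hi (arithFun_lengthAt hi)) (arithFun_const 0)) (.and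
    (.all (.imp (.le (arithFun_const 1) hj) (.imp (.le (arithFun_succ hj) (arithFun_lengthAt hi'))
      (.imp (.eq (arithFun_tapeAt hi' hj) (arithFun_const 0))
        (.eq (arithFun_tapeAt hi' (arithFun_succ hj)) (arithFun_const 0))))))
    (.and (.le (arithFun_const 1) (arithFun_headAt hi))
      (.le (arithFun_headAt hi) (arithFun_lengthAt hi)))))))

/-- The type of transitions, written as tuples of numbers. -/
abbrev Transition : Type := ℕ × Option ℕ × ℕ × ℕ × Bool

theorem arith_stepAt : Arith fun F (a : Description × ℕ) => StepAt F a.1.2.2.2 a.2 := by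
  have hl : Primrec fun a : (Description × ℕ) × Transition => a.1.1.2.2.2 :=
    .comp .snd (.comp .snd (.comp .snd (.comp .fst .fst)))
  have hi : ArithFun fun _ (a : (Description × ℕ) × Transition) => a.1.2 :=
    .of_primrec (.comp .snd .fst)
  have hi' : ArithFun fun _ (a : ((Description × ℕ) × Transition) × ℕ) => a.1.1.2 :=
    .of_primrec (.comp .snd (.comp .fst .fst))
  have hj : ArithFun fun _ (a : ((Description × ℕ) × Transition) × ℕ) => a.2 := .of_primrec .snd
  have h1 : Primrec fun a : (Description × ℕ) × Transition => a.2.1 := .comp .fst .snd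
  have h2 : Primrec fun a : (Description × ℕ) × Transition => a.2.2.1 := .comp .fst (.comp .snd .snd)
  have h3 : Primrec fun a : (Description × ℕ) × Transition => a.2.2.2.1 :=
    .comp .fst (.comp .snd (.comp .snd .snd))
  have h4 : Primrec fun a : (Description × ℕ) × Transition => a.2.2.2.2.1 :=
    .comp .fst (.comp .snd (.comp .snd (.comp .snd .snd)))
  have h5 : Primrec fun a : (Description × ℕ) × Transition => a.2.2.2.2.2 :=
    .comp .snd (.comp .snd (.comp .snd (.comp .snd .snd)))
  have hmem : PrimrecPred fun a : (Description × ℕ) × Transition => a.2 ∈ a.1.1.2.2.2 :=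
    ((PrimrecRel.exists_mem_list (R := fun a b : Transition => a = b) Primrec.eq).comp hl .snd).of_eq
      fun a => by simp
  have hmove : Primrec fun p : Bool × ℕ => bif p.1 then p.2 + 1 else p.2 - 1 :=
    .cond .fst (.comp .succ .snd) (.comp .pred .snd)
  have p1 := Arith.eq (arithFun_stateAt hi) (.of_primrec h1)
  have p2 := Arith.eq (arithFun_tapeAt hi (arithFun_headAt hi)) (.of_primrec (.comp .encode h2))
  have p3 := Arith.or (.eq (.of_primrec h5) (arithFun_const true))
    (.le (arithFun_const 2) (arithFun_headAt hi))
  have p4 := Arith.eq (arithFun_lengthAt (arithFun_succ hi)) (arithFun_succ (arithFun_lengthAt hi))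
  have h4' : Primrec fun a : ((Description × ℕ) × Transition) × ℕ => a.1.2.2.2.2.1 + 1 :=
    Primrec.succ.comp (h4.comp (Primrec.fst (β := ℕ)))
  have p5 := Arith.imp (.eq hj (arithFun_headAt hi'))
    (.eq (arithFun_tapeAt (arithFun_succ hi') hj) (.of_primrec h4'))
  have p5' := Arith.imp (.not (.eq hj (arithFun_headAt hi')))
    (.eq (arithFun_tapeAt (arithFun_succ hi') hj) (arithFun_tapeAt hi' hj))
  have p6 := Arith.eq (arithFun_headAt (arithFun_succ hi))
      (.comp hmove ((ArithFun.of_primrec h5).pair (arithFun_headAt hi)))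
  have p7 := Arith.eq (arithFun_stateAt (arithFun_succ hi)) (.of_primrec h3)
  exact .ex ((Arith.of_pred hmem).and (p1.and (p2.and (p3.and (p4.and ((Arith.all (p5.and p5')).and (p6.and p7)))))))

theorem arith_recursBy : Arith fun F (x : Description) => RecursBy F x := by
  refine .and (.all arith_configAt) (.and (.all arith_stepAt) (.all (.ex (.and
    (.le (.of_primrec (.comp .snd .fst)) (.of_primrec .snd))
    (.eq (arithFun_stateAt (.of_primrec .snd))
      (.of_primrec (.comp .fst (.comp .snd (.comp .snd (.comp .fst .fst))))))))))

theorem primrecPred_valid : PrimrecPred Description.Valid := by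
  have hb : PrimrecRel fun (y : Transition) (p : ℕ × ℕ) => TransitionBounded p.1 p.2 y := by
    have hk : Primrec fun a : Transition × ℕ × ℕ => a.2.1 + 1 := .comp .succ (.comp .fst .snd)
    have hm : Primrec fun a : Transition × ℕ × ℕ => a.2.2 + 2 :=
      .comp .succ (.comp .succ (.comp .snd .snd))
    exact .and (Primrec.nat_lt.comp (.comp .fst .fst) hk) (.and
      (Primrec.nat_lt.comp (.comp .encode (.comp .fst (.comp .snd .fst))) (.comp .succ hm)) (.and
      (Primrec.nat_lt.comp (.comp .fst (.comp .snd (.comp .snd .fst))) hk)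
      (Primrec.nat_lt.comp (.comp .fst (.comp .snd (.comp .snd (.comp .snd .fst)))) hm)))
  refine .and (Primrec.nat_lt.comp (.comp .fst (.comp .snd .snd)) (.comp .succ .fst)) ?_
  exact hb.forall_mem_list.comp (.comp .snd (.comp .snd .snd)) (.pair .fst (.comp .fst .snd))

/-- A decision problem that asks whether all computations from configurations of a certain kind
are non-recurring is `Π¹₁`, provided that the configurations of this kind are arithmetical. -/
theorem isPi11_codesOf {I : (M : NDTM) → M.Config → Prop} {J : (ℕ → ℕ) → Description → Prop}
    (hJ : Arith J) (hIJ : ∀ F (x : Description), x.Valid → ∀ ρ : (ofDescription x).Config,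
      Describes F 0 ρ → (J F x ↔ I _ ρ)) :
    IsPi11 (codesOf fun M qr => ∀ ρ, I M ρ → M.NonRecurringFrom qr ρ) := by
  -- The description is quantified inside the scope of `F`. This does no harm, because it is
  -- determined by `c` and so cannot vary with `F`.
  have key : Arith fun F (c : ℕ) => ∃ x : Description, encode x = c ∧ x.Valid ∧
      ¬ (J F x ∧ RecursBy F x) :=
    .ex (.and (.of_pred (Primrec.eq.comp (.comp .encode .snd) .fst))
      (.and (.of_pred (primrecPred_valid.comp .snd)) (.comp (.not (hJ.and arith_recursBy)) .snd)))
  convert key.isPi11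
  ext c
  rw [mem_codesOf, Set.mem_ofPred_eq]
  have hx : ∀ x : Description, (h : x.Valid) → ((∀ ρ, I (ofDescription x) ρ →
      (ofDescription x).NonRecurringFrom ⟨x.2.2.1, h.1⟩ ρ) ↔ ∀ F, ¬ (J F x ∧ RecursBy F x)) := by
    intro x h
    rw [← not_exists, ← exists_recurs_iff h (hIJ · x h)]
    simp only [nonRecurringFrom_iff, not_exists, not_and]
    exact ⟨fun H c hI hc => H _ hI c rfl hc, fun H ρ hI c hρ hc => H c (hρ ▸ hI) hc⟩
  constructor
  · rintro ⟨x, hc, h, H⟩ F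
    exact ⟨x, hc, h, (hx x h).1 H F⟩
  · intro H
    -- Any function will do here, for instance the zero function, to extract the description.
    obtain ⟨x, hc, h, -⟩ := H 0
    refine ⟨x, hc, h, (hx x h).2 fun F => ?_⟩
    obtain ⟨x', hc', -, H'⟩ := H F
    obtain rfl : x' = x := encode_injective (hc'.trans hc.symm)
    exact H'

/-- `F` describes the starting configuration on the word `w` at time `0`. -/
def StartsOn (F : ℕ → ℕ) (w : List Bool) : Prop :=
  lengthAt F 0 = w.length + 1 ∧ headAt F 0 = 1 ∧ stateAt F 0 = 0 ∧
    ∀ j, tapeAt F 0 (j + 1) = encode (w[j]?.map fun b => bif b then 1 else 0)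

theorem startsOn_iff {M : NDTM} {F : ℕ → ℕ} {w : List Bool} {ρ : M.Config}
    (h : Describes F 0 ρ) : StartsOn F w ↔ ρ = M.start w := by
  have hw : ∀ j, encode (w[j]?.map fun b => bif b then 1 else 0) =
      cell ((M.start w).t (j + 1)) := by
    intro j
    show _ = cell (w[j]?.map M.bit)
    cases w[j]? with
    | none => rfl
    | some b => cases b <;> rfl
  unfold StartsOn
  rw [h.length, h.head, h.state]
  simp only [h.tape, hw, cell_injective.eq_iff]
  constructor
  · rintro ⟨h1, h2, h3, h4⟩
    obtain ⟨n, t, p, q, h5, _, _, _, _⟩ := ρ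
    have ht : t = (M.start w).t := by
      funext j
      cases j with
      | zero => exact h5 0 (.inl rfl)
      | succ j => exact h4 j
    simp only at h1 h2 h3
    have hq : q = 0 := Fin.ext h3
    subst h1 h2 ht hq
    rfl
  · rintro rfl
    exact ⟨rfl, rfl, rfl, fun _ => rfl⟩

theorem arith_startsOn : Arith StartsOn := by
  have h0 {α : Type} [Primcodable α] : ArithFun fun (_ : ℕ → ℕ) (_ : α) => 0 := arithFun_const 0
  have hbit : Primrec fun a : List Bool × ℕ => encode (a.1[a.2]?.map fun b => bif b then 1 else 0) :=
    .comp .encode (.option_map (.comp .list_getElem? (.pair .fst .snd))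
      (Primrec.cond .snd (.const 1) (.const 0)).to₂)
  exact .and (.eq (arithFun_lengthAt h0) (.of_primrec (.comp .succ .list_length))) (.and
    (.eq (arithFun_headAt h0) (arithFun_const 1)) (.and (.eq (arithFun_stateAt h0) h0)
    (.all (.eq (arithFun_tapeAt h0 (.of_primrec (.comp .succ .snd))) (.of_primrec hbit)))))

theorem isPi11_nonRecurringOn_nil : IsPi11 (codesOf fun M qr => M.NonRecurringOn qr []) := by
  have h := isPi11_codesOf (I := fun M ρ => ρ = M.start []) (J := fun F _ => StartsOn F [])
    (arith_startsOn.comp (.const [])) fun F x _ ρ h => startsOn_iff h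
  simpa [NonRecurringOn] using h

theorem isPi11_universallyNonRecurring :
    IsPi11 (codesOf fun M qr => M.UniversallyNonRecurring qr) := by
  have h := isPi11_codesOf (I := fun M ρ => ∃ w, ρ = M.start w)
    (J := fun F _ => ∃ w, StartsOn F w) (.ex (arith_startsOn.comp .snd))
    fun F x _ ρ h => exists_congr fun w => startsOn_iff h
  simpa [UniversallyNonRecurring, NonRecurringOn] using h

theorem isPi11_robustNonRecurring : IsPi11 (codesOf fun M qr => M.RobustNonRecurring qr) := by
  have h := isPi11_codesOf (I := fun _ _ => True) (J := fun _ _ => True)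
    (.of_pred (.of_eq (Primrec.eq.comp (.const 0) (.const 0)) fun _ => by simp)) fun F x _ ρ h => Iff.rfl
  simpa [RobustNonRecurring] using h

end NDTM

end

section
open FirstOrder FirstOrder.Language Encodable

/-! ### A normal form for `Π¹₁` sets -/

/-- The list of the first `k` values of `f`. -/
def initialSegment (f : ℕ → ℕ) (k : ℕ) : List ℕ := (List.range k).map f

@[simp] theorem length_initialSegment (f : ℕ → ℕ) (k : ℕ) : (initialSegment f k).length = k := by
  simp [initialSegment]

theorem map_initialSegment (g f : ℕ → ℕ) (k : ℕ) :
    (initialSegment f k).map g = initialSegment (fun i => g (f i)) k := by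
  simp [initialSegment, Function.comp_def]

theorem take_initialSegment (f : ℕ → ℕ) {j k : ℕ} (h : j ≤ k) :
    (initialSegment f k).take j = initialSegment f j := by
  simp [initialSegment, ← List.map_take, List.take_range, h]

theorem getD_initialSegment (f : ℕ → ℕ) {j k : ℕ} (h : j < k) (d : ℕ) :
    (initialSegment f k).getD j d = f j := by
  simp [initialSegment, List.getD, h]

theorem getD_initialSegment_of_le (f : ℕ → ℕ) {j k : ℕ} (h : k ≤ j) (d : ℕ) :
    (initialSegment f k).getD j d = d := by
  simp [initialSegment, List.getD, h]

/-- Relations between a function and a list of numbers of the form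
`∃ f, ∀ k, R (X|k+1, f|k+1, e)` with a primitive recursive `R`. -/
def SigmaNF (P : (ℕ → ℕ) → List ℕ → Prop) : Prop :=
  ∃ R : List ℕ × List ℕ × List ℕ → Prop, PrimrecPred R ∧ ∀ X e,
    P X e ↔ ∃ f, ∀ k, R (initialSegment X (k + 1), initialSegment f (k + 1), e)

namespace SigmaNF
variable {P Q : (ℕ → ℕ) → List ℕ → Prop}

theorem of_iff (h : SigmaNF P) (H : ∀ X e, Q X e ↔ P X e) : SigmaNF Q :=
  let ⟨R, hR, h⟩ := h
  ⟨R, hR, fun X e => (H X e).trans (h X e)⟩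

theorem of_pred {p : List ℕ → Prop} (hp : PrimrecPred p) : SigmaNF fun _ e => p e :=
  ⟨fun a => p a.2.2, hp.comp (.comp .snd .snd), fun X e => by simp⟩

theorem and : SigmaNF P → SigmaNF Q → SigmaNF fun X e => P X e ∧ Q X e := by
  rintro ⟨R, hR, hP⟩ ⟨S, hS, hQ⟩
  have h1 : Primrec fun l : List ℕ => l.map fun a => a.unpair.1 :=
    .list_map .id (Primrec.fst.comp (.comp .unpair .snd)).to₂
  have h2 : Primrec fun l : List ℕ => l.map fun a => a.unpair.2 :=
    .list_map .id (Primrec.snd.comp (.comp .unpair .snd)).to₂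
  refine ⟨fun a => R (a.1, a.2.1.map fun a => a.unpair.1, a.2.2) ∧
    S (a.1, a.2.1.map fun a => a.unpair.2, a.2.2), .and ?_ ?_, fun X e => ?_⟩
  · exact hR.comp (.pair .fst (.pair (h1.comp (.comp .fst .snd)) (.comp .snd .snd)))
  · exact hS.comp (.pair .fst (.pair (h2.comp (.comp .fst .snd)) (.comp .snd .snd)))
  · simp only [map_initialSegment, hP, hQ]
    constructor
    · rintro ⟨⟨f, hf⟩, g, hg⟩
      exact ⟨fun i => Nat.pair (f i) (g i), fun k => by simpa using ⟨hf k, hg k⟩⟩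
    · rintro ⟨f, hf⟩
      exact ⟨⟨_, fun k => (hf k).1⟩, _, fun k => (hf k).2⟩

/-- The witness for the number quantifier is kept in the left component of the first value of `f`,
which every nonempty initial segment shows; the right components form the old witness function. -/
theorem ex {P : (ℕ → ℕ) → List ℕ → ℕ → Prop} {Q : (ℕ → ℕ) → List ℕ → Prop} (hQ : SigmaNF Q)
    (h : ∀ X e a, P X e a ↔ Q X (a :: e)) : SigmaNF fun X e => ∃ a, P X e a := by
  obtain ⟨R, hR, hQ⟩ := hQ
  have h1 : Primrec fun l : List ℕ => l.headI.unpair.1 :=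
    Primrec.fst.comp (.comp .unpair .list_headI)
  have h2 : Primrec fun l : List ℕ => l.map fun a => a.unpair.2 :=
    .list_map .id (Primrec.snd.comp (.comp .unpair .snd)).to₂
  refine ⟨fun a => R (a.1, a.2.1.map fun a => a.unpair.2, a.2.1.headI.unpair.1 :: a.2.2),
    hR.comp (.pair .fst (.pair (h2.comp (.comp .fst .snd))
      (.comp .list_cons (.pair (h1.comp (.comp .fst .snd)) (.comp .snd .snd))))), fun X e => ?_⟩
  have hhead : ∀ (f : ℕ → ℕ) k, (initialSegment f (k + 1)).headI = f 0 := by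
    intro f k
    simp [initialSegment, List.range_succ_eq_map]
  simp only [map_initialSegment, hhead, h, hQ]
  constructor
  · rintro ⟨a, f, hf⟩
    exact ⟨fun i => Nat.pair a (f i), fun k => by simpa using hf k⟩
  · rintro ⟨f, hf⟩
    exact ⟨_, _, hf⟩

/-- A disjunction is a choice of a number that selects the disjunct, so it reduces to `ex` for a
relation that tests the head of the list. -/
theorem or (hP : SigmaNF P) (hQ : SigmaNF Q) : SigmaNF fun X e => P X e ∨ Q X e := by
  obtain ⟨R, hR, hP⟩ := hP
  obtain ⟨S, hS, hQ⟩ := hQ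
  have hcons : PrimrecPred fun a : List ℕ × List ℕ × List ℕ => a.2.2.headI = 0 :=
    Primrec.eq.comp (.comp .list_headI (.comp .snd .snd)) (.const 0)
  have htail : Primrec fun a : List ℕ × List ℕ × List ℕ => (a.1, a.2.1, a.2.2.tail) :=
    .pair .fst (.pair (.comp .fst .snd) (.comp .list_tail (.comp .snd .snd)))
  have h : SigmaNF fun X e => (e.headI = 0 ∧ P X e.tail) ∨ (¬ e.headI = 0 ∧ Q X e.tail) := by
    refine ⟨fun a => (a.2.2.headI = 0 ∧ R (a.1, a.2.1, a.2.2.tail)) ∨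
      (¬ a.2.2.headI = 0 ∧ S (a.1, a.2.1, a.2.2.tail)),
      .or (.and hcons (hR.comp htail)) (.and hcons.not (hS.comp htail)), fun X e => ?_⟩
    by_cases he : e.headI = 0 <;> simp [he, hP, hQ]
  refine (ex h (P := fun X e a => (a = 0 ∧ P X e) ∨ (¬ a = 0 ∧ Q X e)) fun X e a => Iff.rfl).of_iff
    fun X e => ⟨?_, ?_⟩
  · rintro (h | h)
    exacts [⟨0, .inl ⟨rfl, h⟩⟩, ⟨1, .inr ⟨one_ne_zero, h⟩⟩]
  · rintro ⟨a, ⟨-, h⟩ | ⟨-, h⟩⟩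
    exacts [.inl h, .inr h]

/-- By choice, the witness functions for all `a` merge into one `f` with columns `j ↦ f (pair a j)`.
The segment of length `K + 1` is used to check the single condition with `(a, k) = K.unpair`. It is
long enough, because `pair a j ≤ pair a k = K` for `j ≤ k`. -/
theorem all {P : (ℕ → ℕ) → List ℕ → ℕ → Prop} {Q : (ℕ → ℕ) → List ℕ → Prop} (hQ : SigmaNF Q)
    (h : ∀ X e a, P X e a ↔ Q X (a :: e)) : SigmaNF fun X e => ∀ a, P X e a := by
  obtain ⟨R, hR, hQ⟩ := hQ
  have hn : Primrec fun a : List ℕ × List ℕ × List ℕ => (a.2.1.length - 1).unpair :=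
    .comp .unpair (.comp .pred (.comp .list_length (.comp .fst .snd)))
  have hk : Primrec fun a : List ℕ × List ℕ × List ℕ => (a.2.1.length - 1).unpair.2 + 1 :=
    .comp .succ (.comp .snd hn)
  have hg : Primrec₂ fun (a : List ℕ × List ℕ × List ℕ) j =>
      a.2.1.getD (Nat.pair (a.2.1.length - 1).unpair.1 j) 0 :=
    (Primrec.list_getD 0).comp (.comp .fst (.comp .snd .fst))
      (Primrec₂.natPair.comp (.comp .fst (hn.comp .fst)) .snd)
  refine ⟨fun a => R (a.1.take ((a.2.1.length - 1).unpair.2 + 1),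
    (List.range ((a.2.1.length - 1).unpair.2 + 1)).map fun j =>
      a.2.1.getD (Nat.pair (a.2.1.length - 1).unpair.1 j) 0,
    (a.2.1.length - 1).unpair.1 :: a.2.2), hR.comp (.pair (Primrec.list_take.comp hk .fst)
      (.pair (.list_map (.comp .list_range hk) hg)
        (Primrec.list_cons.comp (.comp .fst hn) (.comp .snd .snd)))), fun X e => ?_⟩
  have key : ∀ f : ℕ → ℕ, ∀ K,
      (List.range (K.unpair.2 + 1)).map (fun j =>
        (initialSegment f (K + 1)).getD (Nat.pair K.unpair.1 j) 0) =
      initialSegment (fun j => f (Nat.pair K.unpair.1 j)) (K.unpair.2 + 1) := by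
    intro f K
    refine List.map_congr_left fun j hj => ?_
    rw [getD_initialSegment]
    rw [List.mem_range] at hj
    have h1 : Nat.pair K.unpair.1 j ≤ Nat.pair K.unpair.1 K.unpair.2 := by
      rcases (Nat.lt_succ_iff.1 hj).lt_or_eq with hlt | heq
      · exact (Nat.pair_lt_pair_right _ hlt).le
      · rw [heq]
    rw [Nat.pair_unpair] at h1
    omega
  have hle : ∀ K : ℕ, K.unpair.2 + 1 ≤ K + 1 := fun K => Nat.succ_le_succ (Nat.unpair_right_le K)
  simp only [length_initialSegment, Nat.add_sub_cancel, key, take_initialSegment X (hle _), h, hQ]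
  constructor
  · intro H
    choose g hg using H
    exact ⟨fun z => g z.unpair.1 z.unpair.2, fun K => by simpa using hg K.unpair.1 K.unpair.2⟩
  · rintro ⟨f, hf⟩ a
    exact ⟨fun j => f (Nat.pair a j), fun k => by simpa using hf (Nat.pair a k)⟩

/-- The default value `1` makes the test succeed as long as the initial segment is too short to
contain the argument `g e`; the segment with `k = g e` then decides. In `eq_zero` the default `0`
plays the same role. -/
theorem ne_zero {g : List ℕ → ℕ} (hg : Primrec g) : SigmaNF fun X e => X (g e) ≠ 0 := by
  refine ⟨fun a => ¬ a.1.getD (g a.2.2) 1 = 0, .not (Primrec.eq.comp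
    ((Primrec.list_getD 1).comp .fst (hg.comp (.comp .snd .snd))) (.const 0)), fun X e => ?_⟩
  constructor
  · refine fun h => ⟨0, fun k => ?_⟩
    rcases Nat.lt_or_ge (g e) (k + 1) with hk | hk
    · simpa only [getD_initialSegment X hk]
    · simp only [getD_initialSegment_of_le X hk]; simp
  · rintro ⟨f, hf⟩
    simpa only [getD_initialSegment X (Nat.lt_succ_self (g e))] using hf (g e)

theorem eq_zero {g : List ℕ → ℕ} (hg : Primrec g) : SigmaNF fun X e => X (g e) = 0 := by
  refine ⟨fun a => a.1.getD (g a.2.2) 0 = 0, Primrec.eq.comp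
    ((Primrec.list_getD 0).comp .fst (hg.comp (.comp .snd .snd))) (.const 0), fun X e => ?_⟩
  constructor
  · refine fun h => ⟨0, fun k => ?_⟩
    rcases Nat.lt_or_ge (g e) (k + 1) with hk | hk
    · simpa only [getD_initialSegment X hk]
    · simp only [getD_initialSegment_of_le X hk]
  · rintro ⟨f, hf⟩
    simpa only [getD_initialSegment X (Nat.lt_succ_self (g e))] using hf (g e)

end SigmaNF

/-! ### Skolemization of arithmetical formulas -/

/-- The sets coded by a function. -/
def setsOf (X : ℕ → ℕ) (i : ℕ) : Set ℕ := {m | X (Nat.pair i m) ≠ 0}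

/-- The values of the bound variables, the last variable coming first in the list. -/
def boundValues (n : ℕ) (e : List ℕ) (i : Fin n) : ℕ := e.getD (n - 1 - i) 0

theorem snoc_boundValues (n : ℕ) (e : List ℕ) (a : ℕ) :
    (Fin.snoc (boundValues n e) a : Fin (n + 1) → ℕ) = boundValues (n + 1) (a :: e) := by
  funext i
  refine Fin.lastCases ?_ (fun i => ?_) i
  · simp [boundValues]
  · have : n - i = (n - 1 - i) + 1 := by omega
    simp [boundValues, this]

/-- The list `e` is the whole environment: its first `n` entries are the bound variables and the
entry at position `n` is the free variable. Terms contain no set variables, so their values do not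
depend on `X`. -/
theorem exists_primrec_realize_term {n : ℕ} (t : arithLang.Term (Unit ⊕ Fin n)) :
    ∃ g : List ℕ → ℕ, Primrec g ∧ ∀ X e, @Term.realize arithLang ℕ (natModel X) _
      (Sum.elim (fun _ => e.getD n 0) (boundValues n e)) t = g e := by
  induction t with
  | var i =>
    rcases i with i | i
    · exact ⟨fun e => e.getD n 0, (Primrec.list_getD 0).comp .id (.const n), fun X e => rfl⟩
    · exact ⟨fun e => e.getD (n - 1 - i) 0, (Primrec.list_getD 0).comp .id (.const _),
        fun X e => rfl⟩
  | func f ts ih =>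
    choose g hg h using ih
    cases f with
    | zero => exact ⟨fun _ => 0, .const 0, fun X e => rfl⟩
    | one => exact ⟨fun _ => 1, .const 1, fun X e => rfl⟩
    | add => exact ⟨fun e => g 0 e + g 1 e, Primrec.nat_add.comp (hg 0) (hg 1),
        fun X e => congrArg₂ (· + ·) (h 0 X e) (h 1 X e)⟩
    | mul => exact ⟨fun e => g 0 e * g 1 e, Primrec.nat_mul.comp (hg 0) (hg 1),
        fun X e => congrArg₂ (· * ·) (h 0 X e) (h 1 X e)⟩

/-- The normal form is proved for a formula and its negation together: implication needs the
negation of its premise, and the negation of a universal formula is existential. -/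
theorem sigmaNF_realize {n : ℕ} (φ : arithLang.BoundedFormula Unit n) :
    (SigmaNF fun X e => @BoundedFormula.Realize arithLang ℕ (natModel (setsOf X)) _ _ φ
      (fun _ => e.getD n 0) (boundValues n e)) ∧
    SigmaNF fun X e => ¬ @BoundedFormula.Realize arithLang ℕ (natModel (setsOf X)) _ _ φ
      (fun _ => e.getD n 0) (boundValues n e) := by
  induction φ with
  | falsum =>
    have h : PrimrecPred fun _ : List ℕ => False :=
      .of_eq (Primrec.eq.comp (.const 0) (.const 1)) fun _ => by simp
    exact ⟨SigmaNF.of_pred h, SigmaNF.of_pred h.not⟩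
  | @equal n t s =>
    obtain ⟨f, hf, ht⟩ := exists_primrec_realize_term t
    obtain ⟨g, hg, hs⟩ := exists_primrec_realize_term s
    have h := Primrec.eq.comp hf hg
    have key : ∀ X e, @BoundedFormula.Realize arithLang ℕ (natModel (setsOf X)) _ _ (.equal t s)
        (fun _ => e.getD n 0) (boundValues n e) ↔ f e = g e := by
      intro X e
      rw [← ht (setsOf X), ← hs (setsOf X)]
      rfl
    exact ⟨(SigmaNF.of_pred h).of_iff key, (SigmaNF.of_pred h.not).of_iff
      fun X e => not_congr (key X e)⟩
  | @rel n l R ts =>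
    cases R with
    | set i =>
      obtain ⟨g, hg, h⟩ := exists_primrec_realize_term (ts 0)
      have hg' : Primrec fun e => Nat.pair i (g e) := Primrec₂.natPair.comp (.const i) hg
      have key : ∀ X e, @BoundedFormula.Realize arithLang ℕ (natModel (setsOf X)) _ _
          (.rel (ArithRel.set i) ts)
          (fun _ => e.getD n 0) (boundValues n e) ↔ X (Nat.pair i (g e)) ≠ 0 := by
        intro X e
        rw [← h (setsOf X)]
        rfl
      exact ⟨(SigmaNF.ne_zero hg').of_iff key, (SigmaNF.eq_zero hg').of_iff
        fun X e => (not_congr (key X e)).trans not_not⟩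
  | imp φ ψ hφ hψ =>
    refine ⟨(hφ.2.or hψ.1).of_iff fun X e => ?_, (hφ.1.and hψ.2).of_iff fun X e => ?_⟩
    · let _ := natModel (setsOf X)
      rw [BoundedFormula.realize_imp]; tauto
    · let _ := natModel (setsOf X)
      rw [BoundedFormula.realize_imp]; tauto
  | @all n φ hφ =>
    have key : ∀ X e a, @BoundedFormula.Realize arithLang ℕ (natModel (setsOf X)) _ _ φ
        (fun _ => e.getD n 0) (Fin.snoc (boundValues n e) a) ↔
        @BoundedFormula.Realize arithLang ℕ (natModel (setsOf X)) _ _ φ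
        (fun _ => (a :: e).getD (n + 1) 0) (boundValues (n + 1) (a :: e)) := by
      intro X e a
      rw [snoc_boundValues]; rfl
    refine ⟨(SigmaNF.all hφ.1 key).of_iff fun X e => ?_,
      (SigmaNF.ex hφ.2 fun X e a => not_congr (key X e a)).of_iff fun X e => ?_⟩
    · let _ := natModel (setsOf X)
      rw [BoundedFormula.realize_all]
    · let _ := natModel (setsOf X)
      rw [BoundedFormula.realize_all, not_forall]

/-- Normal form of `Π¹₁` sets: the complement consists of those `n` for which there is a function
all of whose nonempty initial segments satisfy a primitive recursive condition. -/
theorem IsPi11.exists_initialSegment {B : Set ℕ} (hB : IsPi11 B) :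
    ∃ R : ℕ × List ℕ → Prop, PrimrecPred R ∧
      ∀ n, n ∉ B ↔ ∃ h, ∀ k, R (n, initialSegment h (k + 1)) := by
  obtain ⟨φ, hφ⟩ := hB
  obtain ⟨R, hR, H⟩ := (sigmaNF_realize φ).2
  have h1 : Primrec fun l : List ℕ => l.map fun a => a.unpair.1 :=
    .list_map .id (Primrec.fst.comp (.comp .unpair .snd)).to₂
  have h2 : Primrec fun l : List ℕ => l.map fun a => a.unpair.2 :=
    .list_map .id (Primrec.snd.comp (.comp .unpair .snd)).to₂
  -- The set parameter `X` and the Skolem function `f` are the two components of a single function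
  -- `h`.
  refine ⟨fun a => R (a.2.map fun a => a.unpair.1, a.2.map fun a => a.unpair.2, [a.1]),
    hR.comp (.pair (h1.comp .snd) (.pair (h2.comp .snd)
      (Primrec.list_cons.comp .fst (.const [])))), fun n => ?_⟩
  have hn : n ∉ B ↔ ∃ X : ℕ → ℕ, ¬ @Formula.Realize arithLang ℕ (natModel (setsOf X)) Unit φ
      (fun _ => n) := by
    rw [hφ, not_forall]
    constructor
    · classical
      rintro ⟨X, hX⟩
      refine ⟨fun z => if z.unpair.2 ∈ X z.unpair.1 then 1 else 0, ?_⟩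
      convert hX
      ext i m
      simp [setsOf]
    · rintro ⟨X, hX⟩
      exact ⟨_, hX⟩
  have hn' : ∀ X : ℕ → ℕ, (¬ @Formula.Realize arithLang ℕ (natModel (setsOf X)) Unit φ
      (fun _ => n)) ↔ ∃ f, ∀ k, R (initialSegment X (k + 1), initialSegment f (k + 1), [n]) := by
    intro X
    refine Iff.trans ?_ (H X [n])
    exact not_congr (iff_of_eq (congrArg (@BoundedFormula.Realize arithLang ℕ (natModel (setsOf X))
      Unit 0 φ fun _ => n) (Subsingleton.elim _ _)))
  simp only [hn, hn', map_initialSegment]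
  constructor
  · rintro ⟨X, f, hf⟩
    exact ⟨fun i => Nat.pair (X i) (f i), fun k => by simpa using hf k⟩
  · rintro ⟨h, hh⟩
    exact ⟨_, _, hh⟩

/-- Normal form of `Π¹₁` sets: the complement consists of those `n` for which there is an infinite
chain of a primitive recursive relation; the chain may start at `0`. -/
theorem IsPi11.exists_chain {B : Set ℕ} (hB : IsPi11 B) :
    ∃ T : ℕ → ℕ → ℕ → Prop, PrimrecPred (fun a : ℕ × ℕ × ℕ => T a.1 a.2.1 a.2.2) ∧
      (∀ n, n ∉ B → ∃ σ : ℕ → ℕ, σ 0 = 0 ∧ ∀ i, T n (σ i) (σ (i + 1))) ∧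
      ∀ n (σ : ℕ → ℕ), (∀ i, T n (σ i) (σ (i + 1))) → n ∉ B := by
  obtain ⟨R, hR, H⟩ := hB.exists_initialSegment
  let L : ℕ → List ℕ := Denumerable.ofNat (List ℕ)
  have hL : Primrec L := .ofNat _
  -- Nodes are finite sequences, stored in reverse so that a one-step extension is a `cons`. All
  -- nonempty prefixes of `L y` are checked, not only the longest: a chain that starts at an
  -- arbitrary node must also vouch for the prefixes of that node.
  refine ⟨fun n s y => (L y ≠ [] ∧ (L y).tail = L s) ∧
      ∀ j ∈ List.range (L y).length, R (n, ((L y).drop j).reverse), ?_, fun n hn => ?_, ?_⟩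
  · have hy : Primrec fun a : ℕ × ℕ × ℕ => L a.2.2 := hL.comp (.comp .snd .snd)
    refine .and (.and (.not (Primrec.eq.comp hy (.const []))) (Primrec.eq.comp
      (.comp .list_tail hy) (hL.comp (.comp .fst .snd)))) ?_
    have hrel : PrimrecRel fun (j : ℕ) (a : ℕ × ℕ × ℕ) => R (a.1, ((L a.2.2).drop j).reverse) :=
      hR.comp (.pair (.comp .fst .snd) (.comp .list_reverse
        (Primrec.list_drop.comp .fst (hy.comp .snd))))
    exact hrel.forall_mem_list.comp (.comp .list_range (.comp .list_length hy)) .id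
  · obtain ⟨h, hh⟩ := (H n).1 hn
    refine ⟨fun i => encode (initialSegment h i).reverse, rfl, fun i => ?_⟩
    simp only [L, Denumerable.ofNat_encode]
    have hs : initialSegment h (i + 1) = initialSegment h i ++ [h i] := by
      simp [initialSegment, List.range_succ]
    refine ⟨⟨by simp [hs], by simp [hs]⟩, fun j hj => ?_⟩
    simp only [List.length_reverse, length_initialSegment, List.mem_range] at hj
    rw [List.drop_reverse, List.reverse_reverse, length_initialSegment,
      take_initialSegment _ (by omega)]
    have := hh (i - j)
    rwa [show i - j + 1 = i + 1 - j by omega] at this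
  · intro n σ hσ
    have hcons : ∀ i, ∃ a, L (σ (i + 1)) = a :: L (σ i) := by
      intro i
      obtain ⟨⟨h1, h2⟩, -⟩ := hσ i
      obtain ⟨a, l, hl⟩ := List.exists_cons_of_ne_nil h1
      exact ⟨a, by rw [← h2, hl]; rfl⟩
    choose b hb using hcons
    set l₀ := (L (σ 0)).reverse with hl₀
    -- The infinite branch consists of the starting node `l₀` followed by the entries that the chain
    -- adds.
    let h : ℕ → ℕ := fun i => if i < l₀.length then l₀.getD i 0 else b (i - l₀.length)
    have hseg : ∀ i, (L (σ i)).reverse = initialSegment h (l₀.length + i) := by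
      intro i
      induction i with
      | zero =>
        rw [← hl₀]
        refine List.ext_getElem (by simp) fun j h1 h2 => ?_
        simp [initialSegment, h, h1]
      | succ i ih =>
        rw [hb, List.reverse_cons, ih, initialSegment, initialSegment, ← Nat.add_assoc,
          List.range_succ, List.map_append]
        simp [h]
    refine (H n).2 ⟨h, fun k => ?_⟩
    obtain ⟨-, h2⟩ := hσ k
    have hlen : (L (σ (k + 1))).length = l₀.length + (k + 1) := by
      have := congrArg List.length (hseg (k + 1))
      simpa using this
    have := h2 l₀.length (by rw [List.mem_range]; omega)
    rw [List.reverse_drop, hseg, hlen, take_initialSegment _ (by omega)] at this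
    rwa [show l₀.length + (k + 1) - l₀.length = k + 1 by omega] at this

end

section
open Function

/-! ### Register machine programs -/

/-- Programs for register machines. -/
inductive Prog
  | skip
  | inc (i : ℕ)
  | seq (p q : Prog)
  | loop (i : ℕ) (p : Prog)

namespace Prog

/-- `Eval p v w` says that the program `p` transforms the registers `v` into `w`.  The loop
`loop i p` decrements the register `i` and performs `p` as long as the register is not zero. -/
inductive Eval : Prog → (ℕ → ℕ) → (ℕ → ℕ) → Prop
  | skip (v) : Eval skip v v
  | inc (i v) : Eval (inc i) v (update v i (v i + 1))
  | seq {p q u v w} : Eval p u v → Eval q v w → Eval (seq p q) u w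
  | loop_zero {i p v} : v i = 0 → Eval (loop i p) v v
  | loop_succ {i p u v w n} : u i = n + 1 → Eval p (update u i n) v → Eval (loop i p) v w →
      Eval (loop i p) u w

theorem Eval.of_eq {p : Prog} {u v w : ℕ → ℕ} (h : Eval p u v) (e : v = w) : Eval p u w := e ▸ h

/-- The execution of a loop with the states `s n, …, s 0`. -/
theorem Eval.loop {i : ℕ} {p : Prog} (s : ℕ → ℕ → ℕ) (hs : ∀ k, s k i = k) (n : ℕ)
    (hp : ∀ k < n, Eval p (update (s (k + 1)) i k) (s k)) : Eval (loop i p) (s n) (s 0) := by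
  induction n with
  | zero => exact .loop_zero (hs 0)
  | succ n ih => exact .loop_succ (hs _) (hp n (by omega)) (ih fun k hk => hp k (by omega))

/-- Set the register `i` to zero. -/
def clear (i : ℕ) : Prog := loop i skip

theorem eval_clear (i : ℕ) (v : ℕ → ℕ) : Eval (clear i) v (update v i 0) := by
  have h := Eval.loop (i := i) (p := skip) (fun k => update v i k) (by simp) (v i)
    fun k _ => by simpa using Eval.skip (update v i k)
  simpa [clear] using h

/-- Add the register `i` to the register `j` and set `i` to zero. -/
def move (i j : ℕ) : Prog := loop i (inc j)

theorem eval_move {i j : ℕ} (hij : i ≠ j) (v : ℕ → ℕ) :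
    Eval (move i j) v (update (update v i 0) j (v j + v i)) := by
  have h := Eval.loop (i := i) (p := inc j) (fun k => update (update v i k) j (v j + (v i - k)))
    (by simp [hij]) (v i) fun k hk => (Eval.inc _ _).of_eq (by
      funext r
      simp only [update_apply]
      split_ifs <;> simp_all
      omega)
  simpa [move] using h

/-- Add the register `i` to the register `j`, using the register `b`. -/
def copy (i j b : ℕ) : Prog := seq (loop i (seq (inc j) (inc b))) (move b i)

theorem eval_copy {i j b : ℕ} (hij : i ≠ j) (hib : i ≠ b) (hjb : j ≠ b) {v : ℕ → ℕ}
    (hv : v b = 0) : Eval (copy i j b) v (update v j (v j + v i)) := by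
  have h := Eval.loop (i := i) (p := seq (inc j) (inc b))
    (fun k => update (update (update v i k) j (v j + (v i - k))) b (v i - k))
    (by simp [hij, hib]) (v i) fun k hk => (Eval.seq (.inc _ _) (.inc _ _)).of_eq (by
      funext r
      simp only [update_apply]
      split_ifs <;> simp_all <;> omega)
  have e : update v b 0 = v := by rw [← hv, update_eq_self]
  simp only [update_eq_self, Nat.sub_self, Nat.add_zero, Nat.sub_zero, e] at h
  refine (h.seq (eval_move hib.symm _)).of_eq ?_
  funext r
  simp only [update_apply]
  split_ifs <;> simp_all

/-- Set the registers `b, …, b + n - 1` to zero. -/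
def clearRange (b : ℕ) : ℕ → Prog
  | 0 => skip
  | n + 1 => seq (clearRange b n) (clear (b + n))

theorem eval_clearRange (b n : ℕ) (v : ℕ → ℕ) :
    Eval (clearRange b n) v fun r => if b ≤ r ∧ r < b + n then 0 else v r := by
  induction n with
  | zero => exact (Eval.skip v).of_eq (by funext r; split_ifs <;> omega)
  | succ n ih =>
    refine (ih.seq (eval_clear _ _)).of_eq ?_
    funext r
    simp only [update_apply]
    split_ifs <;> omega

/-- The function `f` can be computed by programs, for any choice of the input registers `a`, of the
output register `o` and of the bound `b` from which on all registers may be used freely. -/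
def Computes {n : ℕ} (f : List.Vector ℕ n → ℕ) : Prop :=
  ∀ (a : Fin n → ℕ) (o b : ℕ), (∀ i, a i < b) → o < b → (∀ i, a i ≠ o) →
    ∃ p, ∀ v : ℕ → ℕ, (∀ r, b ≤ r → v r = 0) →
      Eval p v (update v o (v o + f (List.Vector.ofFn fun i => v (a i))))

/-- The values of the inner functions go to the registers `b, …, b + n - 1`, each computed with
scratch space from `b + n` on; they serve as inputs of `f` and are cleared in the end, so that the
scratch registers are zero again. -/
theorem computes_comp {m n : ℕ} {f : List.Vector ℕ n → ℕ} {g : Fin n → List.Vector ℕ m → ℕ}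
    (hf : Computes f) (hg : ∀ i, Computes (g i)) :
    Computes fun a => f (List.Vector.ofFn fun i => g i a) := by
  intro a o b ha ho hao
  let G : ℕ → List.Vector ℕ m → ℕ := fun j w => if h : j < n then g ⟨j, h⟩ w else 0
  have hG : ∀ k ≤ n, ∃ p, ∀ v : ℕ → ℕ, (∀ r, b ≤ r → v r = 0) →
      Eval p v fun r => if b ≤ r ∧ r < b + k then
        G (r - b) (List.Vector.ofFn fun i => v (a i)) else v r := by
    intro k
    induction k with
    | zero =>
      exact fun _ => ⟨skip, fun v _ => (Eval.skip v).of_eq (by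
        funext r; split_ifs <;> omega)⟩
    | succ k ih =>
      intro hk
      obtain ⟨p, hp⟩ := ih (by omega)
      obtain ⟨q, hq⟩ := hg ⟨k, hk⟩ a (b + k) (b + n) (fun i => by have := ha i; omega) (by omega)
        fun i => by have := ha i; omega
      refine ⟨p.seq q, fun v hv => ((hp v hv).seq (hq _ fun r hr => ?_)).of_eq ?_⟩
      · rw [if_neg (by omega), hv r (by omega)]
      · have h1 : ∀ i, ¬ (b ≤ a i ∧ a i < b + k) := fun i => by have := ha i; omega
        funext r
        simp only [update_apply, h1, if_false]
        by_cases hr : r = b + k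
        · subst hr
          rw [if_pos rfl, if_neg (by omega), if_pos (by omega), hv _ (by omega)]
          simp [G, show k < n by omega]
        · rw [if_neg hr]
          split_ifs <;> omega
  obtain ⟨p, hp⟩ := hG n le_rfl
  obtain ⟨q, hq⟩ := hf (fun i => b + i) o (b + n) (fun i => by omega) (by omega)
    fun i => by omega
  refine ⟨(p.seq q).seq (clearRange b n), fun v hv => (((hp v hv).seq (hq _ fun r hr => ?_)).seq
    (eval_clearRange b n _)).of_eq ?_⟩
  · rw [if_neg (by omega), hv r (by omega)]
  · funext r
    simp only [update_apply]
    by_cases hr : r = o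
    · subst hr
      rw [if_neg (by omega), if_pos rfl, if_pos rfl, if_neg (by omega)]
      congr 2
      congr 1
      funext i
      simp [G]
    · simp only [hr, if_false]
      split_ifs with h
      · rw [hv _ h.1]
      · rfl

/-- Register `b` counts the remaining rounds, `b + 1` holds the current value of the recursion, `b +
2` the index of the round and `b + 3` receives the next value. The programs for `f` and `g` use
scratch space from `b + 4` on. -/
theorem computes_prec {n : ℕ} {f : List.Vector ℕ n → ℕ} {g : List.Vector ℕ (n + 2) → ℕ}
    (hf : Computes f) (hg : Computes g) :
    Computes fun v : List.Vector ℕ (n + 1) =>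
      v.head.rec (f v.tail) fun y IH => g (y ::ᵥ IH ::ᵥ v.tail) := by
  intro a o b ha ho hao
  obtain ⟨p, hp⟩ := hf (fun i => a i.succ) (b + 1) (b + 4) (fun i => by have := ha i.succ; omega)
    (by omega) fun i => by have := ha i.succ; omega
  obtain ⟨q, hq⟩ := hg (Fin.cons (b + 2) (Fin.cons (b + 1) fun i => a i.succ)) (b + 3) (b + 4)
    (by
      refine Fin.cases (by simp) (Fin.cases (by simp) fun i => ?_)
      have := ha i.succ
      simp; omega) (by omega)
    (by
      refine Fin.cases (by simp) (Fin.cases (by simp) fun i => ?_)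
      have := ha i.succ
      simp; omega)
  refine ⟨(((p.seq (copy (a 0) b (b + 4))).seq (loop b ((q.seq (clear (b + 1))).seq
    ((move (b + 3) (b + 1)).seq (inc (b + 2)))))).seq (move (b + 1) o)).seq (clear (b + 2)),
    fun v hv => ?_⟩
  set N := v (a 0) with hN
  set w := List.Vector.ofFn fun i : Fin n => v (a i.succ) with hw
  let R : ℕ → ℕ := fun k => k.rec (f w) fun y IH => g (y ::ᵥ IH ::ᵥ w)
  have ha0 := ha 0
  -- The registers when `k` rounds remain, that is, after `N - k` rounds.
  let s : ℕ → ℕ → ℕ := fun k => update (update (update v b k) (b + 1) (R (N - k))) (b + 2) (N - k)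
  have h1 : Eval (p.seq (copy (a 0) b (b + 4))) v (s N) := by
    refine ((hp v fun r hr => hv r (by omega)).seq (eval_copy (by omega) (by omega) (by omega)
      ?_)).of_eq ?_
    · rw [update_of_ne (by omega), hv _ (by omega)]
    · have hb := hv b le_rfl
      have hb1 := hv (b + 1) (by omega)
      have hb2 := hv (b + 2) (by omega)
      funext r
      simp only [s, update_apply, Nat.sub_self]
      split_ifs <;> first | omega | simp_all [R]
  have h2 : Eval (loop b ((q.seq (clear (b + 1))).seq ((move (b + 3) (b + 1)).seq (inc (b + 2)))))
      (s N) (s 0) := by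
    refine Eval.loop s (fun k => by simp [s]) N fun k hk => ?_
    have hb3 := hv (b + 3) (by omega)
    refine (((hq _ fun r hr => ?_).seq (eval_clear _ _)).seq ((eval_move (by omega) _).seq
      (.inc _ _))).of_eq ?_
    · simp only [s, update_apply]
      rw [if_neg (by omega), if_neg (by omega), if_neg (by omega), if_neg (by omega),
        hv r (by omega)]
    · have hargs : (List.Vector.ofFn fun i : Fin (n + 2) => update (s (k + 1)) b k
          ((Fin.cons (b + 2) (Fin.cons (b + 1) fun i => a i.succ) : Fin (n + 2) → ℕ) i)) =
          (N - (k + 1)) ::ᵥ R (N - (k + 1)) ::ᵥ w := by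
        have hs : ∀ i : Fin n, update (s (k + 1)) b k (a i.succ) = v (a i.succ) := by
          intro i
          have := ha i.succ
          simp only [s, update_apply]
          rw [if_neg (by omega), if_neg (by omega), if_neg (by omega), if_neg (by omega)]
        simp [List.Vector.ofFn, hs, s, hw]
      have hR : g ((N - (k + 1)) ::ᵥ R (N - (k + 1)) ::ᵥ w) = R (N - k) := by
        rw [show N - k = (N - (k + 1)) + 1 by omega]
      rw [hargs, hR]
      funext r
      simp only [s, update_apply]
      split_ifs <;> first | omega | simp_all
  have hRN : R N = Nat.rec (motive := fun _ => ℕ) (f (List.Vector.ofFn fun i => v (a i)).tail)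
      (fun y IH => g (y ::ᵥ IH ::ᵥ (List.Vector.ofFn fun i => v (a i)).tail))
      (List.Vector.ofFn fun i => v (a i)).head := by
    simp [R, hN, hw, List.Vector.ofFn]
  beta_reduce
  rw [← hRN]
  refine (((h1.seq h2).seq (eval_move (by omega) _)).seq (eval_clear _ _)).of_eq ?_
  have hb := hv b le_rfl
  have hb1 := hv (b + 1) (by omega)
  have hb2 := hv (b + 2) (by omega)
  funext r
  simp only [s, update_apply]
  split_ifs <;> first | omega | simp_all

/-- Programs compute all primitive recursive functions. -/
theorem computes_of_primrec {n : ℕ} {f : List.Vector ℕ n → ℕ} (hf : Nat.Primrec' f) :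
    Computes f := by
  induction hf with
  | zero => exact fun a o b _ _ _ => ⟨skip, fun v _ => by simpa using Eval.skip v⟩
  | succ =>
    intro a o b ha ho hao
    refine ⟨(copy (a 0) o b).seq (inc o), fun v hv => ((eval_copy (hao 0) (ha 0).ne ho.ne
      (hv b le_rfl)).seq (.inc _ _)).of_eq ?_⟩
    simp [List.Vector.ofFn, Nat.add_assoc]
  | get i =>
    intro a o b ha ho hao
    refine ⟨copy (a i) o b, fun v hv => (eval_copy (hao i) (ha i).ne ho.ne (hv b le_rfl)).of_eq ?_⟩
    simp
  | comp g _ _ hf hg => exact computes_comp hf hg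
  | prec _ _ hf hg => exact computes_prec hf hg

end Prog

end

section
open Function Relation

/-! ### Counter machines -/

/-- Instructions of nondeterministic counter machines: increment a counter; decrement a counter
or branch if it is zero; jump to one of two labels; halt. -/
inductive Instr
  | inc (i l : ℕ)
  | dec (i lz lnz : ℕ)
  | jump (l₁ l₂ : ℕ)
  | halt

namespace Instr

/-- The possible results of an instruction. -/
def next : Instr → (ℕ → ℕ) → Set (ℕ × (ℕ → ℕ))
  | inc i l, v => {(l, update v i (v i + 1))}
  | dec i lz lnz, v => if v i = 0 then {(lz, v)} else {(lnz, update v i (v i - 1))}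
  | jump l₁ l₂, v => {(l₁, v), (l₂, v)}
  | halt, _ => ∅

/-- The instruction only uses counters below `K` and labels below `B`. -/
def Bounded (K B : ℕ) : Instr → Prop
  | inc i l => i < K ∧ l < B
  | dec i lz lnz => i < K ∧ lz < B ∧ lnz < B
  | jump l₁ l₂ => l₁ < B ∧ l₂ < B
  | halt => True

/-- Deterministic computations of a counter machine. -/
def Det (P : ℕ → Instr) : ℕ × (ℕ → ℕ) → ℕ × (ℕ → ℕ) → Prop :=
  ReflTransGen fun s t => (P s.1).next s.2 = {t}

/-- The list `L` of instructions is found in the program `P` from label `s` on. -/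
def Located (P : ℕ → Instr) (L : List Instr) (s : ℕ) : Prop :=
  ∀ j I, L[j]? = some I → P (s + j) = I

theorem Located.append {P : ℕ → Instr} {L L' : List Instr} {s : ℕ} (h : Located P (L ++ L') s) :
    Located P L s ∧ Located P L' (s + L.length) := by
  constructor
  · intro j I hj
    refine h j I ?_
    rw [List.getElem?_append_left (List.getElem?_eq_some_iff.1 hj).1, hj]
  · intro j I hj
    rw [Nat.add_assoc]
    refine h _ I ?_
    rw [List.getElem?_append_right (by omega), Nat.add_sub_cancel_left, hj]

theorem Located.cons {P : ℕ → Instr} {I : Instr} {L : List Instr} {s : ℕ}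
    (h : Located P (I :: L) s) : P s = I ∧ Located P L (s + 1) :=
  ⟨h 0 I rfl, (Located.append (L := [I]) h).2⟩

end Instr

namespace Prog
open Instr

/-- The compiled program, for the entry label `s` and the exit label `e`. -/
def compile : Prog → ℕ → ℕ → List Instr
  | skip, _, e => [.jump e e]
  | inc i, _, e => [.inc i e]
  | seq p q, s, e => p.compile s (s + (p.compile 0 0).length) ++
      q.compile (s + (p.compile 0 0).length) e
  | loop i p, s, e => .dec i e (s + 1) :: p.compile (s + 1) s

/-- Labels do not affect the length of the code; so the length for the dummy labels `0, 0` gives the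
positions of later code. -/
theorem length_compile (p : Prog) (s e : ℕ) :
    (p.compile s e).length = (p.compile 0 0).length := by
  induction p generalizing s e with
  | skip => rfl
  | inc i => rfl
  | seq p q hp hq =>
    simp only [compile, List.length_append, hp s, hq (s + _), hp 0 (0 + _), hq (0 + _)]
  | loop i p hp => simp only [compile, List.length_cons, hp (s + 1), hp (0 + 1)]

theorem length_compile_pos (p : Prog) : 0 < (p.compile 0 0).length := by
  induction p with
  | seq p q hp hq =>
    simp only [compile, List.length_append, length_compile p 0 (0 + _)]; omega
  | _ => simp [compile]

/-- A bound for the registers of a program. -/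
def bound : Prog → ℕ
  | skip => 0
  | inc i => i + 1
  | seq p q => max p.bound q.bound
  | loop i p => max (i + 1) p.bound

theorem bounded_compile (p : Prog) {K B s e : ℕ} (hK : p.bound ≤ K)
    (hs : s + (p.compile 0 0).length ≤ B) (he : e < B) : ∀ I ∈ p.compile s e, I.Bounded K B := by
  induction p generalizing s e with
  | skip => simp [compile, Bounded, he]
  | inc i => simp [compile, Bounded, he]; simpa [bound] using hK
  | seq p q hp hq =>
    have hq0 := q.length_compile_pos
    simp only [compile, List.length_append, length_compile p 0 (0 + _),
      length_compile q (0 + _)] at hs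
    simp only [bound, max_le_iff] at hK
    simp only [compile, List.mem_append]
    rintro I (hI | hI)
    · exact hp hK.1 (by omega) (by omega) I hI
    · exact hq hK.2 (by omega) he I hI
  | loop i p hp =>
    have hp0 := p.length_compile_pos
    simp only [compile, List.length_cons, length_compile p (0 + 1)] at hs
    simp only [bound, max_le_iff] at hK
    simp only [compile, List.mem_cons]
    rintro I (rfl | hI)
    · exact ⟨hK.1, he, by omega⟩
    · exact hp hK.2 (by omega) (by omega) I hI

/-- Induction on the evaluation. The body of a loop exits to the label of the loop's own test, so
the same piece of code serves for the remaining rounds. -/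
theorem Eval.det {P : ℕ → Instr} {p : Prog} {v w : ℕ → ℕ} (h : Eval p v w) {s e : ℕ}
    (hP : Located P (p.compile s e) s) : Det P (s, v) (e, w) := by
  induction h generalizing s e with
  | skip v =>
    refine .single ?_
    rw [(Located.cons hP).1]
    simp [Instr.next]
  | inc i v =>
    refine .single ?_
    rw [(Located.cons hP).1]
    rfl
  | @seq p q _ _ _ _ _ h1 h2 =>
    have h := Located.append hP
    rw [length_compile p s] at h
    exact (h1 h.1).trans (h2 h.2)
  | loop_zero h0 =>
    refine .single ?_
    rw [(Located.cons hP).1]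
    simp [Instr.next, h0]
  | loop_succ hn _ _ h1 h2 =>
    refine .head ?_ ((h1 (Located.cons hP).2).trans (h2 hP))
    rw [(Located.cons hP).1]
    simp [Instr.next, hn]

end Prog

/-! ### The search program -/

namespace Search
open Instr Prog

/-- A bound for the registers used in the search program. -/
def numRegs (p : Prog) : ℕ := max p.bound 4

/-- The program that moves the register `2` to the register `1` and clears all others. -/
def reset (p : Prog) : Prog :=
  (((clear 1).seq (move 2 1)).seq (clear 0)).seq (clearRange 2 (numRegs p - 2))

theorem bound_clearRange (b n K : ℕ) (h : b + n ≤ K) : (clearRange b n).bound ≤ K := by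
  induction n with
  | zero => simp [clearRange, bound]
  | succ n ih =>
    simp only [clearRange, bound, Prog.clear, max_le_iff]
    exact ⟨ih (by omega), by omega, by omega⟩

theorem bound_reset (p : Prog) : (reset p).bound ≤ numRegs p := by
  have h : 4 ≤ numRegs p := le_max_right _ _
  simp only [reset, bound, Prog.clear, Prog.move, max_le_iff]
  refine ⟨?_, bound_clearRange _ _ _ (by omega)⟩
  refine ⟨⟨⟨?_, ?_⟩, ?_, ?_⟩, ?_, ?_⟩ <;> omega

theorem eval_reset (p : Prog) {v : ℕ → ℕ} (hv : ∀ r, numRegs p ≤ r → v r = 0) :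
    Eval (reset p) v (update 0 1 (v 2)) := by
  have h : 4 ≤ numRegs p := le_max_right _ _
  refine ((((eval_clear 1 v).seq (eval_move (by decide) _)).seq (eval_clear 0 _)).seq
    (eval_clearRange 2 _ _)).of_eq ?_
  funext r
  have := hv r
  simp only [update_apply, Pi.zero_apply]
  split_ifs <;> omega

/-- The number of instructions for the check. -/
def checkLength (p : Prog) : ℕ := (p.compile 0 0).length

/-- The number of instructions for the reset. -/
def resetLength (p : Prog) : ℕ := ((reset p).compile 0 0).length

/-- The label that is visited in each round. -/
def roundLabel (p : Prog) : ℕ := 3 + checkLength p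

/-- The label of the halting instruction. -/
def haltLabel (p : Prog) : ℕ := 3 + checkLength p + resetLength p

/-- The label of the nondeterministic jump. -/
def guessLabel (p : Prog) : ℕ := 4 + checkLength p + resetLength p

/-- The part of the search program that does not depend on the input. -/
def fixedPart (p : Prog) : List Instr :=
  -- The first entry only fills the place of label `0`, which `program` treats separately. Label `1`
  -- increases the guess, `2` begins the check, and the final jump chooses between guessing on and
  -- checking.
  [halt, .inc 2 (guessLabel p)] ++ (p.compile 2 (2 + checkLength p) ++
    ([.dec 3 (haltLabel p) (roundLabel p)] ++
      ((reset p).compile (roundLabel p) 0 ++ [halt, .jump 1 2])))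

theorem length_fixedPart (p : Prog) : (fixedPart p).length = guessLabel p + 1 := by
  simp only [fixedPart, List.length_append, length_compile, List.length_cons, List.length_nil,
    guessLabel, checkLength, resetLength]
  omega

/-- The search program for the input `n`: it writes `n` to the register `0`, guesses a number in
the register `2`, performs the check `p` with the result in the register `3`, and if successful
begins the next round, in which the guessed number is in the register `1`. -/
def program (p : Prog) (n l : ℕ) : Instr :=
  -- The input is hard-wired: above `guessLabel p` there are `n` increments of register `0`,
  -- executed downwards at the start of each round. Both targets of the first jump agree, so it is
  -- deterministic.
  if l = 0 then .jump (guessLabel p + n) (guessLabel p + n)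
  else if l < guessLabel p + 1 then (fixedPart p).getD l halt else .inc 0 (l - 1)

theorem program_zero (p : Prog) (n : ℕ) :
    program p n 0 = .jump (guessLabel p + n) (guessLabel p + n) := if_pos rfl

theorem program_init (p : Prog) (n j : ℕ) :
    program p n (guessLabel p + (j + 1)) = .inc 0 (guessLabel p + j) := by
  rw [program, if_neg (by omega), if_neg (by omega)]
  rfl

theorem located_fixedPart (p : Prog) (n : ℕ) : Located (program p n) (fixedPart p).tail 1 := by
  intro j I hj
  have hlt := (List.getElem?_eq_some_iff.1 hj).1
  rw [List.length_tail, length_fixedPart] at hlt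
  rw [program, if_neg (by omega), if_pos (by omega), List.getD, Nat.add_comm 1 j,
    ← List.getElem?_tail, hj]
  rfl

structure Spec (p : Prog) (P : ℕ → Instr) : Prop where
  count : P 1 = .inc 2 (guessLabel p)
  check : Located P (p.compile 2 (2 + checkLength p)) 2
  test : P (2 + checkLength p) = .dec 3 (haltLabel p) (roundLabel p)
  reset : Located P ((reset p).compile (roundLabel p) 0) (roundLabel p)
  halt : P (haltLabel p) = .halt
  guess : P (guessLabel p) = .jump 1 2

theorem spec_program (p : Prog) (n : ℕ) : Spec p (program p n) := by
  have h1 := (Located.append (L := [.inc 2 (guessLabel p)]) (located_fixedPart p n))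
  have h2 := h1.2.append
  rw [length_compile] at h2
  have h3 := h2.2.append
  have h4 := h3.2.append
  rw [length_compile (Search.reset p) (roundLabel p)] at h4
  have h5 := h4.2.cons
  have h6 := h5.2.cons
  have e1 : 1 + [Instr.inc 2 (guessLabel p)].length + (p.compile 0 0).length =
    2 + checkLength p := rfl
  have e2 : 2 + checkLength p + [Instr.dec 3 (haltLabel p) (roundLabel p)].length =
    roundLabel p := by simp [roundLabel]; omega
  have e3 : roundLabel p + ((Search.reset p).compile 0 0).length = haltLabel p := rfl
  have e4 : haltLabel p + 1 = guessLabel p := by simp [haltLabel, guessLabel]; omega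
  rw [e1] at h3 h4 h5 h6
  rw [e2] at h4 h5 h6
  rw [e3] at h5 h6
  rw [e4] at h6
  exact ⟨h1.1.cons.1, h2.1, h3.1.cons.1, h4.1, h5.1, h6.1⟩

theorem bounded_program (p : Prog) {n l : ℕ} (hl : l < guessLabel p + n + 1) :
    (program p n l).Bounded (numRegs p) (guessLabel p + n + 1) := by
  have h4 : 4 ≤ numRegs p := le_max_right _ _
  have hg : guessLabel p = 4 + checkLength p + resetLength p := rfl
  unfold program
  split_ifs with h0 h1
  · exact ⟨by omega, by omega⟩
  · rw [← length_fixedPart] at h1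
    rw [List.getD_eq_getElem _ _ h1]
    have hmem := List.getElem_mem h1
    generalize (fixedPart p)[l] = I at hmem
    simp only [fixedPart, List.mem_append, List.mem_cons, List.not_mem_nil, or_false] at hmem
    rcases hmem with (rfl | rfl) | hI | rfl | hI | rfl | rfl
    · trivial
    · exact ⟨by omega, by omega⟩
    · exact bounded_compile p (le_max_left _ _) (by unfold checkLength at hg; omega)
        (by omega) I hI
    · exact ⟨by omega, by unfold haltLabel; omega, by unfold roundLabel; omega⟩
    · exact bounded_compile _ (bound_reset p) (by unfold roundLabel; unfold resetLength at hg; omega)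
        (by omega) I hI
    · trivial
    · exact ⟨by omega, by omega⟩
  · exact ⟨by omega, by omega⟩

/-- The registers at the beginning of a round. -/
def base (s : ℕ) : ℕ → ℕ := update 0 1 s

/-- The registers when `y` has been guessed. -/
def guessed (n s y : ℕ) : ℕ → ℕ := update (update (base s) 0 n) 2 y

theorem det_reset (p : Prog) (n : ℕ) {v : ℕ → ℕ} (hv : ∀ r, numRegs p ≤ r → v r = 0) :
    Det (program p n) (roundLabel p, v) (0, base (v 2)) :=
  (eval_reset p hv).det (spec_program p n).reset

theorem det_init (p : Prog) (n s : ℕ) :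
    Det (program p n) (0, base s) (guessLabel p, guessed n s 0) := by
  have h : ∀ j ≤ n, Det (program p n) (guessLabel p + j, update (base s) 0 (n - j))
      (guessLabel p, update (base s) 0 n) := by
    intro j
    induction j with
    | zero => exact fun _ => .refl
    | succ j ih =>
      intro hj
      refine .head ?_ (ih (by omega))
      show (program p n (guessLabel p + (j + 1))).next _ = _
      rw [program_init]
      simp only [Instr.next, update_self, update_idem]
      rw [show n - (j + 1) + 1 = n - j by omega]
  have h0 : guessed n s 0 = update (base s) 0 n := by
    funext r
    simp only [guessed, base, update_apply, Pi.zero_apply]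
    split_ifs <;> omega
  have h1 : update (base s) 0 (n - n) = base s := by
    funext r
    simp only [base, update_apply, Pi.zero_apply]
    split_ifs <;> omega
  rw [h0]
  refine .head ?_ (h n le_rfl)
  rw [program_zero, h1]
  simp [Instr.next]

/-- The check alters only register `3`, whose value `0` means failure; the zero test then separates
the two cases. On success only register `2` and the vanishing of the registers from `numRegs p` on
matter, as the reset clears the rest. -/
theorem det_check {p : Prog} {T : ℕ → ℕ → ℕ → Prop} {f : ℕ → ℕ → ℕ → ℕ}
    (hf : ∀ n s y, f n s y = 0 ↔ ¬ T n s y)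
    (hp : ∀ n s y, Eval p (guessed n s y) (update (guessed n s y) 3 (f n s y))) (n s y : ℕ) :
    (T n s y ∧ ∃ v, v 2 = y ∧ (∀ r, numRegs p ≤ r → v r = 0) ∧
      Det (program p n) (2, guessed n s y) (roundLabel p, v)) ∨
    (¬ T n s y ∧ ∃ v, Det (program p n) (2, guessed n s y) (haltLabel p, v)) := by
  have h4 : 4 ≤ numRegs p := le_max_right _ _
  have h := (hp n s y).det (spec_program p n).check
  by_cases hT : f n s y = 0
  · refine .inr ⟨(hf n s y).1 hT, update (guessed n s y) 3 (f n s y), h.tail ?_⟩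
    rw [(spec_program p n).test]
    simp [Instr.next, hT]
  · refine .inl ⟨not_not.1 fun h => hT ((hf n s y).2 h),
      update (guessed n s y) 3 (f n s y - 1), by simp [guessed], fun r hr => ?_, h.tail ?_⟩
    · simp only [guessed, base, update_apply, Pi.zero_apply]
      split_ifs <;> omega
    · rw [(spec_program p n).test]
      simp [Instr.next, hT]

end Search

end

section
open Function Relation

/-! ### Simulation of counter machines by Turing machines -/

/-- Tape symbols: a mark for the leftmost cell in use, and one bit for each counter. -/
abbrev TSym (K : ℕ) : Type := Bool × (Fin K → Bool)

namespace TSym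
variable {K : ℕ}

/-- The cell carries the mark. -/
def marked (s : Option (TSym K)) : Bool := s.elim false Prod.fst

/-- The bit of the `i`-th counter. -/
def bitAt (s : Option (TSym K)) (i : ℕ) : Bool :=
  s.elim false fun a => if h : i < K then a.2 ⟨i, h⟩ else false

/-- The symbol with the mark only. -/
def mark : TSym K := (true, fun _ => false)

/-- Remove the mark. -/
def unmark (s : Option (TSym K)) : TSym K := (false, fun i => bitAt s i)

/-- Remove the mark and set the `i`-th bit to `b`. -/
def setBit (s : Option (TSym K)) (i : ℕ) (b : Bool) : TSym K :=
  (false, fun j => if j.val = i then b else bitAt s j)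

/-- The transitions for the instruction `I` with label `l`, in the phase `ph`, if `s` is read.
In phase `0` the head moves left until it finds the mark. -/
def trans (l : ℕ) (I : Instr) (ph : ℕ) (s : Option (TSym K)) : List (ℕ × TSym K × Dir) :=
  match ph, I, s with
  -- In phase `0` a blank is as good as a mark, so that an empty tape represents counters that are
  -- all zero. A halting instruction has no transition there.
  | 0, .halt, none => []
  | 0, .halt, some a => if a.1 then [] else [(3 * l, a, .left)]
  | 0, _, none => [(3 * l + 1, mark, .right)]
  | 0, _, some a => if a.1 then [(3 * l + 1, mark, .right)] else [(3 * l, a, .left)]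
  -- In phase `1` the head runs right over the unary block of the counter `i`, erasing stray marks,
  -- up to the first cell without its bit. An increment fills this cell; a decrement steps back to
  -- see whether the block is empty. A jump makes its choice at once.
  | 1, .inc i _, s => if bitAt s i then [(3 * l + 1, unmark s, .right)]
      else [(3 * l + 2, setBit s i true, .right)]
  | 1, .dec i _ _, s => if bitAt s i then [(3 * l + 1, unmark s, .right)]
      else [(3 * l + 2, unmark s, .left)]
  | 1, .jump l₁ l₂, s => [(3 * l₁, unmark s, .left), (3 * l₂, unmark s, .left)]
  -- After an increment, the next cell must get the bit `0`, since an arbitrary tape may contain a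
  -- bit there. After the step back of a decrement, a mark means that the counter is zero; the head
  -- then leaves to the right because the marked cell may be the leftmost one.
  | 2, .inc i l', s => [(3 * l', setBit s i false, .left)]
  | 2, .dec i lz lnz, s => if marked s then [(3 * lz, mark, .right)]
      else [(3 * lnz, setBit s i false, .left)]
  | _, _, _ => []

theorem trans_bounded {l B : ℕ} {I : Instr} (hl : l < B) (hI : I.Bounded K B) {ph : ℕ}
    {s : Option (TSym K)} : ∀ x ∈ trans l I ph s, x.1 < 3 * B := by
  unfold trans
  split <;> (try split_ifs) <;> simp [Instr.Bounded] at hI ⊢ <;> omega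

/-- The cells from `h` on are not yet visited; the cell `p` is marked, the visited cells to the
right of `p` are not marked, and the values of the counters are the numbers of consecutive bits to
the right of `p`. -/
structure Inv (R : ℕ → Option (TSym K)) (p h : ℕ) (v : ℕ → ℕ) : Prop where
  pos : 1 ≤ p
  home : marked (R p) = true
  clear : ∀ x, p < x → x < h → marked (R x) = false
  nonblank : ∀ x, 1 ≤ x → x < h → R x ≠ none
  counts : ∀ i < K, (∀ j < v i, bitAt (R (p + 1 + j)) i = true) ∧
    bitAt (R (p + 1 + v i)) i = false

@[simp] theorem bitAt_unmark (s : Option (TSym K)) (i : ℕ) : bitAt (some (unmark s)) i = bitAt s i := by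
  cases s <;> simp [bitAt, unmark]

theorem bitAt_setBit (s : Option (TSym K)) (i j : ℕ) (b : Bool) (hj : j < K) :
    bitAt (some (setBit s i b)) j = if j = i then b else bitAt s j := by
  simp [bitAt, setBit, hj]

theorem Inv.mono {R : ℕ → Option (TSym K)} {p h h' : ℕ} {v : ℕ → ℕ} (H : Inv R p h v)
    (hh : h' ≤ h) : Inv R p h' v :=
  ⟨H.pos, H.home, fun x h1 h2 => H.clear x h1 (by omega), fun x h1 h2 => H.nonblank x h1 (by omega),
    H.counts⟩

theorem Inv.unmark {R : ℕ → Option (TSym K)} {p h : ℕ} {v : ℕ → ℕ} (H : Inv R p h v) (hp : p < h) :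
    Inv (update R h (some (unmark (R h)))) p (h + 1) v := by
  refine ⟨H.pos, ?_, fun x h1 h2 => ?_, fun x h1 h2 => ?_, fun i hi => ?_⟩
  · rw [update_of_ne hp.ne]; exact H.home
  · by_cases hx : x = h
    · subst hx; rw [update_self]; rfl
    · rw [update_of_ne hx]; exact H.clear x h1 (by omega)
  · by_cases hx : x = h
    · subst hx; simp
    · rw [update_of_ne hx]; exact H.nonblank x h1 (by omega)
  · have hb : ∀ x, bitAt (update R h (some (TSym.unmark (R h))) x) i = bitAt (R x) i := by
      intro x
      by_cases hx : x = h
      · subst hx; rw [update_self, bitAt_unmark]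
      · rw [update_of_ne hx]
    simp only [hb]
    exact H.counts i hi

/-- The first write lengthens the unary block by one cell and the second one ends it there, whatever
that cell contained. The other tracks keep their bits. -/
theorem Inv.inc {R R' : ℕ → Option (TSym K)} {p i : ℕ} {v : ℕ → ℕ} (H : Inv R p (p + 1 + v i) v)
    (hR : R' = update R (p + 1 + v i) (some (setBit (R (p + 1 + v i)) i true))) :
    Inv (update R' (p + 1 + v i + 1) (some (setBit (R' (p + 1 + v i + 1)) i false))) p
      (p + 1 + v i + 2) (update v i (v i + 1)) := by
  have h1 : R' (p + 1 + v i + 1) = R (p + 1 + v i + 1) := by rw [hR, update_of_ne (by omega)]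
  rw [h1, hR]
  refine ⟨H.pos, ?_, fun x h1 h2 => ?_, fun x h1 h2 => ?_, fun j hj => ?_⟩
  · rw [update_of_ne (by omega), update_of_ne (by omega)]; exact H.home
  · simp only [update_apply]
    split_ifs with h3 h4
    · rfl
    · rfl
    · exact H.clear x h1 (by omega)
  · simp only [update_apply]
    split_ifs with h3 h4
    · simp
    · simp
    · exact H.nonblank x h1 (by omega)
  · obtain ⟨h5, h6⟩ := H.counts j hj
    by_cases hji : j = i
    · subst hji
      simp only [update_self]
      refine ⟨fun x hx => ?_, ?_⟩
      · rw [update_of_ne (by omega)]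
        by_cases hxv : x = v j
        · rw [hxv, update_self, bitAt_setBit _ _ _ _ hj, if_pos rfl]
        · rw [update_of_ne (by omega)]; exact h5 x (by omega)
      · rw [← Nat.add_assoc, update_self, bitAt_setBit _ _ _ _ hj, if_pos rfl]
    · rw [update_of_ne hji]
      have hb : ∀ x, bitAt (update (update R (p + 1 + v i) (some (setBit (R (p + 1 + v i)) i true)))
          (p + 1 + v i + 1) (some (setBit (R (p + 1 + v i + 1)) i false)) x) j = bitAt (R x) j := by
        intro x
        simp only [update_apply]
        split_ifs with h3 h4
        · rw [h3, bitAt_setBit _ _ _ _ hj, if_neg hji]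
        · rw [h4, bitAt_setBit _ _ _ _ hj, if_neg hji]
        · rfl
      simp only [hb]
      exact ⟨h5, h6⟩

theorem Inv.dec {R : ℕ → Option (TSym K)} {p i n h : ℕ} {v : ℕ → ℕ} (H : Inv R p h v)
    (hn : v i = n + 1) :
    Inv (update R (p + 1 + n) (some (setBit (R (p + 1 + n)) i false))) p h (update v i n) := by
  refine ⟨H.pos, ?_, fun x h1 h2 => ?_, fun x h1 h2 => ?_, fun j hj => ?_⟩
  · rw [update_of_ne (by omega)]; exact H.home
  · simp only [update_apply]
    split_ifs with h3
    · rfl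
    · exact H.clear x h1 (by omega)
  · simp only [update_apply]
    split_ifs with h3
    · simp
    · exact H.nonblank x h1 (by omega)
  · obtain ⟨h5, h6⟩ := H.counts j hj
    by_cases hji : j = i
    · subst hji
      simp only [update_self]
      refine ⟨fun x hx => ?_, ?_⟩
      · rw [update_of_ne (by omega)]; exact h5 x (by omega)
      · rw [bitAt_setBit _ _ _ _ hj, if_pos rfl]
    · rw [update_of_ne hji]
      have hb : ∀ x, bitAt (update R (p + 1 + n) (some (setBit (R (p + 1 + n)) i false)) x) j =
          bitAt (R x) j := by
        intro x
        simp only [update_apply]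
        split_ifs with h3
        · rw [h3, bitAt_setBit _ _ _ _ hj, if_neg hji]
        · rfl
      simp only [hb]
      exact ⟨h5, h6⟩

/-- Marking the cell `p` again. -/
theorem Inv.mark {R : ℕ → Option (TSym K)} {p h : ℕ} {v : ℕ → ℕ} (hp : 1 ≤ p)
    (hclear : ∀ x, p < x → x < h → marked (R x) = false)
    (hblank : ∀ x, 1 ≤ x → x < h → x ≠ p → R x ≠ none)
    (hcounts : ∀ i < K, (∀ j < v i, bitAt (R (p + 1 + j)) i = true) ∧
      bitAt (R (p + 1 + v i)) i = false) :
    Inv (update R p (some mark)) p h v := by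
  refine ⟨hp, by simp [marked, TSym.mark], fun x h1 h2 => ?_, fun x h1 h2 => ?_, fun i hi => ?_⟩
  · rw [update_of_ne (by omega)]; exact hclear x h1 h2
  · by_cases hx : x = p
    · subst hx; simp
    · rw [update_of_ne hx]; exact hblank x h1 h2 hx
  · obtain ⟨h5, h6⟩ := hcounts i hi
    refine ⟨fun j hj => ?_, ?_⟩
    · rw [update_of_ne (by omega)]; exact h5 j hj
    · rw [update_of_ne (by omega)]; exact h6

end TSym

end

section
open Function Relation TSym

/-! ### Single steps and single instructions of the simulating machine -/

namespace NDTM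
variable {M : NDTM} {K B : ℕ} {P : ℕ → Instr} {e : TSym K ≃ M.Symbol}

/-- The Turing machine `M` simulates the counter machine with the program `P`, `K` counters and
`B` labels.  The states `3 * l`, `3 * l + 1` and `3 * l + 2` belong to the label `l`. -/
structure Simulates (M : NDTM) (K B : ℕ) (P : ℕ → Instr) (e : TSym K ≃ M.Symbol) : Prop where
  states : M.k + 1 = 3 * B
  bounded : ∀ l < B, (P l).Bounded K B
  trans : ∀ s q r a d, (r, a, d) ∈ M.δ s q ↔
    (r.val, e.symm a, d) ∈ TSym.trans (q.val / 3) (P (q.val / 3)) (q.val % 3) (s.map e.symm)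

/-- The contents of the cell `x`. -/
def read (e : TSym K ≃ M.Symbol) (C : M.Config) (x : ℕ) : Option (TSym K) := (C.t x).map e.symm

/-- The configuration `C'` arises from `C` by the transition `x`. -/
structure IsStep (e : TSym K ≃ M.Symbol) (C : M.Config) (x : ℕ × TSym K × Dir) (C' : M.Config) :
    Prop where
  n_eq : C'.n = C.n + 1
  t_eq : C'.t = update C.t C.p (some (e x.2.1))
  p_eq : C'.p = (match x.2.2 with
      | Dir.left => C.p - 1
      | Dir.right => C.p + 1)
  q_eq : C'.q.val = x.1

theorem IsStep.read {C C' : M.Config} {x : ℕ × TSym K × Dir} (h : IsStep e C x C') :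
    NDTM.read e C' = update (NDTM.read e C) C.p (some x.2.1) := by
  funext y
  simp only [NDTM.read, h.t_eq, update_apply]
  split_ifs <;> simp

theorem IsStep.unique {C C₁ C₂ : M.Config} {x : ℕ × TSym K × Dir} (h₁ : IsStep e C x C₁)
    (h₂ : IsStep e C x C₂) : C₁ = C₂ := by
  obtain ⟨n₁, t₁, p₁, q₁, _, _, _, _, _⟩ := C₁
  obtain ⟨n₂, t₂, p₂, q₂, _, _, _, _, _⟩ := C₂
  have hn : n₁ = n₂ := h₁.n_eq.trans h₂.n_eq.symm
  have ht : t₁ = t₂ := h₁.t_eq.trans h₂.t_eq.symm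
  have hp : p₁ = p₂ := h₁.p_eq.trans h₂.p_eq.symm
  have hq : q₁ = q₂ := Fin.ext (h₁.q_eq.trans h₂.q_eq.symm)
  subst hn ht hp hq
  rfl

/-- Writing a symbol to the right of a blank would violate the shape of tapes, so the transition
then leads to no configuration. The condition on the cells left of the head excludes this. -/
theorem exists_isStep (e : TSym K ≃ M.Symbol) (C : M.Config) {x : ℕ × TSym K × Dir}
    (hx : x.1 < M.k + 1) (hd : x.2.2 = Dir.right ∨ 2 ≤ C.p)
    (hC : ∀ i, 1 ≤ i → i < C.p → NDTM.read e C i ≠ none) : ∃ C', IsStep e C x C' := by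
  have hp := C.p_le_n
  have hp1 := C.one_le_p
  refine ⟨⟨C.n + 1, update C.t C.p (some (e x.2.1)), (match x.2.2 with
      | Dir.left => C.p - 1
      | Dir.right => C.p + 1), ⟨x.1, hx⟩, ?_, ?_, ?_, ?_, ?_⟩, rfl, rfl, rfl, rfl⟩
  · intro i hi
    rw [update_of_ne (by omega)]
    exact C.outside i (by omega)
  · rw [update_of_ne (by omega)]
    exact C.outside _ (by omega)
  · intro i h1 h2 h3
    have hip : i ≠ C.p := by
      rintro rfl
      simp at h3
    rw [update_of_ne hip] at h3
    have hip' : ¬ i < C.p := fun h => hC i h1 h (by simp [NDTM.read, h3])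
    rw [update_of_ne (by omega)]
    rcases Nat.lt_or_ge i C.n with h | h
    · exact C.blank_succ i h1 h h3
    · exact C.outside _ (by omega)
  · rcases hd with hd | hd
    · rw [hd]; simp
    · cases x.2.2 <;> simp; omega
  · cases x.2.2 <;> simp <;> omega

namespace Simulates

theorem mem_next (S : Simulates M K B P e) {C C' : M.Config} :
    C' ∈ M.Next C ↔ ∃ x ∈ TSym.trans (C.q.val / 3) (P (C.q.val / 3)) (C.q.val % 3)
      (NDTM.read e C C.p), (x.2.2 = Dir.right ∨ 2 ≤ C.p) ∧ IsStep e C x C' := by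
  constructor
  · rintro ⟨r, a, d, h1, h2, h3, h4, h5, h6⟩
    refine ⟨(r.val, e.symm a, d), (S.trans _ _ _ _ _).1 h1, h2, h3, by simpa using h4, h5, ?_⟩
    rw [h6]
  · rintro ⟨⟨r, a, d⟩, h1, h2, h3⟩
    refine ⟨C'.q, e a, d, (S.trans _ _ _ _ _).2 ?_, h2, h3.n_eq, h3.t_eq, h3.p_eq, rfl⟩
    rw [h3.q_eq]
    simpa [NDTM.read] using h1

theorem label_lt (S : Simulates M K B P e) (C : M.Config) : C.q.val / 3 < B := by
  have := C.q.2
  have := S.states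
  omega

theorem exists_step (S : Simulates M K B P e) {C : M.Config} {l ph : ℕ} {x : ℕ × TSym K × Dir}
    (hq : C.q.val = 3 * l + ph) (hph : ph < 3)
    (hx : x ∈ TSym.trans l (P l) ph (NDTM.read e C C.p)) (hd : x.2.2 = Dir.right ∨ 2 ≤ C.p)
    (hC : ∀ i, 1 ≤ i → i < C.p → NDTM.read e C i ≠ none) : ∃ C', IsStep e C x C' := by
  have hl := S.label_lt C
  rw [show C.q.val / 3 = l by omega] at hl
  refine exists_isStep e C ?_ hd hC
  rw [S.states]
  exact trans_bounded hl (S.bounded l hl) x hx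

theorem next_eq_singleton (S : Simulates M K B P e) {C : M.Config} {l ph : ℕ}
    {x : ℕ × TSym K × Dir} (hq : C.q.val = 3 * l + ph) (hph : ph < 3)
    (hx : TSym.trans l (P l) ph (NDTM.read e C C.p) = [x]) (hd : x.2.2 = Dir.right ∨ 2 ≤ C.p)
    (hC : ∀ i, 1 ≤ i → i < C.p → NDTM.read e C i ≠ none) :
    ∃ C', M.Next C = {C'} ∧ IsStep e C x C' := by
  obtain ⟨C', h⟩ := S.exists_step hq hph (by rw [hx]; simp) hd hC
  refine ⟨C', ?_, h⟩
  ext C''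
  rw [S.mem_next, show C.q.val / 3 = l by omega, show C.q.val % 3 = ph by omega, hx]
  simp only [List.mem_singleton, exists_eq_left, Set.mem_singleton_iff]
  exact ⟨fun h' => h'.2.unique h, fun h' => ⟨hd, h' ▸ h⟩⟩

end Simulates

/-- `C` is the only successor, and its state belongs to `A`. -/
def DetStep (A : ℕ → Prop) (C C' : M.Config) : Prop := M.Next C = {C'} ∧ A C'.q.val

/-- The machine is about to perform the instruction with label `l` on the counters `v`. -/
structure At (e : TSym K ≃ M.Symbol) (C : M.Config) (l : ℕ) (v : ℕ → ℕ) : Prop where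
  state : C.q.val = 3 * l
  home : NDTM.read e C C.p = none ∨ marked (NDTM.read e C C.p) = true
  nonblank : ∀ x, 1 ≤ x → x < C.p → NDTM.read e C x ≠ none
  counts : ∀ i < K, (∀ j < v i, bitAt (NDTM.read e C (C.p + 1 + j)) i = true) ∧
    bitAt (NDTM.read e C (C.p + 1 + v i)) i = false

theorem trans_left (l : ℕ) (I : Instr) {s : Option (TSym K)} (hs : s ≠ none)
    (hm : marked s = false) : ∃ a, s = some a ∧ TSym.trans l I 0 s = [(3 * l, a, .left)] := by
  obtain ⟨a, rfl⟩ := Option.ne_none_iff_exists'.1 hs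
  have ha : a.1 = false := hm
  refine ⟨a, rfl, ?_⟩
  cases I <;> simp [TSym.trans, ha]

theorem trans_home (l : ℕ) {I : Instr} (hI : I ≠ .halt) {s : Option (TSym K)}
    (hs : s = none ∨ marked s = true) : TSym.trans l I 0 s = [(3 * l + 1, mark, .right)] := by
  rcases s with _ | a
  · cases I <;> simp [TSym.trans] at hI ⊢
  · have ha : a.1 = true := by simpa [marked] using hs
    cases I <;> simp [TSym.trans, ha] at hI ⊢

namespace Simulates
variable (S : Simulates M K B P e)
include S

/-- Return of the head to the mark. -/
theorem exists_at {A : ℕ → Prop} {l p : ℕ} {v : ℕ → ℕ} (hA : A (3 * l))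
    {C : M.Config} (hq : C.q.val = 3 * l) (hp : p ≤ C.p)
    (H : Inv (NDTM.read e C) p (C.p + 1) v) :
    ∃ C', ReflTransGen (DetStep A) C C' ∧ At e C' l v := by
  obtain ⟨d, hd⟩ := Nat.exists_eq_add_of_le hp
  induction d generalizing C with
  | zero =>
    have hp' : C.p = p := hd
    refine ⟨C, .refl, hq, .inr (hp' ▸ H.home), fun x h1 h2 => H.nonblank x h1 (by omega), ?_⟩
    rw [hp']
    exact H.counts
  | succ d ih =>
    have hnb := H.nonblank C.p C.one_le_p (by omega)
    obtain ⟨a, ha, ht⟩ := trans_left l (P l) hnb (H.clear C.p (by omega) (by omega))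
    have := H.pos
    obtain ⟨C', h1, h2⟩ := S.next_eq_singleton (ph := 0) hq (by omega) ht (.inr (by omega))
      fun x h1 h2 => H.nonblank x h1 (by omega)
    have hr : NDTM.read e C' = NDTM.read e C := by rw [h2.read, ← ha, update_eq_self]
    have hp' : C'.p = C.p - 1 := h2.p_eq
    obtain ⟨C'', h3, h4⟩ := ih h2.q_eq (by omega) (by rw [hr]; exact H.mono (by omega)) (by omega)
    exact ⟨C'', .head ⟨h1, by rw [h2.q_eq]; exact hA⟩ h3, h4⟩

/-- The first step of an instruction. -/
theorem exists_leave {A : ℕ → Prop} {l : ℕ} {v : ℕ → ℕ} (hA : A (3 * l + 1)) (hl : P l ≠ .halt)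
    {C : M.Config} (H : At e C l v) :
    ∃ C', DetStep A C C' ∧ C'.q.val = 3 * l + 1 ∧ C'.p = C.p + 1 ∧
      Inv (NDTM.read e C') C.p C'.p v := by
  obtain ⟨C', h1, h2⟩ := S.next_eq_singleton (ph := 0) H.state (by omega) (trans_home l hl H.home)
    (.inl rfl) H.nonblank
  have hp : C'.p = C.p + 1 := h2.p_eq
  refine ⟨C', ⟨h1, by rw [h2.q_eq]; exact hA⟩, h2.q_eq, hp, ?_⟩
  rw [h2.read, hp]
  exact Inv.mark C.one_le_p (fun x h1 h2 => by omega) (fun x h1 h2 h3 => H.nonblank x h1 (by omega))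
    H.counts

/-- The search for the end of the `i`-th counter. -/
theorem exists_scan {A : ℕ → Prop} {l p i : ℕ} {v : ℕ → ℕ} (hA : A (3 * l + 1)) (hi : i < K)
    (hl : ∀ s : Option (TSym K), bitAt s i = true →
      TSym.trans l (P l) 1 s = [(3 * l + 1, unmark s, .right)])
    {C : M.Config} (hq : C.q.val = 3 * l + 1) (hp : p < C.p) (hp' : C.p ≤ p + 1 + v i)
    (H : Inv (NDTM.read e C) p C.p v) :
    ∃ C', ReflTransGen (DetStep A) C C' ∧ C'.q.val = 3 * l + 1 ∧ C'.p = p + 1 + v i ∧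
      Inv (NDTM.read e C') p C'.p v := by
  obtain ⟨d, hd⟩ := Nat.exists_eq_add_of_le hp'
  induction d generalizing C with
  | zero => exact ⟨C, .refl, hq, hd.symm, H⟩
  | succ d ih =>
    have hb : bitAt (NDTM.read e C C.p) i = true := by
      have := (H.counts i hi).1 (C.p - (p + 1)) (by omega)
      rwa [show p + 1 + (C.p - (p + 1)) = C.p by omega] at this
    obtain ⟨C', h1, h2⟩ := S.next_eq_singleton hq (by omega) (hl _ hb) (.inl rfl) H.nonblank
    have hp' : C'.p = C.p + 1 := h2.p_eq
    obtain ⟨C'', h3, h4⟩ := ih h2.q_eq (by omega) (by omega)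
      (by rw [h2.read, hp']; exact H.unmark hp) (by omega)
    exact ⟨C'', .head ⟨h1, by rw [h2.q_eq]; exact hA⟩ h3, h4⟩

/-- States in which the instruction `l` is performed, and the first state for the label `l'`. -/
theorem exists_at_of_next_eq {l l' : ℕ} {v v' : ℕ → ℕ} {C : M.Config} (hB : l < B)
    (hl : ∀ l₁ l₂, P l ≠ .jump l₁ l₂) (H : At e C l v) (hn : (P l).next v = {(l', v')}) :
    ∃ C', TransGen (DetStep fun q => q / 3 = l ∨ q = 3 * l') C C' ∧ At e C' l' v' := by
  have hbd := S.bounded l hB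
  cases hP : P l with
  | halt => rw [hP] at hn; simp [Instr.next, Set.ext_iff] at hn
  | jump l₁ l₂ => exact absurd hP (hl _ _)
  | inc i l₁ =>
    rw [hP] at hn hbd
    simp only [Instr.next, Set.singleton_eq_singleton_iff, Prod.mk.injEq] at hn
    obtain ⟨rfl, rfl⟩ := hn
    obtain ⟨C₁, h1, hq1, hp1, H1⟩ := S.exists_leave (A := fun q => q / 3 = l ∨ q = 3 * l₁)
      (.inl (by omega)) (by simp [hP]) H
    obtain ⟨C₂, h2, hq2, hp2, H2⟩ := S.exists_scan (A := fun q => q / 3 = l ∨ q = 3 * l₁)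
      (.inl (by omega)) hbd.1 (fun s hs => by simp [TSym.trans, hP, hs]) hq1 (by omega)
      (by omega) H1
    have hb := (H2.counts i hbd.1).2
    rw [← hp2] at hb
    obtain ⟨C₃, h3, s3⟩ := S.next_eq_singleton (x := (3 * l + 2, _, .right)) hq2 (by omega)
      (by simp only [TSym.trans, hP, hb]; rfl) (.inl rfl) H2.nonblank
    have hp3 : C₃.p = C₂.p + 1 := s3.p_eq
    -- The cell after the new last bit is given the bit `0`, and the head turns back.
    obtain ⟨C₄, h4, s4⟩ := S.next_eq_singleton (x := (3 * l₁, _, .left)) s3.q_eq (by omega)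
      (by simp only [TSym.trans, hP]; rfl) (.inr (by have := C₂.one_le_p; omega))
      (by
        intro x hx hx'
        rw [s3.read, update_apply]
        split_ifs
        · simp
        · exact H2.nonblank x hx (by omega))
    have hp4 : C₄.p = C₃.p - 1 := s4.p_eq
    have H4 : Inv (NDTM.read e C₄) C.p (C.p + 1 + v i + 2) (update v i (v i + 1)) := by
      rw [s4.read, show C₃.p = C.p + 1 + v i + 1 by omega]
      exact Inv.inc (hp2 ▸ H2) (by rw [s3.read, hp2])
    obtain ⟨C₅, h5, H5⟩ := S.exists_at (A := fun q => q / 3 = l ∨ q = 3 * l₁) (.inr rfl) s4.q_eq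
      (by omega) (H4.mono (by omega))
    refine ⟨C₅, ?_, H5⟩
    exact (((TransGen.head' h1 h2).tail ⟨h3, .inl (by rw [s3.q_eq]; omega)⟩).tail
      ⟨h4, .inr s4.q_eq⟩).trans_left h5
  | dec i lz lnz =>
    rw [hP] at hn hbd
    set A : ℕ → Prop := fun q => q / 3 = l ∨ q = 3 * l' with hA
    obtain ⟨C₁, h1, hq1, hp1, H1⟩ := S.exists_leave (A := A) (.inl (by omega)) (by simp [hP]) H
    obtain ⟨C₂, h2, hq2, hp2, H2⟩ := S.exists_scan (A := A)
      (.inl (by omega)) hbd.1 (fun s hs => by simp [TSym.trans, hP, hs]) hq1 (by omega)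
      (by omega) H1
    have hb := (H2.counts i hbd.1).2
    rw [← hp2] at hb
    have hpos := C.one_le_p
    -- The head steps back to the last cell of the block, or to the mark if the block is empty.
    obtain ⟨C₃, h3, s3⟩ := S.next_eq_singleton (x := (3 * l + 2, _, .left)) hq2 (by omega)
      (by simp only [TSym.trans, hP, hb]; rfl) (.inr (by omega)) H2.nonblank
    have hp3 : C₃.p = C₂.p - 1 := s3.p_eq
    have H3 : Inv (NDTM.read e C₃) C.p (C₂.p + 1) v := by
      rw [s3.read]; exact H2.unmark (by omega)
    have hnb : ∀ x, 1 ≤ x → x < C₃.p → NDTM.read e C₃ x ≠ none :=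
      fun x h1 h2 => H3.nonblank x h1 (by omega)
    by_cases hv : v i = 0
    · simp only [Instr.next, hv, if_true, Set.singleton_eq_singleton_iff, Prod.mk.injEq] at hn
      obtain ⟨rfl, rfl⟩ := hn
      have hp3' : C₃.p = C.p := by omega
      obtain ⟨C₄, h4, s4⟩ := S.next_eq_singleton (x := (3 * lz, mark, .right)) s3.q_eq (by omega)
        (by simp only [TSym.trans, hP, hp3', H3.home]; rfl) (.inl rfl) hnb
      have hp4 : C₄.p = C₃.p + 1 := s4.p_eq
      have H4 : Inv (NDTM.read e C₄) C.p (C₂.p + 1) v := by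
        rw [s4.read, hp3']
        exact Inv.mark hpos H3.clear (fun x h1 h2 _ => H3.nonblank x h1 h2) H3.counts
      obtain ⟨C₅, h5, H5⟩ := S.exists_at (A := A) (.inr rfl) s4.q_eq (by omega)
        (H4.mono (by omega))
      refine ⟨C₅, ?_, H5⟩
      exact (((TransGen.head' h1 h2).tail ⟨h3, .inl (by rw [s3.q_eq]; omega)⟩).tail
        ⟨h4, .inr s4.q_eq⟩).trans_left h5
    · simp only [Instr.next, hv, if_false, Set.singleton_eq_singleton_iff, Prod.mk.injEq] at hn
      obtain ⟨rfl, rfl⟩ := hn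
      obtain ⟨n, hvn⟩ := Nat.exists_eq_succ_of_ne_zero hv
      have hp3' : C₃.p = C.p + 1 + n := by omega
      have hm : marked (NDTM.read e C₃ C₃.p) = false := H3.clear _ (by omega) (by omega)
      obtain ⟨C₄, h4, s4⟩ := S.next_eq_singleton (x := (3 * lnz, _, .left)) s3.q_eq (by omega)
        (by simp only [TSym.trans, hP, hm]; rfl) (.inr (by omega)) hnb
      have hp4 : C₄.p = C₃.p - 1 := s4.p_eq
      have H4 : Inv (NDTM.read e C₄) C.p (C₂.p + 1) (update v i (v i - 1)) := by
        rw [s4.read, hp3', hvn]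
        exact H3.dec hvn
      obtain ⟨C₅, h5, H5⟩ := S.exists_at (A := A) (.inr rfl) s4.q_eq (by omega)
        (H4.mono (by omega))
      refine ⟨C₅, ?_, H5⟩
      exact (((TransGen.head' h1 h2).tail ⟨h3, .inl (by rw [s3.q_eq]; omega)⟩).tail
        ⟨h4, .inr s4.q_eq⟩).trans_left h5

/-- The head goes one cell to the right of the mark and back, so both successors stand on the mark
already and no further return is needed. -/
theorem exists_at_of_jump {l l₁ l₂ : ℕ} {v : ℕ → ℕ} {C : M.Config} (hP : P l = .jump l₁ l₂)
    (H : At e C l v) :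
    ∃ C' C₁ C₂, DetStep (fun q => q / 3 = l) C C' ∧ M.Next C' = {C₁, C₂} ∧
      At e C₁ l₁ v ∧ At e C₂ l₂ v := by
  obtain ⟨C', h1, hq, hp, H1⟩ := S.exists_leave (A := fun q => q / 3 = l) (by omega)
    (by simp [hP]) H
  have hpos := C.one_le_p
  have htr : TSym.trans l (P l) 1 (NDTM.read e C' C'.p) =
      [(3 * l₁, unmark (NDTM.read e C' C'.p), .left),
        (3 * l₂, unmark (NDTM.read e C' C'.p), .left)] := by simp [TSym.trans, hP]
  obtain ⟨C₁, s1⟩ := S.exists_step (x := (3 * l₁, unmark (NDTM.read e C' C'.p), .left)) hq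
    (by omega) (by simp [htr]) (.inr (by omega)) H1.nonblank
  obtain ⟨C₂, s2⟩ := S.exists_step (x := (3 * l₂, unmark (NDTM.read e C' C'.p), .left)) hq
    (by omega) (by simp [htr]) (.inr (by omega)) H1.nonblank
  have hat : ∀ C'' l', IsStep e C' (3 * l', unmark (NDTM.read e C' C'.p), .left) C'' →
      At e C'' l' v := by
    intro C'' l' s
    have hp'' : C''.p = C'.p - 1 := s.p_eq
    have H2 : Inv (NDTM.read e C'') C.p (C'.p + 1) v := by
      rw [s.read]; exact H1.unmark (by omega)
    have hp3 : C''.p = C.p := by omega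
    refine ⟨s.q_eq, .inr (hp3 ▸ H2.home), fun x h1 h2 => H2.nonblank x h1 (by omega), ?_⟩
    rw [hp3]
    exact H2.counts
  refine ⟨C', C₁, C₂, h1, ?_, hat _ _ s1, hat _ _ s2⟩
  ext C''
  rw [S.mem_next, show C'.q.val / 3 = l by omega, show C'.q.val % 3 = 1 by omega, htr]
  simp only [List.mem_cons, List.not_mem_nil, or_false, Set.mem_insert_iff, Set.mem_singleton_iff]
  constructor
  · rintro ⟨x, rfl | rfl, -, s⟩
    exacts [.inl (s.unique s1), .inr (s.unique s2)]
  · rintro (rfl | rfl)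
    exacts [⟨_, .inl rfl, .inr (by omega), s1⟩, ⟨_, .inr rfl, .inr (by omega), s2⟩]

end Simulates

end NDTM

end

section
open Function Relation TSym

/-! ### Infinite sequences -/

theorem exists_seq_of_step {α : Type} {R : α → α → Prop} (Q : ℕ → α → Prop) {a : α} (ha : Q 0 a)
    (h : ∀ i a, Q i a → ∃ b, Q (i + 1) b ∧ R a b) :
    ∃ f : ℕ → α, f 0 = a ∧ ∀ i, Q i (f i) ∧ R (f i) (f (i + 1)) := by
  choose! g hg hR using h
  let f : ℕ → α := fun n => n.rec a g
  have hf : ∀ i, Q i (f i) := fun i => by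
    induction i with
    | zero => exact ha
    | succ i ih => exact hg i _ ih
  exact ⟨f, rfl, fun i => ⟨hf i, hR i _ (hf i)⟩⟩

theorem exists_path_of_transGen {α : Type} {R : α → α → Prop} {a b : α} (h : TransGen R a b) :
    ∃ (n : ℕ) (g : ℕ → α), g 0 = a ∧ g (n + 1) = b ∧ ∀ i ≤ n, R (g i) (g (i + 1)) := by
  induction h with
  | @single b h =>
    refine ⟨0, fun i => if i = 0 then a else b, rfl, rfl, fun i hi => ?_⟩
    obtain rfl : i = 0 := by omega
    simpa using h
  | @tail b c _ h ih =>
    obtain ⟨n, g, h0, hn, hg⟩ := ih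
    refine ⟨n + 1, fun i => if i ≤ n + 1 then g i else c, by simp [h0], by simp, fun i hi => ?_⟩
    rcases Nat.lt_or_ge n i with h1 | h1
    · obtain rfl : i = n + 1 := by omega
      simpa [hn] using h
    · have := hg i h1
      simpa [h1, show i ≤ n + 1 by omega] using this

/-- Concatenation of infinitely many finite paths. -/
theorem exists_infinite_path {α : Type} {R : α → α → Prop} {f : ℕ → α}
    (h : ∀ i, TransGen R (f i) (f (i + 1))) :
    ∃ c : ℕ → α, c 0 = f 0 ∧ (∀ i, R (c i) (c (i + 1))) ∧ ∀ k, ∃ j, k ≤ j ∧ c j = f k := by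
  choose n g h0 hn hg using fun i => exists_path_of_transGen (h i)
  -- At time `j` the walk is on the path with number `(pos j).1`, at its place `(pos j).2`.
  let pos : ℕ → ℕ × ℕ := fun j => j.rec (0, 0) fun _ x =>
    if x.2 = n x.1 then (x.1 + 1, 0) else (x.1, x.2 + 1)
  have hpos : ∀ j, pos (j + 1) =
    if (pos j).2 = n (pos j).1 then ((pos j).1 + 1, 0) else ((pos j).1, (pos j).2 + 1) :=
    fun _ => rfl
  have hle : ∀ j, (pos j).2 ≤ n (pos j).1 := by
    intro j
    induction j with
    | zero => exact Nat.zero_le _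
    | succ j ih =>
      rw [hpos]
      split_ifs with hj
      · exact Nat.zero_le _
      · show (pos j).2 + 1 ≤ n (pos j).1
        omega
  refine ⟨fun j => g (pos j).1 (pos j).2, h0 0, fun j => ?_, fun k => ?_⟩
  · have h1 := hg (pos j).1 (pos j).2 (hle j)
    beta_reduce
    rw [hpos]
    split_ifs with hj
    · rw [hj, hn] at h1
      rwa [h0, hj]
    · exact h1
  · have key : ∀ k, ∃ j, k ≤ j ∧ pos j = (k, 0) := by
      intro k
      induction k with
      | zero => exact ⟨0, le_rfl, rfl⟩
      | succ k ih =>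
        obtain ⟨j, hj, hjk⟩ := ih
        have hi : ∀ i ≤ n k, pos (j + i) = (k, i) := by
          intro i
          induction i with
          | zero => exact fun _ => hjk
          | succ i ih =>
            intro hi
            rw [← Nat.add_assoc, hpos, ih (by omega), if_neg (by simp; omega)]
        exact ⟨j + n k + 1, by omega, by rw [hpos, hi _ le_rfl, if_pos rfl]⟩
    obtain ⟨j, hj, hjk⟩ := key k
    exact ⟨j, hj, by simp only [hjk, h0]⟩

/-! ### Computations of the Turing machine compared with those of the counter machine -/

namespace NDTM
variable {M : NDTM} {K B : ℕ} {P : ℕ → Instr} {e : TSym K ≃ M.Symbol}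

/-- The successor relation of configurations. -/
def Step (M : NDTM) (C C' : M.Config) : Prop := C' ∈ M.Next C

theorem DetStep.step {A : ℕ → Prop} {C C' : M.Config} (h : DetStep A C C') : M.Step C C' := by
  rw [Step, h.1]; rfl

/-- A given computation has no choice but to follow a path of unique successors. The record `A` of
the states on the way later locates the visits to `qr`. -/
theorem run_of_transGen {A : ℕ → Prop} {c : ℕ → M.Config} (hc : ∀ i, c (i + 1) ∈ M.Next (c i))
    {i : ℕ} {C : M.Config} (h : TransGen (DetStep A) (c i) C) :
    ∃ i', i < i' ∧ c i' = C ∧ ∀ j, i < j → j ≤ i' → A (c j).q.val := by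
  induction h with
  | @single C h =>
    have h1 : c (i + 1) = C := by
      have := hc i
      rwa [h.1] at this
    refine ⟨i + 1, by omega, h1, fun j hj hj' => ?_⟩
    obtain rfl : j = i + 1 := by omega
    rw [h1]
    exact h.2
  | @tail C C' _ h ih =>
    obtain ⟨i', hi, hC, hA⟩ := ih
    have h1 : c (i' + 1) = C' := by
      have := hc i'
      rwa [hC, h.1] at this
    refine ⟨i' + 1, by omega, h1, fun j hj hj' => ?_⟩
    rcases Nat.lt_or_ge i' j with h2 | h2
    · obtain rfl : j = i' + 1 := by omega
      rw [h1]
      exact h.2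
    · exact hA j hj h2

namespace Simulates
variable (S : Simulates M K B P e)
include S

theorem label_lt_of_at {C : M.Config} {l : ℕ} {v : ℕ → ℕ} (H : At e C l v) : l < B := by
  have := S.label_lt C
  rwa [H.state, Nat.mul_div_cancel_left _ (by omega)] at this

theorem next_eq_empty {C : M.Config} {l : ℕ} {v : ℕ → ℕ} (H : At e C l v) (hP : P l = .halt) :
    M.Next C = ∅ := by
  have h0 : TSym.trans l (P l) 0 (NDTM.read e C C.p) = [] := by
    have := H.home
    generalize NDTM.read e C C.p = s at this ⊢
    rcases s with _ | a
    · simp [TSym.trans, hP]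
    · have ha : a.1 = true := by simpa [marked] using this
      simp [TSym.trans, hP, ha]
  ext C'
  rw [S.mem_next, H.state, Nat.mul_div_cancel_left _ (by omega), Nat.mul_mod_right, h0]
  simp

/-- Every infinite computation performs the instructions of the counter machine. -/
theorem run_at_next {c : ℕ → M.Config} (hc : ∀ i, c (i + 1) ∈ M.Next (c i)) {i l : ℕ} {v : ℕ → ℕ}
    (H : At e (c i) l v) : ∃ i' l' v', i < i' ∧ (l', v') ∈ (P l).next v ∧ At e (c i') l' v' ∧
      ∀ j, i < j → j ≤ i' → (c j).q.val / 3 = l ∨ (c j).q.val = 3 * l' := by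
  have hlB := S.label_lt_of_at H
  have hdet : ∀ l' v', (∀ l₁ l₂, P l ≠ .jump l₁ l₂) → (P l).next v = {(l', v')} →
      ∃ i' l' v', i < i' ∧ (l', v') ∈ (P l).next v ∧ At e (c i') l' v' ∧
      ∀ j, i < j → j ≤ i' → (c j).q.val / 3 = l ∨ (c j).q.val = 3 * l' := by
    intro l' v' hl hn
    obtain ⟨C', h1, h2⟩ := S.exists_at_of_next_eq hlB hl H hn
    obtain ⟨i', hi, rfl, hA⟩ := run_of_transGen hc h1
    exact ⟨i', l', v', hi, by rw [hn]; rfl, h2, hA⟩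
  cases hP : P l with
  | halt =>
    have := hc i
    rw [S.next_eq_empty H hP] at this
    exact this.elim
  | inc k l₁ => rw [← hP]; exact hdet _ _ (by simp [hP]) (by rw [hP]; rfl)
  | dec k lz lnz =>
    rw [← hP]
    by_cases hv : v k = 0
    · exact hdet lz v (by simp [hP]) (by rw [hP]; simp [Instr.next, hv])
    · exact hdet lnz (update v k (v k - 1)) (by simp [hP]) (by rw [hP]; simp [Instr.next, hv])
  | jump l₁ l₂ =>
    obtain ⟨C', C₁, C₂, h1, h2, h3, h4⟩ := S.exists_at_of_jump hP H
    have e1 : c (i + 1) = C' := by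
      have := hc i
      rwa [h1.1] at this
    have e2 : c (i + 2) = C₁ ∨ c (i + 2) = C₂ := by
      have := hc (i + 1)
      rwa [e1, h2] at this
    have hj : ∀ j, i < j → j ≤ i + 2 → j = i + 1 ∨ j = i + 2 := fun j _ _ => by omega
    rcases e2 with e2 | e2
    · refine ⟨i + 2, l₁, v, by omega, .inl rfl, e2 ▸ h3, fun j h5 h6 => ?_⟩
      rcases hj j h5 h6 with rfl | rfl
      · rw [e1]; exact .inl h1.2
      · rw [e2]; exact .inr h3.state
    · refine ⟨i + 2, l₂, v, by omega, .inr rfl, e2 ▸ h4, fun j h5 h6 => ?_⟩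
      rcases hj j h5 h6 with rfl | rfl
      · rw [e1]; exact .inl h1.2
      · rw [e2]; exact .inr h4.state

theorem run_at_det {c : ℕ → M.Config} (hc : ∀ i, c (i + 1) ∈ M.Next (c i)) {s t : ℕ × (ℕ → ℕ)}
    (hst : Instr.Det P s t) {i : ℕ} (H : At e (c i) s.1 s.2) :
    ∃ i', i ≤ i' ∧ At e (c i') t.1 t.2 := by
  induction hst with
  | refl => exact ⟨i, le_rfl, H⟩
  | tail _ h ih =>
    obtain ⟨i₁, h1, H1⟩ := ih
    obtain ⟨i₂, l', v', h2, h3, h4, -⟩ := S.run_at_next hc H1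
    rw [h] at h3
    cases h3
    exact ⟨i₂, by omega, h4⟩

/-- Whatever the tape, an infinite computation that comes to the state `3 * l` begins to perform
the instruction with label `l`. -/
theorem run_at {c : ℕ → M.Config} (hc : ∀ i, c (i + 1) ∈ M.Next (c i)) {i l : ℕ}
    (hq : (c i).q.val = 3 * l) :
    ∃ i' v, i ≤ i' ∧ (∀ r, K ≤ r → v r = 0) ∧ At e (c i') l v := by
  obtain ⟨n, hn⟩ : ∃ n, (c i).p = n := ⟨_, rfl⟩
  induction n generalizing i with
  | zero => have := (c i).one_le_p; omega
  | succ n ih =>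
    by_cases hh : NDTM.read e (c i) (c i).p = none ∨ marked (NDTM.read e (c i) (c i).p) = true
    -- Beyond the length `n` all cells are blank, so every block of bits is finite. The counters are
    -- read off as the lengths of the blocks that follow the head.
    · have hb : ∀ k, ∃ j, bitAt (NDTM.read e (c i) ((c i).p + 1 + j)) k = false := by
        refine fun k => ⟨(c i).n, ?_⟩
        rw [NDTM.read, (c i).outside _ (by omega)]
        rfl
      refine ⟨i, fun k => if k < K then Nat.find (hb k) else 0, le_rfl,
        fun r hr => if_neg (by omega), hq, hh, fun x hx hx' => ?_, fun k hk => ?_⟩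
      -- There is no blank left of the head: the next configuration exists and has a symbol at the
      -- old head position, hence symbols in all cells before it, and these cells are unchanged.
      · obtain ⟨y, -, -, hy⟩ := S.mem_next.1 (hc i)
        have hp : (c i).p ≤ (c (i + 1)).p + 1 := by rw [hy.p_eq]; cases y.2.2 <;> simp <;> omega
        have h1 : ∀ x, 1 ≤ x → x < (c i).p → (c (i + 1)).t x = none → False := by
          intro x hx hx' h
          have hind : ∀ d, x + d ≤ (c i).p → (c (i + 1)).t (x + d) = none := by
            intro d
            induction d with
            | zero => exact fun _ => h
            | succ d ih =>
              intro hd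
              have h2 := (c i).p_le_n
              have h3 := hy.n_eq
              exact (c (i + 1)).blank_succ (x + d) (by omega) (by omega) (ih (by omega))
          have := hind ((c i).p - x) (by omega)
          rw [Nat.add_sub_cancel' hx'.le, hy.t_eq, update_self] at this
          cases this
        intro h
        refine h1 x hx hx' ?_
        rw [hy.t_eq, update_of_ne (by omega)]
        simpa [NDTM.read] using h
      · simp only [hk, if_true]
        exact ⟨fun j hj => by simpa using Nat.find_min (hb k) hj, Nat.find_spec (hb k)⟩
    -- On an unmarked symbol the only transition goes left in the same state. The head position
    -- decreases, which cannot go on forever.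
    · simp only [not_or, Bool.not_eq_true] at hh
      obtain ⟨a, -, ht⟩ := trans_left l (P l) hh.1 hh.2
      have h1 := S.mem_next.1 (hc i)
      rw [hq, Nat.mul_div_cancel_left _ (by omega), Nat.mul_mod_right, ht] at h1
      obtain ⟨x, hx, -, s⟩ := h1
      obtain rfl := List.mem_singleton.1 hx
      have hp : (c (i + 1)).p = (c i).p - 1 := s.p_eq
      obtain ⟨i', v, h2, h3⟩ := ih s.q_eq (by omega)
      exact ⟨i', v, by omega, h3⟩

/-- The Turing machine can perform every step of the counter machine. -/
theorem exists_transGen {C : M.Config} {l l' : ℕ} {v v' : ℕ → ℕ} (H : At e C l v)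
    (hn : (l', v') ∈ (P l).next v) : ∃ C', TransGen M.Step C C' ∧ At e C' l' v' := by
  have hlB := S.label_lt_of_at H
  have hdet : (∀ l₁ l₂, P l ≠ .jump l₁ l₂) → (P l).next v = {(l', v')} →
      ∃ C', TransGen M.Step C C' ∧ At e C' l' v' := by
    intro hl hn
    obtain ⟨C', h1, h2⟩ := S.exists_at_of_next_eq hlB hl H hn
    exact ⟨C', TransGen.mono (fun _ _ h => DetStep.step h) _ _ h1, h2⟩
  cases hP : P l with
  | halt => rw [hP] at hn; exact hn.elim
  | inc k l₁ =>
    refine hdet (by simp [hP]) ?_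
    rw [hP] at hn ⊢
    cases hn
    rfl
  | dec k lz lnz =>
    refine hdet (by simp [hP]) ?_
    rw [hP] at hn ⊢
    by_cases hv : v k = 0
    · simp only [Instr.next, hv, if_true] at hn ⊢
      rw [Set.mem_singleton_iff.1 hn]
    · simp only [Instr.next, hv, if_false] at hn ⊢
      rw [Set.mem_singleton_iff.1 hn]
  | jump l₁ l₂ =>
    obtain ⟨C', C₁, C₂, h1, h2, h3, h4⟩ := S.exists_at_of_jump hP H
    rw [hP] at hn
    rcases hn with hn | hn
    · cases hn
      exact ⟨C₁, .head h1.step (.single (by rw [Step, h2]; exact .inl rfl)), h3⟩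
    · cases hn
      exact ⟨C₂, .head h1.step (.single (by rw [Step, h2]; exact .inr rfl)), h4⟩

theorem exists_reflTransGen {s t : ℕ × (ℕ → ℕ)} (hst : Instr.Det P s t) {C : M.Config}
    (H : At e C s.1 s.2) : ∃ C', ReflTransGen M.Step C C' ∧ At e C' t.1 t.2 := by
  induction hst with
  | refl => exact ⟨C, .refl, H⟩
  | @tail t t' _ h ih =>
    obtain ⟨C₁, h1, H1⟩ := ih
    obtain ⟨C₂, h2, H2⟩ := S.exists_transGen (l' := t'.1) (v' := t'.2) H1 (by rw [h]; rfl)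
    exact ⟨C₂, h1.trans h2.to_reflTransGen, H2⟩

end Simulates

end NDTM

end

section
open Function Relation TSym

/-! ### Correctness of the search program on Turing machines -/

namespace Search
open Instr NDTM

theorem program_count {p : Prog} {n s y l' : ℕ} {v' : ℕ → ℕ}
    (h : (l', v') ∈ (program p n 1).next (guessed n s y)) :
    l' = guessLabel p ∧ v' = guessed n s (y + 1) := by
  rw [(spec_program p n).count] at h
  cases h
  refine ⟨rfl, ?_⟩
  simp [guessed]

variable {p : Prog} {T : ℕ → ℕ → ℕ → Prop} {f : ℕ → ℕ → ℕ → ℕ} {M : NDTM} {n : ℕ}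
  {e : TSym (numRegs p) ≃ M.Symbol}
  (S : Simulates M (numRegs p) (guessLabel p + n + 1) (program p n) e)
include S

/-- Recurrence forces the guess to end. The loop between `guessLabel p` and label `1` avoids the
round label, so all its rounds lie before the visit at time `j`, and `j - i` decreases with each of
them. -/
theorem run_at_check {c : ℕ → M.Config} (hc : ∀ i, c (i + 1) ∈ M.Next (c i)) {i j s y : ℕ}
    (hij : i ≤ j) (hj : (c j).q.val = 3 * roundLabel p)
    (H : At e (c i) (guessLabel p) (guessed n s y)) :
    ∃ i' y', i ≤ i' ∧ At e (c i') 2 (guessed n s y') := by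
  obtain ⟨d, hd⟩ : ∃ d, j - i = d := ⟨_, rfl⟩
  induction d using Nat.strong_induction_on generalizing i y with
  | _ d ih =>
    have hg : roundLabel p < guessLabel p ∧ 3 ≤ roundLabel p := by
      unfold roundLabel guessLabel; omega
    obtain ⟨i₁, l₁, v₁, h1, h2, H1, h3⟩ := S.run_at_next hc H
    rw [(spec_program p n).guess] at h2
    rcases h2 with h2 | h2
    · cases h2
      obtain ⟨i₂, l₂, v₂, h4, h5, H2, h6⟩ := S.run_at_next hc H1
      obtain ⟨rfl, rfl⟩ := program_count h5
      have h7 : i ≠ j := by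
        rintro rfl
        have := H.state
        omega
      -- Otherwise time `j` would fall within this pass through the loop, where all states belong to
      -- the labels `1` and `guessLabel p`.
      have h8 : i₂ ≤ j := by
        by_contra h
        rcases Nat.lt_or_ge i₁ j with h9 | h9
        · have := h6 j h9 (by omega)
          omega
        · have := h3 j (by omega) h9
          omega
      obtain ⟨i', y', h9, H'⟩ := ih (j - i₂) (by omega) h8 H2 rfl
      exact ⟨i', y', by omega, H'⟩
    · cases h2
      exact ⟨i₁, y, by omega, H1⟩

variable (hf : ∀ n s y, f n s y = 0 ↔ ¬ T n s y)
  (hp : ∀ n s y, Prog.Eval p (guessed n s y) (update (guessed n s y) 3 (f n s y)))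
include hf hp

/-- The reset keeps only register `2`, so nothing need be known about the other registers below
`numRegs p`. The next guess must pass the check, as a failing check leads to a configuration without
successors. -/
theorem run_at_round {c : ℕ → M.Config} (hc : ∀ i, c (i + 1) ∈ M.Next (c i))
    (hrec : ∀ i, ∃ j, i ≤ j ∧ (c j).q.val = 3 * roundLabel p) {i : ℕ} {u : ℕ → ℕ}
    (hu : ∀ r, numRegs p ≤ r → u r = 0) (H : At e (c i) (roundLabel p) u) :
    ∃ i' u', (∀ r, numRegs p ≤ r → u' r = 0) ∧ At e (c i') (roundLabel p) u' ∧
      T n (u 2) (u' 2) := by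
  obtain ⟨i₁, -, H1⟩ := S.run_at_det hc ((det_reset p n hu).trans (det_init p n (u 2))) H
  obtain ⟨j, hj, hq⟩ := hrec i₁
  obtain ⟨i₂, y, -, H2⟩ := run_at_check S hc hj hq H1
  rcases det_check hf hp n (u 2) y with ⟨hT, v, rfl, hv, hdet⟩ | ⟨-, v, hdet⟩
  · obtain ⟨i₃, -, H3⟩ := S.run_at_det hc hdet H2
    exact ⟨i₃, v, hv, H3, hT⟩
  · obtain ⟨i₃, -, H3⟩ := S.run_at_det hc hdet H2
    have := hc i₃
    rw [S.next_eq_empty H3 (spec_program p n).halt] at this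
    exact this.elim

/-- A recurring computation of the Turing machine yields an infinite chain. -/
theorem exists_chain_of_recurs {c : ℕ → M.Config} {qr : M.State} (hq : qr.val = 3 * roundLabel p)
    (hc : M.Recurs qr c) : ∃ σ : ℕ → ℕ, ∀ i, T n (σ i) (σ (i + 1)) := by
  have hrec : ∀ i, ∃ j, i ≤ j ∧ (c j).q.val = 3 * roundLabel p := fun i =>
    (hc.2 i).imp fun j hj => ⟨hj.1, by rw [hj.2, hq]⟩
  obtain ⟨j, -, hj⟩ := hrec 0
  obtain ⟨i, u, -, hu, H⟩ := S.run_at hc.1 hj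
  -- Dependent choice along the rounds. The first value `u 2` comes from an arbitrary tape, so the
  -- chain may start anywhere.
  obtain ⟨g, -, hg⟩ := exists_seq_of_step (R := fun u u' : ℕ → ℕ => T n (u 2) (u' 2))
    (fun _ u => (∀ r, numRegs p ≤ r → u r = 0) ∧ ∃ i, At e (c i) (roundLabel p) u)
    ⟨hu, i, H⟩ fun _ u ⟨hu, i, H⟩ => by
      obtain ⟨i', u', hu', H', hT⟩ := run_at_round S hf hp hc.1 hrec hu H
      exact ⟨u', ⟨hu', i', H'⟩, hT⟩
  exact ⟨fun i => g i 2, fun i => (hg i).2⟩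

omit hf hp in
theorem exists_guess {s : ℕ} (y : ℕ) {C : M.Config}
    (H : At e C (guessLabel p) (guessed n s 0)) :
    ∃ C', ReflTransGen M.Step C C' ∧ At e C' (guessLabel p) (guessed n s y) := by
  induction y with
  | zero => exact ⟨C, .refl, H⟩
  | succ y ih =>
    obtain ⟨C₁, h1, H1⟩ := ih
    obtain ⟨C₂, h2, H2⟩ := S.exists_transGen (l' := 1) (v' := guessed n s y) H1
      (by rw [(spec_program p n).guess]; exact .inl rfl)
    obtain ⟨C₃, h3, H3⟩ := S.exists_transGen (l' := guessLabel p) (v' := guessed n s (y + 1)) H2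
      (by rw [(spec_program p n).count]; simp [Instr.next, guessed])
    exact ⟨C₃, h1.trans (h2.to_reflTransGen.trans h3.to_reflTransGen), H3⟩

theorem exists_round {C : M.Config} {s y : ℕ} (H : At e C 0 (base s)) (hT : T n s y) :
    ∃ C' C'', TransGen M.Step C C' ∧ C'.q.val = 3 * roundLabel p ∧ ReflTransGen M.Step C' C'' ∧
      At e C'' 0 (base y) := by
  obtain ⟨C₁, h1, H1⟩ := S.exists_reflTransGen (det_init p n s) H
  obtain ⟨C₂, h2, H2⟩ := exists_guess S y H1
  obtain ⟨C₃, h3, H3⟩ := S.exists_transGen (l' := 2) (v' := guessed n s y) H2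
    (by rw [(spec_program p n).guess]; exact .inr rfl)
  rcases det_check hf hp n s y with ⟨-, v, rfl, hv, hdet⟩ | ⟨h, -⟩
  · obtain ⟨C₄, h4, H4⟩ := S.exists_reflTransGen hdet H3
    obtain ⟨C₅, h5, H5⟩ := S.exists_reflTransGen (det_reset p n hv) H4
    exact ⟨C₄, C₅, .trans_left (.trans_right (h1.trans h2) h3) h4, H4.state, h5, H5⟩
  · exact (h hT).elim

/-- An infinite chain yields a recurring computation of the Turing machine. -/
theorem exists_recurs_of_chain {qr : M.State} (hq : qr.val = 3 * roundLabel p) {σ : ℕ → ℕ}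
    (h0 : σ 0 = 0) (hσ : ∀ i, T n (σ i) (σ (i + 1))) :
    ∃ c, c 0 = M.start [] ∧ M.Recurs qr c := by
  -- The blank tape represents counters that are all zero, hence the number `0` as the current node;
  -- this is why the chain has to start there.
  have hstart : At e (M.start []) 0 (base (σ 0)) := by
    have hb : base (σ 0) = 0 := by simp [base, h0]
    have hread : ∀ x, NDTM.read e (M.start []) x = none := by
      rintro (_ | x) <;> simp [NDTM.read, NDTM.start, NDTM.inputTape]
    rw [hb]
    refine ⟨rfl, .inl (hread _), fun x hx hx' => ?_, fun k hk => ⟨fun j hj => ?_, ?_⟩⟩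
    · have : x < 1 := hx'
      omega
    · exact absurd hj (Nat.not_lt_zero _)
    · rw [hread]; rfl
  -- Except for the first, the chosen configurations are those in the state `qr`; each can still
  -- reach the beginning of the next round with the node `σ i`.
  obtain ⟨g, hg0, hg⟩ := exists_seq_of_step (R := TransGen M.Step)
    (fun i C => (∃ C', ReflTransGen M.Step C C' ∧ At e C' 0 (base (σ i))) ∧
      (i = 0 ∨ C.q.val = 3 * roundLabel p)) ⟨⟨_, .refl, hstart⟩, .inl rfl⟩
    fun i C ⟨⟨C', h1, H⟩, _⟩ => by
      obtain ⟨C₁, C₂, h2, h3, h4, H'⟩ := exists_round S hf hp H (hσ i)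
      exact ⟨C₁, ⟨⟨C₂, h4, H'⟩, .inr h3⟩, .trans_right h1 h2⟩
  obtain ⟨c, hc0, hc, hcg⟩ := exists_infinite_path fun i => (hg i).2
  refine ⟨c, hc0.trans hg0, hc, fun i => ?_⟩
  obtain ⟨j, hj, hcj⟩ := hcg (i + 1)
  refine ⟨j, by omega, Fin.ext ?_⟩
  rw [hcj, hq]
  exact (hg (i + 1)).1.2.resolve_left (by omega)

end Search

end

section
open Function Relation TSym Encodable

/-! ### Descriptions of the search machines -/

namespace NDTM
open Search

/-- The numerical code of a move. -/
def dirCode : Dir → Bool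
  | .left => false
  | .right => true

theorem dirCode_injective : Injective dirCode := by
  rintro (_ | _) (_ | _) h <;> first | rfl | cases h

theorem transitionBounded_mk {k m q r : ℕ} {s : Option (Fin (m + 2))} {a : Fin (m + 2)} {d : Bool}
    (hq : q < k + 1) (hr : r < k + 1) : TransitionBounded k m (q, s.map Fin.val, r, a.val, d) := by
  refine ⟨hq, ?_, hr, a.2⟩
  rcases s with _ | s
  · simp
  · have := s.2
    simp

variable {K m : ℕ} (e : TSym K ≃ Fin (m + 2))

/-- The phases of the simulation of an instruction, together with the symbol that is read. -/
noncomputable def situations (K : ℕ) : List (ℕ × Option (TSym K)) :=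
  [0, 1, 2] ×ˢ (Finset.univ : Finset (Option (TSym K))).toList

theorem mem_situations {ph : ℕ} {s : Option (TSym K)} : (ph, s) ∈ situations K ↔ ph < 3 := by
  simp [situations]
  omega

/-- The codes of the transitions for the instruction `I` with label `l`. -/
noncomputable def labelTransitions (l : ℕ) (I : Instr) : List Transition :=
  (situations K).flatMap fun x => (trans l I x.1 x.2).map fun y =>
    (3 * l + x.1, (x.2.map e).map Fin.val, y.1, (e y.2.1).val, dirCode y.2.2)

theorem mem_labelTransitions {l : ℕ} {I : Instr} {q r : ℕ} {s : Option (Fin (m + 2))}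
    {a : Fin (m + 2)} {d : Dir} :
    (q, s.map Fin.val, r, a.val, dirCode d) ∈ labelTransitions e l I ↔
      q / 3 = l ∧ (r, e.symm a, d) ∈ trans l I (q % 3) (s.map e.symm) := by
  simp only [labelTransitions, List.mem_flatMap, List.mem_map]
  constructor
  · rintro ⟨⟨ph, s'⟩, hx, ⟨r', a', d'⟩, hy, h⟩
    have hph := mem_situations.1 hx
    simp only [Prod.mk.injEq, Fin.val_inj] at h
    obtain ⟨rfl, h2, rfl, rfl, h5⟩ := h
    obtain rfl := dirCode_injective h5
    obtain rfl := Option.map_injective Fin.val_injective h2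
    have h1 : (3 * l + ph) / 3 = l := by omega
    have h2 : (3 * l + ph) % 3 = ph := by omega
    refine ⟨h1, ?_⟩
    rw [h2]
    simpa using hy
  · rintro ⟨rfl, h⟩
    refine ⟨(q % 3, s.map e.symm), mem_situations.2 (Nat.mod_lt _ (by omega)), _, h, ?_⟩
    simp [Nat.div_add_mod]

/-- The description of a Turing machine that performs the search program for the input `n`. -/
noncomputable def searchDescription {p : Prog} (e : TSym (numRegs p) ≃ Fin (m + 2)) (n : ℕ) :
    Description :=
  (3 * (guessLabel p + n) + 2, m, 3 * roundLabel p,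
    (List.range (guessLabel p + n + 1)).flatMap fun l => labelTransitions e l (program p n l))

variable {p : Prog} (e : TSym (numRegs p) ≃ Fin (m + 2)) (n : ℕ)

theorem valid_searchDescription : (searchDescription e n).Valid := by
  refine ⟨?_, fun y hy => ?_⟩
  · show 3 * roundLabel p < 3 * (guessLabel p + n) + 2 + 1
    unfold roundLabel guessLabel
    omega
  · simp only [searchDescription, List.mem_flatMap, List.mem_range, labelTransitions,
      List.mem_map] at hy
    obtain ⟨l, hl, ⟨ph, s⟩, hx, z, hz, rfl⟩ := hy
    have := trans_bounded hl (bounded_program p hl) z hz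
    have := mem_situations.1 hx
    refine transitionBounded_mk ?_ ?_
    · show 3 * l + ph < 3 * (guessLabel p + n) + 2 + 1
      omega
    · show z.1 < 3 * (guessLabel p + n) + 2 + 1
      omega

theorem simulates_searchDescription :
    Simulates (ofDescription (searchDescription e n)) (numRegs p) (guessLabel p + n + 1)
      (program p n) e := by
  refine ⟨rfl, fun l hl => bounded_program p hl, fun s q r a d => ?_⟩
  have hq : q.val < 3 * (guessLabel p + n) + 2 + 1 := q.2
  have h1 : (r, a, d) ∈ (ofDescription (searchDescription e n)).δ s q ↔
      (q.val, s.map Fin.val, r.val, a.val, dirCode d) ∈ (searchDescription e n).2.2.2 := by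
    cases d <;> rfl
  rw [h1]
  simp only [searchDescription, List.mem_flatMap, List.mem_range]
  constructor
  · rintro ⟨l, -, h⟩
    obtain ⟨rfl, h⟩ := (mem_labelTransitions e).1 h
    exact h
  · intro h
    exact ⟨q.val / 3, by omega, (mem_labelTransitions e).2 ⟨rfl, h⟩⟩

/-! ### Computability of the description -/

/-- The list `L` is fixed, so only the finitely many functions `f · b` matter. Hence the
noncomputable choice of an enumeration of the symbols does not affect primitive recursiveness. -/
theorem primrec_flatMap_const {α β γ : Type} [Primcodable α] [Primcodable γ] (L : List β)
    {f : α → β → List γ} (h : ∀ b ∈ L, Primrec fun a => f a b) :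
    Primrec fun a => L.flatMap (f a) := by
  induction L with
  | nil => exact .const []
  | cons b L ih =>
    simp only [List.flatMap_cons]
    exact Primrec.list_append.comp (h b (by simp)) (ih fun b hb => h b (by simp [hb]))

theorem primrec_entry {α : Type} [Primcodable α] {q r : α → ℕ} (hq : Primrec q) (hr : Primrec r)
    (s : Option ℕ) (a : ℕ) (d : Bool) :
    Primrec fun x => ((q x, s, r x, a, d) : Transition) :=
  hq.pair ((Primrec.const s).pair (hr.pair (.const (a, d))))

theorem primrec_mul_add {α : Type} [Primcodable α] {l : α → ℕ} (hl : Primrec l) (c : ℕ) :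
    Primrec fun x => 3 * l x + c :=
  Primrec.nat_add.comp (Primrec.nat_mul.comp (.const 3) hl) (.const c)

/-- In every fixed situation the symbols and moves are constants, and the argument enters only
through states of the form `3 * l + c`. -/
theorem primrec_labelTransitions_jump {α : Type} [Primcodable α] {l t t' : α → ℕ} (hl : Primrec l)
    (ht : Primrec t) (ht' : Primrec t') :
    Primrec fun x => labelTransitions e (l x) (.jump (t x) (t' x)) := by
  refine primrec_flatMap_const _ fun ⟨ph, s⟩ hx => ?_
  have hph := mem_situations.1 hx
  have h3 := primrec_mul_add hl
  have h0 := fun {t : α → ℕ} (ht : Primrec t) => primrec_mul_add ht 0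
  simp only [Nat.add_zero] at h0
  interval_cases ph <;> rcases s with _ | ⟨b, s⟩ <;> try cases b
  all_goals
    simp only [TSym.trans, Bool.false_eq_true, if_true, if_false, List.map_cons, List.map_nil]
    repeat' first
      | exact .const _
      | exact primrec_entry (h3 _) (h3 _) _ _ _
      | exact primrec_entry (h3 _) (h0 hl) _ _ _
      | exact primrec_entry (h3 _) (h0 ht) _ _ _
      | exact primrec_entry (h3 _) (h0 ht') _ _ _
      | refine Primrec.list_cons.comp ?_ ?_

theorem primrec_labelTransitions_inc {α : Type} [Primcodable α] {l t : α → ℕ} (hl : Primrec l)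
    (ht : Primrec t) (i : ℕ) : Primrec fun x => labelTransitions e (l x) (.inc i (t x)) := by
  refine primrec_flatMap_const _ fun ⟨ph, s⟩ hx => ?_
  have hph := mem_situations.1 hx
  have h3 := primrec_mul_add hl
  have h0 := fun {t : α → ℕ} (ht : Primrec t) => primrec_mul_add ht 0
  simp only [Nat.add_zero] at h0
  interval_cases ph <;> rcases s with _ | ⟨b, s⟩ <;> try cases b
  all_goals
    simp only [TSym.trans, Bool.false_eq_true, if_true, if_false]
    try split_ifs
  all_goals
    simp only [List.map_cons, List.map_nil]
    refine Primrec.list_cons.comp ?_ (.const _)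
    first
      | exact primrec_entry (h3 _) (h3 _) _ _ _
      | exact primrec_entry (h3 _) (h0 hl) _ _ _
      | exact primrec_entry (h3 _) (h0 ht) _ _ _

/-- The check `p`, the alphabet and its numbering `e` do not depend on `n`; the input affects only
the target of the initial jump and the number of increments. -/
theorem primrec_searchDescription : Primrec (searchDescription e) := by
  have hg : Primrec fun n => guessLabel p + n := Primrec.nat_add.comp (.const _) .id
  have hfst : Primrec (Prod.fst : ℕ × ℕ → ℕ) := .fst
  have hsnd : Primrec (Prod.snd : ℕ × ℕ → ℕ) := .snd
  have hzero : Primrec fun x : ℕ × ℕ =>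
      labelTransitions e x.2 (.jump (guessLabel p + x.1) (guessLabel p + x.1)) :=
    primrec_labelTransitions_jump e hsnd (hg.comp hfst) (hg.comp hfst)
  have hinc : Primrec fun x : ℕ × ℕ => labelTransitions e x.2 (.inc 0 (x.2 - 1)) :=
    primrec_labelTransitions_inc e hsnd (Primrec.nat_sub.comp hsnd (.const 1)) 0
  -- The transitions for the fixed part form a finite table, so they are found by looking up the
  -- label in a constant list.
  let L : List (List Transition) := (List.range (guessLabel p + 1)).map fun l =>
    labelTransitions e l ((fixedPart p).getD l .halt)
  have hfix : Primrec fun x : ℕ × ℕ => L.getD x.2 [] :=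
    (Primrec.list_getD []).comp (.const L) hsnd
  have hcase : Primrec fun x : ℕ × ℕ => labelTransitions e x.2 (program p x.1 x.2) := by
    refine (Primrec.ite (Primrec.eq.comp hsnd (.const 0)) hzero
      (Primrec.ite (Primrec.nat_lt.comp hsnd (.const (guessLabel p + 1))) hfix hinc)).of_eq
      fun x => ?_
    unfold program
    split_ifs with h1 h2
    · rfl
    · simp [L, List.getD_eq_getElem?_getD, h2]
    · rfl
  exact (primrec_mul_add hg 2).pair ((Primrec.const m).pair ((Primrec.const _).pair
    (Primrec.list_flatMap (Primrec.list_range.comp (Primrec.succ.comp hg)) hcase.to₂)))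

end NDTM

/-! ### The reduction and completeness -/

open NDTM Search

/-- There is a program for the check in the search program. -/
theorem Search.exists_prog {T : ℕ → ℕ → ℕ → Prop}
    (hT : PrimrecPred fun a : ℕ × ℕ × ℕ => T a.1 a.2.1 a.2.2) :
    ∃ (f : ℕ → ℕ → ℕ → ℕ) (p : Prog), (∀ n s y, f n s y = 0 ↔ ¬ T n s y) ∧
      ∀ n s y, Prog.Eval p (guessed n s y) (update (guessed n s y) 3 (f n s y)) := by
  classical
  let f : ℕ → ℕ → ℕ → ℕ := fun n s y => if T n s y then 1 else 0
  have hf : Primrec fun v : List.Vector ℕ 3 => f (v.get 0) (v.get 1) (v.get 2) := by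
    have hv : ∀ i : Fin 3, Primrec fun v : List.Vector ℕ 3 => v.get i := fun i =>
      Primrec.vector_get.comp .id (.const i)
    exact Primrec.ite (hT.comp ((hv 0).pair ((hv 1).pair (hv 2)))) (.const 1) (.const 0)
  -- The inputs `n`, `s`, `y` are in the registers `0`, `1`, `2`, the result goes to `3`, and the
  -- registers from `4` on are free.
  obtain ⟨p, hp⟩ := Prog.computes_of_primrec (Nat.Primrec'.prim_iff.2 hf) (fun i => i.val) 3 4
    (fun i => by omega) (by omega) (fun i => by omega)
  refine ⟨f, p, fun n s y => by simp [f], fun n s y => ?_⟩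
  have h := hp (guessed n s y) fun r hr => by
    simp only [guessed, base, update_apply, Pi.zero_apply]
    split_ifs <;> omega
  simpa [guessed, base] using h

/-- Every `Π¹₁` set reduces to robust non-recurrence, with negative instances mapped to machines
that recur on the empty word. -/
theorem IsPi11.exists_reduction {B : Set ℕ} (hB : IsPi11 B) :
    ∃ (x : ℕ → Description) (hx : ∀ n, (x n).Valid), Primrec x ∧
      (∀ n ∈ B, (ofDescription (x n)).RobustNonRecurring ⟨(x n).2.2.1, (hx n).1⟩) ∧
      ∀ n ∉ B, ¬ (ofDescription (x n)).NonRecurringOn ⟨(x n).2.2.1, (hx n).1⟩ [] := by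
  obtain ⟨T, hT, hc, hs⟩ := hB.exists_chain
  obtain ⟨f, p, hf, hp⟩ := exists_prog hT
  -- The component for the mark alone provides two symbols, as many as the format `Fin (m + 2)` of
  -- the alphabet demands.
  obtain ⟨m, hm⟩ : ∃ m, Fintype.card (TSym (numRegs p)) = m + 2 := by
    obtain ⟨m, hm⟩ := Nat.exists_eq_add_of_le (Fintype.one_lt_card (α := TSym (numRegs p)))
    exact ⟨m, by omega⟩
  let e := Fintype.equivFinOfCardEq hm
  refine ⟨searchDescription e, valid_searchDescription e, primrec_searchDescription e,
    fun n hn ρ => ?_, fun n hn h => ?_⟩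
  · rw [nonRecurringFrom_iff]
    rintro ⟨c, -, hrec⟩
    obtain ⟨σ, hσ⟩ := exists_chain_of_recurs (simulates_searchDescription e n) hf hp rfl hrec
    exact hs n σ hσ hn
  · rw [NonRecurringOn, nonRecurringFrom_iff] at h
    obtain ⟨σ, h0, hσ⟩ := hc n hn
    exact h (exists_recurs_of_chain (simulates_searchDescription e n) hf hp rfl h0 hσ)

/-- A property between robust non-recurrence and non-recurrence on the empty word is complete as
soon as it is `Π¹₁`. -/
theorem isPi11Complete_codesOf {P : (M : NDTM) → M.State → Prop} (hP : IsPi11 (codesOf P))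
    (h1 : ∀ M qr, M.RobustNonRecurring qr → P M qr)
    (h2 : ∀ M qr, P M qr → M.NonRecurringOn qr []) : IsPi11Complete (codesOf P) := by
  refine ⟨hP, fun B hB => ?_⟩
  obtain ⟨x, hx, hxp, hpos, hneg⟩ := hB.exists_reduction
  refine ⟨fun n => encode (x n), (Primrec.encode.comp hxp).to_comp, fun n => ?_⟩
  show n ∈ B ↔ encode (x n) ∈ codesOf P
  rw [mem_codesOf]
  constructor
  · exact fun hn => ⟨x n, rfl, hx n, h1 _ _ (hpos n hn)⟩
  · rintro ⟨y, hy, hyv, h⟩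
    obtain rfl := encode_injective hy
    by_contra hn
    exact hneg n hn (h2 _ _ h)

end

theorem mainTheorem5 :
    IsPi11Complete (NDTM.codesOf fun M qr => M.NonRecurringOn qr []) ∧
    IsPi11Complete (NDTM.codesOf fun M qr => M.UniversallyNonRecurring qr) ∧
    IsPi11Complete (NDTM.codesOf fun M qr => M.RobustNonRecurring qr) :=
  ⟨isPi11Complete_codesOf NDTM.isPi11_nonRecurringOn_nil (fun M _ h => h (M.start [])) fun _ _ h => h,
    isPi11Complete_codesOf NDTM.isPi11_universallyNonRecurring (fun M _ h w => h (M.start w))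
      fun _ _ h => h [],
    isPi11Complete_codesOf NDTM.isPi11_robustNonRecurring (fun _ _ h => h) fun M _ h => h (M.start [])⟩
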